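/- **Theorem (correctness and running time of the balancing algorithm).** *Straight models.* Let $T$ be a finite tree with $\Delta(T)\le 4$. An *s-model* (straight model) $M$ of $T$ places the vertices of $T$ at distinct points of the rectangular grid $\mathbb Z^2$ and draws every edge as a straight segment of a grid line, such that no vertex lies on an edge of which it is not an endpoint and two different edges meet at most in a common endpoint. The number of bends of a path of $T$ in $M$ is the number of inner vertices of the path at which its drawing turns. Let $b(M)$ be the maximum number of bends of a leaf-to-leaf path in $M$ (with $b(M)=0$ if $T$ has only one vertex), and $b(T)=\min\{b(M): M \text{ an s-model of } T\}$. For a vertex $p$ and a vertex $v\neq p$ let $b^\ell_M(p,v)$ be the maximum number of bends of a path from $p$ through $v$ to a leaf. A vertex $v$ with neighbours $N(v)$ is completed by $4-|N(v)|$ *virtual* neighbours; a real neighbour $u$ has the value $b^\ell_M(v,u)$, a virtual one the value $-1$. The vertex $v$ is *balanced* in $M$ if its four neighbours can be ordered as $u^1,u^2,u^3,u^4$ with non-increasing values such that $u^1$ and $u^2$ lie on a common grid line (this condition being void if $u^1$ or $u^2$ is virtual). *The algorithm.* The input is $T$, with $n$ vertices. 1. Choose a vertex $v_0$ and a sequence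 $(v_1,p_1),\dots,(v_{n-1},p_{n-1})$ that lists the remaining vertices, such that $p_i$ is the only neighbour of $v_i$ among $v_0,\dots,v_{i-1}$. Place $v_0$ at a grid point. 2. For $i=1,\dots,n-1$: attach $v_i$ to $p_i$ in any free horizontal or vertical grid line at $p_i$ (rescaling the drawing to make room, if necessary), and then call $\mathrm{Balance}(v_i,p_i)$ on the resulting s-model of the tree $T[\{v_0,\dots,v_i\}]$. The procedure $\mathrm{Balance}(p,v)$ calls $\mathrm{Balance}(v,u)$ for all $u\in N(v)\setminus\{p\}$, one after the other in any order. Then, if $v$ is not balanced, it makes $v$ balanced by rearranging the drawings of the subtrees hanging at $v$ (each together with its edge to $v$): each of them may be rotated as a whole by a multiple of a right angle and rescaled, where rescaling may change the lengths of its edges but not their directions relative to each other, so that the result is an s-model again. Neighbourhoods, leaves and values refer to the current tree $T[\{v_0,\dots,v_i\}]$. *Claim.* (a) For every tree $T$ with $\Delta(T)\le4$ a sequence as in step 1 exists; for every such sequence the algorithm has an execution; and whatever choices are made, every execution ends with an s-model $M$ of $T$ such that $b(M)=b(T)$. (b) The algorithm can be carried out in $O(n^2)$ time: there are a program for a random access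 machine (unit-cost addition, truncated subtraction, indexed memory access, conditionals and loops) and a constant $C$ such that, for every $n$ and every tree $T$ on $\{0,\dots,n-1\}$ with $\Delta(T)\le 4$ that is given by its adjacency lists, the program halts after at most $C n^2$ steps, never stores a number larger than $Cn$, and outputs the coordinates of an s-model of $T$ with which some execution of the algorithm on $T$ ends. By (a), this s-model $M$ satisfies $b(M)=b(T)$. -/

import Mathlib

/-! ### Straight models of trees in the rectangular grid -/

namespace StraightModel

variable {V : Type*}

/-- Points of the infinite rectangular grid. -/
abbrev GridPoint : Type := ℤ × ℤ

/-- Two grid points lie on a common vertical or horizontal grid line. -/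
def SameLine (a b : GridPoint) : Prop := a.1 = b.1 ∨ a.2 = b.2

/-- The grid points between `a` and `b`. For two points on a common grid line this is the straight
grid segment joining them. -/
def segment (a b : GridPoint) : Set GridPoint := Set.uIcc a b

/-- `M` is an s-model (straight model) of the subgraph of `T` induced by the vertex set `S`:
the vertices in `S` are placed at distinct grid points, every edge is drawn as a straight segment
of a grid line, no vertex lies on an edge of which it is not an endpoint, and two different edges
meet at most in a common endpoint. The values of `M` outside of `S` are irrelevant. -/
structure IsSModel (T : SimpleGraph V) (S : Set V) (M : V → GridPoint) : Prop where
  injOn : Set.InjOn M S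
  straight : ∀ x ∈ S, ∀ y ∈ S, T.Adj x y → SameLine (M x) (M y)
  vertex_edge : ∀ x ∈ S, ∀ y ∈ S, ∀ z ∈ S, T.Adj x y → M z ∈ segment (M x) (M y) → z = x ∨ z = y
  edge_edge : ∀ x ∈ S, ∀ y ∈ S, ∀ z ∈ S, ∀ w ∈ S, T.Adj x y → T.Adj z w → s(x, y) ≠ s(z, w) →
    ∀ q ∈ segment (M x) (M y) ∩ segment (M z) (M w),
      ∃ c, (c = x ∨ c = y) ∧ (c = z ∨ c = w) ∧ q = M c

/-- The grid path running straight from `a` to `b` and then straight from `b` to `c` has a bend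
at `b`: the three points are not on one vertical or on one horizontal grid line. -/
def TurnsAt (a b c : GridPoint) : Prop :=
  ¬ (a.1 = b.1 ∧ b.1 = c.1) ∧ ¬ (a.2 = b.2 ∧ b.2 = c.2)

instance (a b c : GridPoint) : Decidable (TurnsAt a b c) :=
  inferInstanceAs (Decidable (¬ (a.1 = b.1 ∧ b.1 = c.1) ∧ ¬ (a.2 = b.2 ∧ b.2 = c.2)))

/-- Number of bends, in the model `M`, of a path given by the list of its consecutive vertices. -/
def bendCount (M : V → GridPoint) : List V → ℕ
  | a :: b :: c :: l => (if TurnsAt (M a) (M b) (M c) then 1 else 0) + bendCount M (b :: c :: l)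
  | _ => 0

/-- `v` is a leaf of the subgraph of `T` induced by `S`. -/
def IsLeaf (T : SimpleGraph V) (S : Set V) (v : V) : Prop :=
  v ∈ S ∧ ∃! w, w ∈ S ∧ T.Adj v w

/-- `b(M)`: the maximum number of bends of a leaf-to-leaf path (`0` for a one-vertex tree). -/
noncomputable def modelBends (T : SimpleGraph V) (S : Set V) (M : V → GridPoint) : ℕ :=
  sSup {k | ∃ x y, IsLeaf T S x ∧ IsLeaf T S y ∧
    ∃ q : T.Walk x y, q.IsPath ∧ bendCount M q.support = k}

/-- `b(T)`: the minimum of `b(M)` over all s-models `M` of `T`. -/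
noncomputable def treeBends (T : SimpleGraph V) : ℕ :=
  sInf {k | ∃ M : V → GridPoint, IsSModel T Set.univ M ∧ modelBends T Set.univ M = k}

/-- `b^ℓ_M(p, v)`: the maximum number of bends of a path from `p` through `v` to a leaf of the
tree induced by `S`. -/
noncomputable def leafBends (T : SimpleGraph V) (S : Set V) (M : V → GridPoint) (p v : V) : ℕ :=
  sSup {k | ∃ f, IsLeaf T S f ∧
    ∃ q : T.Walk p f, q.IsPath ∧ v ∈ q.support ∧ bendCount M q.support = k}

/-- The value `b^ℓ_M(v, w)` of a real neighbour `w` of `v`, and `-1` for a virtual neighbour. -/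
noncomputable def nbrValue (T : SimpleGraph V) (S : Set V) (M : V → GridPoint) (v : V) :
    Option V → ℤ
  | none => -1
  | some w => (leafBends T S M v w : ℤ)

/-- `u 0, u 1, u 2, u 3` is an admissible ordering `u^1(v), …, u^4(v)` of the neighbours of `v`:
every neighbour of `v` (in the tree induced by `S`) occurs exactly once, the remaining entries are
virtual neighbours, and the values are non-increasing. Ties may be broken in any way. -/
structure IsNbrOrder (T : SimpleGraph V) (S : Set V) (M : V → GridPoint) (v : V)
    (u : Fin 4 → Option V) : Prop where
  mem_iff : ∀ w, (∃ i, u i = some w) ↔ w ∈ S ∧ T.Adj v w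
  unique : ∀ i j w, u i = some w → u j = some w → i = j
  antitone : Antitone fun i => nbrValue T S M v (u i)

/-- `v` is balanced: for some admissible ordering of its neighbours, `u^1(v)` and `u^2(v)` are on
a common grid line. (Virtual neighbours may be thought of as occupying the free grid lines at `v`,
so there is no condition if `u^1(v)` or `u^2(v)` is virtual.) -/
def Balanced (T : SimpleGraph V) (S : Set V) (M : V → GridPoint) (v : V) : Prop :=
  ∃ u : Fin 4 → Option V, IsNbrOrder T S M v u ∧
    ∀ x y, u 0 = some x → u 1 = some y → SameLine (M x) (M y)

/-- The direction in which `b` is seen from `a`. -/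
def direction (a b : GridPoint) : ℤ × ℤ := (Int.sign (b.1 - a.1), Int.sign (b.2 - a.2))

/-- Rotation of a direction by a right angle. -/
def quarterTurn (d : ℤ × ℤ) : ℤ × ℤ := (-d.2, d.1)

/-- The vertices of `T(v, u)`: the vertex `v`, together with all vertices to which the path
from `v` goes through the neighbour `u`. -/
def branch (T : SimpleGraph V) (v u : V) : Set V :=
  {x | x = v ∨ ∃ q : T.Walk v x, q.IsPath ∧ u ∈ q.support}

/-- `M'` is an s-model obtained from `M` by rearranging the drawings of the subtrees `T(v, u)`,
`u` a neighbour of `v`: each of them is rotated as a whole by a multiple of a right angle, and it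
is rescaled (lengths may change, directions relative to each other do not). -/
def Rearranged (T : SimpleGraph V) (S : Set V) (v : V) (M M' : V → GridPoint) : Prop :=
  IsSModel T S M' ∧ ∀ u ∈ S, T.Adj v u → ∃ k : ℕ,
    ∀ x ∈ S ∩ branch T v u, ∀ y ∈ S ∩ branch T v u, T.Adj x y →
      direction (M' x) (M' y) = quarterTurn^[k] (direction (M x) (M y))

/-- The balance step at `v`, turning the s-model `M` into `M'`. -/
def BalanceStep (T : SimpleGraph V) (S : Set V) (v : V) (M M' : V → GridPoint) : Prop :=
  (Balanced T S M v ∧ M' = M) ∨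
    (¬ Balanced T S M v ∧ Rearranged T S v M M' ∧ Balanced T S M' v)

/-- `l` lists the set `N(v) \ {p}` (in the tree induced by `S`), in some order. -/
def ListsNbrs (T : SimpleGraph V) (S : Set V) (v p : V) (l : List V) : Prop :=
  l.Nodup ∧ ∀ u, u ∈ l ↔ u ∈ S ∧ T.Adj v u ∧ u ≠ p

/-- `BalanceCalls T S p l M M'`: carrying out the calls `Balance(·, p, v)`, for the entries `v` of
the list `l` one after the other, may turn `M` into `M'`. A call `Balance(·, p, v)` makes the
calls `Balance(·, v, u)` for all `u ∈ N(v) \ {p}`, in some order, and then does the balance step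
at `v`. -/
inductive BalanceCalls (T : SimpleGraph V) (S : Set V) :
    V → List V → (V → GridPoint) → (V → GridPoint) → Prop
  | nil (p : V) (M : V → GridPoint) : BalanceCalls T S p [] M M
  | cons {p v : V} {rest children : List V} {M M₁ M₂ M₃ : V → GridPoint} :
      ListsNbrs T S v p children →
      BalanceCalls T S v children M M₁ →
      BalanceStep T S v M₁ M₂ →
      BalanceCalls T S p rest M₂ M₃ →
      BalanceCalls T S p (v :: rest) M M₃

/-- The procedure `Balance(M, p, v)` may turn `M` into `M'`. -/
def Balance (T : SimpleGraph V) (S : Set V) (p v : V) (M M' : V → GridPoint) : Prop :=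
  BalanceCalls T S p [v] M M'

/-- The vertices added so far, where `l` is the list of the pairs `(vᵢ, pᵢ)`, latest first. -/
def addedVertices (v₀ : V) (l : List (V × V)) : Set V :=
  {x | x = v₀ ∨ x ∈ l.map Prod.fst}

/-- The list `l` of pairs `(vᵢ, pᵢ)`, latest first, is a sequence of vertex additions in `T`
starting from `v₀`: each `vᵢ` is new, and `pᵢ` is its only neighbour among the earlier vertices. -/
inductive IsAdditionSeq (T : SimpleGraph V) (v₀ : V) : List (V × V) → Prop
  | nil : IsAdditionSeq T v₀ []
  | cons {v p : V} {l : List (V × V)} :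
      IsAdditionSeq T v₀ l →
      v ∉ addedVertices v₀ l →
      (∀ q, q ∈ addedVertices v₀ l ∧ T.Adj v q ↔ q = p) →
      IsAdditionSeq T v₀ ((v, p) :: l)

/-- `T` is incrementally built from `v₀` by the vertex additions in `l` (latest first). -/
def IncrementallyBuilt (T : SimpleGraph V) (v₀ : V) (l : List (V × V)) : Prop :=
  IsAdditionSeq T v₀ l ∧ addedVertices v₀ l = Set.univ

/-- `M'` is an s-model obtained from the s-model `M` on the vertex set `S` by attaching the new
vertex `v` to its neighbour in a free grid line; the drawing of the old tree may be rescaled to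
make room. -/
def Attached (T : SimpleGraph V) (S : Set V) (v : V) (M M' : V → GridPoint) : Prop :=
  IsSModel T (insert v S) M' ∧
    ∀ x ∈ S, ∀ y ∈ S, T.Adj x y → direction (M' x) (M' y) = direction (M x) (M y)

/-- `Produces T v₀ l M`: the balancing algorithm, run along the vertex additions in `l` (latest
first), may end with the model `M`. It starts with any grid point for `v₀`; for each pair `(v, p)`
it attaches `v` to `p` and calls `Balance(·, v, p)`. All choices that the algorithm leaves open
(free grid lines, order of recursive calls, ordering of neighbours with equal values, placement
of the drawings) are arbitrary. -/
inductive Produces (T : SimpleGraph V) (v₀ : V) : List (V × V) → (V → GridPoint) → Prop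
  | start (M : V → GridPoint) : Produces T v₀ [] M
  | add {v p : V} {l : List (V × V)} {M M₁ M₂ : V → GridPoint} :
      Produces T v₀ l M →
      Attached T (addedVertices v₀ l) v M M₁ →
      Balance T (insert v (addedVertices v₀ l)) v p M₁ M₂ →
      Produces T v₀ ((v, p) :: l) M₂

end StraightModel

/-! ### A random access machine with a step count -/

namespace RAM

/-- Memory: arrays of natural numbers, numbered `0, 1, 2, …`; `σ a i` is the content of
cell `i` of array `a`. A program text mentions only finitely many arrays. -/
abbrev Memory : Type := ℕ → ℕ → ℕ

/-- Arithmetic expressions: constants, memory access with computed index (the array is fixed by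
the program text), addition and truncated subtraction. -/
inductive Expr : Type
  | const (c : ℕ)
  | get (a : ℕ) (i : Expr)
  | add (e₁ e₂ : Expr)
  | sub (e₁ e₂ : Expr)

/-- The value of an expression. -/
def Expr.eval (σ : Memory) : Expr → ℕ
  | .const c => c
  | .get a i => σ a (i.eval σ)
  | .add e₁ e₂ => e₁.eval σ + e₂.eval σ
  | .sub e₁ e₂ => e₁.eval σ - e₂.eval σ

/-- The number of elementary operations in the evaluation of an expression. -/
def Expr.cost : Expr → ℕ
  | .const _ => 1
  | .get _ i => i.cost + 1
  | .add e₁ e₂ => e₁.cost + e₂.cost + 1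
  | .sub e₁ e₂ => e₁.cost + e₂.cost + 1

/-- Programs; a condition holds if its value is not `0`. -/
inductive Prog : Type
  | skip
  | set (a : ℕ) (i e : Expr)
  | seq (P Q : Prog)
  | ite (e : Expr) (P Q : Prog)
  | while (e : Expr) (P : Prog)

/-- Write the value `x` into cell `i` of array `a`. -/
def write (σ : Memory) (a i x : ℕ) : Memory := Function.update σ a (Function.update (σ a) i x)

/-- `Exec W P σ t σ'`: started in memory `σ`, the program `P` halts after exactly `t` elementary
steps in memory `σ'`, and never writes a value greater than the word bound `W`. -/
inductive Exec (W : ℕ) : Prog → Memory → ℕ → Memory → Prop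
  | skip (σ : Memory) : Exec W .skip σ 1 σ
  | set (a : ℕ) (i e : Expr) (σ : Memory) : e.eval σ ≤ W →
      Exec W (.set a i e) σ (i.cost + e.cost + 1) (write σ a (i.eval σ) (e.eval σ))
  | seq {P Q : Prog} {σ σ₁ σ₂ : Memory} {t₁ t₂ : ℕ} :
      Exec W P σ t₁ σ₁ → Exec W Q σ₁ t₂ σ₂ → Exec W (.seq P Q) σ (t₁ + t₂) σ₂
  | ite_true {e : Expr} {P Q : Prog} {σ σ' : Memory} {t : ℕ} :
      e.eval σ ≠ 0 → Exec W P σ t σ' → Exec W (.ite e P Q) σ (e.cost + 1 + t) σ'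
  | ite_false {e : Expr} {P Q : Prog} {σ σ' : Memory} {t : ℕ} :
      e.eval σ = 0 → Exec W Q σ t σ' → Exec W (.ite e P Q) σ (e.cost + 1 + t) σ'
  | while_true {e : Expr} {P : Prog} {σ σ₁ σ₂ : Memory} {t₁ t₂ : ℕ} :
      e.eval σ ≠ 0 → Exec W P σ t₁ σ₁ → Exec W (.while e P) σ₁ t₂ σ₂ →
      Exec W (.while e P) σ (e.cost + 1 + t₁ + t₂) σ₂
  | while_false {e : Expr} {P : Prog} {σ : Memory} :
      e.eval σ = 0 → Exec W (.while e P) σ (e.cost + 1) σ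

/-- The memory `σ` holds the graph `T` with vertices `0, …, n - 1` and degrees at most `4` as
input: cell `0` of array `0` contains `n`, the four cells `4 * v, …, 4 * v + 3` of array `1`
contain the adjacency list of `v`, a neighbour `w` being stored as `w + 1` and an unused cell
containing `0`, and all other cells contain `0`. -/
structure IsInput {n : ℕ} (T : SimpleGraph (Fin n)) (σ : Memory) : Prop where
  size : σ 0 0 = n
  entry : ∀ v : Fin n, ∀ k < 4, σ 1 (4 * v + k) = 0 ∨
    ∃ w : Fin n, T.Adj v w ∧ σ 1 (4 * v + k) = w + 1
  adj : ∀ v w : Fin n, T.Adj v w → ∃! k, k < 4 ∧ σ 1 (4 * v + k) = w + 1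
  blank : ∀ a i, ¬ (a = 0 ∧ i = 0) → ¬ (a = 1 ∧ i < 4 * n) → σ a i = 0

/-- The model read off from arrays `2` and `3` of the memory: vertex `v` is placed at the grid
point whose coordinates are the contents of cell `v` of these arrays. -/
def outputModel {n : ℕ} (σ : Memory) : Fin n → ℤ × ℤ := fun v => ((σ 2 v : ℤ), (σ 3 v : ℤ))

end RAM

namespace StraightModel

/-! ### Drawings of rooted trees, as seen along an edge -/

/-! Bends and balance depend only on the directions of the edges. Seen along an edge, a model is a
rooted tree (`BTree`) whose children lie ahead, to the left and to the right. `val` is the largest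
number of bends on the way to a leaf, and `SubBal t h` says that all vertices of `t` are balanced if
the value seen backwards from its root is `h`. Call `t` light if `t.val ≤ h`, and heavy otherwise.
Two facts carry the proof. At a vertex at most one child is heavy with respect to the value seen
back from it. And a light balanced tree is sorted (`Srt`: the child ahead has the largest value, at
every vertex), while a sorted tree is balanced for every back value `h ≥ val - 1`; so changes
elsewhere do not disturb light subtrees.

Balanced models are optimal (`Iso.optimal`, `IsSModel.modelBends_le`). Root the tree at a leaf and
compare with any other arrangement. A sorted drawing has the least possible `val`, and in a light
balanced tree no path between two leaves has more than `val + h` bends. Hence light children are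
compared through their values alone, and the single heavy child by induction.

The algorithm keeps all vertices balanced (`call_node`, `BalanceCalls.spec`, `Produces.balAt`). A
new leaf raises the value seen in its direction from `-1` to `0`, and further on a back value `h`
becomes some `u` in `{h, h + 1}`. The invariant `Call` says that a call leaves a light tree as it
is, and turns a heavy one into a heavy tree that is balanced both for `h` and for `u`. If a vertex
loses its balance, then `u = h + 1` and a side value equals `h` exactly; this rigidity makes every
permitted rearrangement good (`Settled.repair`).

Executions exist because every consistent assignment of directions is realised by a model, built by
inserting empty rows and columns (`IsSModel.insert_column`, `IsAdditionSeq.exists_model`).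

For the running time, the recursive procedure is not simulated. Every model that is balanced
everywhere is the result of some execution (`exists_produces_of_balAt`): it has a leaf whose removal
leaves a balanced model, and when this leaf is put back in the same place, no balance step changes
anything. So it suffices to draw one balanced model. The program removes leaves in the order of
their values and inserts them again in the reverse order; each removal and each insertion takes
linear time. -/

/-- A rooted tree with positions: the subtree straight ahead, to the left and to the right.
`nil` stands for a virtual subtree. -/
inductive BTree : Type
  | nil
  | node (a b c : BTree)

namespace BTree

/-- The maximum number of bends on the way to a leaf, `-1` for a virtual subtree. -/
def val : BTree → ℤ
  | nil => -1
  | node a b c => max a.val (max (b.val + 1) (c.val + 1))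

@[simp] lemma val_nil : val nil = -1 := rfl

@[simp] lemma val_node (a b c : BTree) :
    (node a b c).val = max a.val (max (b.val + 1) (c.val + 1)) := rfl

lemma neg_one_le_val (t : BTree) : -1 ≤ t.val := by
  induction t with
  | nil => simp
  | node a b c ha hb hc => simp only [val_node]; omega

lemma val_nonneg {t : BTree} (h : t ≠ nil) : 0 ≤ t.val := by
  cases t with
  | nil => exact absurd rfl h
  | node a b c => have := neg_one_le_val b; simp only [val_node]; omega

lemma eq_nil_of_val_neg {t : BTree} (h : t.val < 0) : t = nil := by
  by_contra hne
  have := val_nonneg hne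
  omega

/-- The balance condition at a vertex with value `h` behind, `α` ahead, `β`, `γ` to the sides. -/
def LocBal (h α β γ : ℤ) : Prop :=
  (β ≤ h ∧ γ ≤ h ∧ β ≤ α ∧ γ ≤ α) ∨ (h ≤ β ∧ h ≤ γ ∧ α ≤ β ∧ α ≤ γ)

/-- All vertices of the tree are balanced, if the value seen backwards from the root is `h`. -/
def SubBal : BTree → ℤ → Prop
  | nil, _ => True
  | node a b c, h => LocBal h a.val b.val c.val ∧
      SubBal a (max h (max (b.val + 1) (c.val + 1))) ∧
      SubBal b (max c.val (max (h + 1) (a.val + 1))) ∧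
      SubBal c (max b.val (max (h + 1) (a.val + 1)))

/-- Straight ahead the value is largest, at every vertex. -/
def Srt : BTree → Prop
  | nil => True
  | node a b c => b.val ≤ a.val ∧ c.val ≤ a.val ∧ Srt a ∧ Srt b ∧ Srt c

/-- The side values are at most `val - 1 ≤ h`, so the directions ahead and behind dominate, and each
child meets the same bound because its own back value is at least `h`. The slack of one in `h + 1`
lets balance survive a loss of one behind the tree. -/
lemma Srt.subBal {t : BTree} : ∀ {h : ℤ}, Srt t → t.val ≤ h + 1 → SubBal t h := by
  induction t with
  | nil => intros; trivial
  | node a b c ha hb hc =>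
    rintro h ⟨h1, h2, sa, sb, sc⟩ hv
    simp only [val_node] at hv
    refine ⟨Or.inl (by omega), ha sa (by omega), hb sb (by omega), hc sc (by omega)⟩

/-- If the sides dominated, a side value would be at least `h`, but lightness bounds it by `h - 1`.
So the pair ahead and behind dominates, and lightness passes to the children. -/
lemma SubBal.srt {t : BTree} : ∀ {h : ℤ}, SubBal t h → t.val ≤ h → Srt t := by
  induction t with
  | nil => intros; trivial
  | node a b c ha hb hc =>
    rintro h ⟨hl, sa, sb, sc⟩ hv
    simp only [val_node] at hv
    unfold LocBal at hl
    refine ⟨by omega, by omega, ha sa (by omega), hb sb (by omega), hc sc (by omega)⟩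

/-- Changes elsewhere in the drawing cannot unbalance a subtree as long as it stays light. -/
lemma SubBal.of_light {t : BTree} {h h' : ℤ} (hs : SubBal t h) (h1 : t.val ≤ h) (h2 : t.val ≤ h') :
    SubBal t h' := (hs.srt h1).subBal (by omega)

/-! ### The effect of the balance procedure on rooted trees. -/

/-- What a call of the balance procedure does to the tree it is applied to, where `u` is the value
seen backwards from the root. -/
def Call (u : ℤ) (t t' : BTree) : Prop :=
  ∀ h, SubBal t h → -1 ≤ h → (u = h ∨ u = h + 1) →
    SubBal t' h ∧ SubBal t' u ∧ (t.val ≤ h → t' = t) ∧ (h < t.val → h < t'.val)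

/-- The value seen from the neighbour in direction `i` back through a vertex around which the
values are given by `f`. -/
def upVal (f : ZMod 4 → ℤ) (i : ZMod 4) : ℤ := max (f (i + 2)) (max (f (i + 1) + 1) (f (i + 3) + 1))

/-- A sequence of calls applied to the trees around a vertex. -/
inductive Calls : List (ZMod 4) → (ZMod 4 → BTree) → (ZMod 4 → BTree) → Prop
  | nil (F : ZMod 4 → BTree) : Calls [] F F
  | cons {e : ZMod 4} {es : List (ZMod 4)} {F F' : ZMod 4 → BTree} {t : BTree} :
      Call (upVal (fun i => (F i).val) e) (F e) t → Calls es (Function.update F e t) F' →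
      Calls (e :: es) F F'

/-- Only relative directions matter; this allows the direction back to the caller to be normalised
to `2`. -/
lemma Calls.shift {es : List (ZMod 4)} {F F' : ZMod 4 → BTree} (k : ZMod 4) (h : Calls es F F') :
    Calls (es.map (· - k)) (fun i => F (i + k)) (fun i => F' (i + k)) := by
  induction h with
  | nil F => exact Calls.nil _
  | @cons e es F F' t hc _ ih =>
    refine Calls.cons (t := t) ?_ ?_
    · have : upVal (fun i => (F (i + k)).val) (e - k) = upVal (fun i => (F i).val) e := by
        simp only [upVal]
        rw [show e - k + 2 + k = e + 2 by ring, show e - k + 1 + k = e + 1 by ring,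
          show e - k + 3 + k = e + 3 by ring]
      simpa [this] using hc
    · convert ih using 1
      funext i
      by_cases hi : i = e - k
      · subst hi; simp
      · have : i + k ≠ e := fun hh => hi (by rw [← hh]; ring)
        simp [Function.update_of_ne, hi, this]

lemma zmod4_add :
    (0 : ZMod 4) + 1 = 1 ∧ (0 : ZMod 4) + 2 = 2 ∧ (0 : ZMod 4) + 3 = 3 ∧
    (1 : ZMod 4) + 1 = 2 ∧ (1 : ZMod 4) + 2 = 3 ∧ (1 : ZMod 4) + 3 = 0 ∧
    (2 : ZMod 4) + 1 = 3 ∧ (2 : ZMod 4) + 2 = 0 ∧ (2 : ZMod 4) + 3 = 1 ∧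
    (3 : ZMod 4) + 1 = 0 ∧ (3 : ZMod 4) + 2 = 1 ∧ (3 : ZMod 4) + 3 = 2 := by decide

lemma zmod4_add_ne (e : ZMod 4) : e + 2 ≠ e ∧ e + 1 ≠ e ∧ e + 3 ≠ e := by
  revert e; decide

lemma zmod4_cases (i : ZMod 4) : i = 0 ∨ i = 1 ∨ i = 2 ∨ i = 3 := by
  revert i; decide

/-- The state of the tree in direction `i` while the calls for the directions in `es` are pending:
light trees remain as they are, a heavy tree is balanced by its call. `G` is the initial state. -/
def SlotOk (h : ℤ) (G : ZMod 4 → BTree) (es : List (ZMod 4)) (F : ZMod 4 → BTree)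
    (i : ZMod 4) : Prop :=
  ((G i).val ≤ upVal (Function.update (fun j => (G j).val) 2 h) i ∧ F i = G i) ∨
  (upVal (Function.update (fun j => (G j).val) 2 h) i < (G i).val ∧
    ((i ∈ es ∧ F i = G i) ∨ (i ∉ es ∧ SubBal (F i) (upVal (Function.update (fun j => (G j).val) 2 h) i) ∧
      SubBal (F i) (upVal (fun j => (G j).val) i) ∧
      upVal (Function.update (fun j => (G j).val) 2 h) i < (F i).val)))

section slots

variable {h : ℤ} {G : ZMod 4 → BTree}

/-- Slot `2` points back to the caller. `G 2` already has the new value, so the old value `h` is put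
in its place; this gives the back values that the children saw before the new leaf came. -/
lemma upVal_update_zero : upVal (Function.update (fun j => (G j).val) 2 h) 0 =
    max h (max ((G 1).val + 1) ((G 3).val + 1)) := by
  simp only [upVal, zmod4_add]; rfl

lemma upVal_update_one : upVal (Function.update (fun j => (G j).val) 2 h) 1 =
    max (G 3).val (max (h + 1) ((G 0).val + 1)) := by
  simp only [upVal, zmod4_add]; rfl

lemma upVal_update_three : upVal (Function.update (fun j => (G j).val) 2 h) 3 =
    max (G 1).val (max ((G 0).val + 1) (h + 1)) := by
  simp only [upVal, zmod4_add]; rfl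

lemma SlotOk.eq_or {F : ZMod 4 → BTree} {es : List (ZMod 4)} {i : ZMod 4}
    (hs : SlotOk h G es F i) : F i = G i ∨
      (upVal (Function.update (fun j => (G j).val) 2 h) i < (F i).val ∧
       upVal (Function.update (fun j => (G j).val) 2 h) i < (G i).val) := by
  rcases hs with h1 | ⟨h0, h1 | h1⟩
  · exact Or.inl h1.2
  · exact Or.inl h1.2
  · exact Or.inr ⟨h1.2.2.2, h0⟩

lemma subBal_slot (hG : SubBal (node (G 0) (G 1) (G 3)) h) (i : ZMod 4) (hi : i ≠ 2) :
    SubBal (G i) (upVal (Function.update (fun j => (G j).val) 2 h) i) := by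
  obtain ⟨-, h0, h1, h3⟩ := hG
  rcases zmod4_cases i with rfl | rfl | rfl | rfl
  · rw [upVal_update_zero]; exact h0
  · rw [upVal_update_one]; exact h1
  · exact absurd rfl hi
  · rw [upVal_update_three, max_comm ((G 0).val + 1)]; exact h3

/-- The call of a light child has no effect, since the siblings keep it light throughout. If a child
is heavy then no sibling is, so at its call the siblings are in their initial state, and its back
value differs from the old one by at most one, as `Call` requires. -/
lemma Calls.slotOk {es : List (ZMod 4)} {F F' : ZMod 4 → BTree} (hc : Calls es F F')
    (hG : SubBal (node (G 0) (G 1) (G 3)) h) (hh : -1 ≤ h)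
    (hu : (G 2).val = h ∨ (G 2).val = h + 1)
    (hnd : es.Nodup) (h2 : (2 : ZMod 4) ∉ es) (hF : ∀ i, i ≠ 2 → SlotOk h G es F i)
    (hF2 : F 2 = G 2) : (∀ i, i ≠ 2 → SlotOk h G [] F' i) ∧ F' 2 = G 2 := by
  induction hc with
  | nil F => exact ⟨hF, hF2⟩
  | @cons e es F F' t hcall _ ih =>
    obtain ⟨hne, hnd⟩ := List.nodup_cons.1 hnd
    rw [List.mem_cons, not_or] at h2
    have he2 : e ≠ 2 := fun hh => h2.1 hh.symm
    have q0 := (hF 0 (by decide)).eq_or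
    have q1 := (hF 1 (by decide)).eq_or
    have q3 := (hF 3 (by decide)).eq_or
    rw [upVal_update_zero] at q0
    rw [upVal_update_one] at q1
    rw [upVal_update_three] at q3
    have n0 := neg_one_le_val (G 0)
    have n1 := neg_one_le_val (G 1)
    have n3 := neg_one_le_val (G 3)
    refine ih hnd h2.2 ?_ (by rw [Function.update_of_ne (Ne.symm he2)]; exact hF2)
    have hsub := subBal_slot hG e he2
    rcases hF e he2 with ⟨hl, hFe⟩ | ⟨hv, ⟨-, hFe⟩ | ⟨hno, -⟩⟩
    · have hup : (G e).val ≤ upVal (fun i => (F i).val) e := by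
        rcases zmod4_cases e with rfl | rfl | rfl | rfl
        · rw [upVal_update_zero] at hl
          simp only [upVal, zmod4_add, hF2]
          rcases q1 with q1 | q1 <;> rcases q3 with q3 | q3 <;> (try rw [q1]) <;> (try rw [q3]) <;>
            omega
        · rw [upVal_update_one] at hl
          simp only [upVal, zmod4_add, hF2]
          rcases q0 with q0 | q0 <;> rcases q3 with q3 | q3 <;> (try rw [q0]) <;> (try rw [q3]) <;>
            omega
        · exact absurd rfl he2
        · rw [upVal_update_three] at hl
          simp only [upVal, zmod4_add, hF2]
          rcases q0 with q0 | q0 <;> rcases q1 with q1 | q1 <;> (try rw [q0]) <;> (try rw [q1]) <;>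
            omega
      -- `Call` is used with the current back value in the role of both `h` and `u`.
      have ht := (hcall (upVal (fun i => (F i).val) e) (by rw [hFe]; exact hsub.of_light hl hup)
        (le_trans (neg_one_le_val _) hup) (Or.inl rfl)).2.2.1 (by rw [hFe]; exact hup)
      intro i hi
      rw [ht, Function.update_eq_self]
      rcases hF i hi with h1 | ⟨h1, ⟨h3, h4⟩ | ⟨h3, h4⟩⟩
      · exact Or.inl h1
      · rcases List.mem_cons.1 h3 with rfl | h5
        · exact absurd hl (not_le.2 h1)
        · exact Or.inr ⟨h1, Or.inl ⟨h5, h4⟩⟩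
      · exact Or.inr ⟨h1, Or.inr ⟨fun h5 => h3 (List.mem_cons_of_mem _ h5), h4⟩⟩
    -- The heavy child is part of what its siblings see back, so they are light.
    · have hrest : ∀ i, i ≠ 2 → i ≠ e →
          (G i).val ≤ upVal (Function.update (fun j => (G j).val) 2 h) i := by
        intro i hi hie
        rcases zmod4_cases e with rfl | rfl | rfl | rfl <;>
        rcases zmod4_cases i with rfl | rfl | rfl | rfl <;>
        first
        | exact absurd rfl hi
        | exact absurd rfl hie
        | exact absurd rfl he2
        | (simp only [upVal_update_zero, upVal_update_one, upVal_update_three] at hv ⊢; omega)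
      have hFi : ∀ i, i ≠ e → F i = G i := by
        intro i hie
        by_cases hi : i = 2
        · rw [hi, hF2]
        · rcases hF i hi with h1 | ⟨h1, -⟩
          · exact h1.2
          · exact absurd (hrest i hi hie) (not_le.2 h1)
      have hup : upVal (fun i => (F i).val) e = upVal (fun j => (G j).val) e := by
        obtain ⟨a1, a2, a3⟩ := zmod4_add_ne e
        simp only [upVal, hFi _ a1, hFi _ a2, hFi _ a3]
      have hup2 : upVal (fun j => (G j).val) e =
            upVal (Function.update (fun j => (G j).val) 2 h) e ∨
          upVal (fun j => (G j).val) e =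
            upVal (Function.update (fun j => (G j).val) 2 h) e + 1 := by
        rcases zmod4_cases e with rfl | rfl | rfl | rfl
        · rw [upVal_update_zero]; simp only [upVal, zmod4_add]; omega
        · rw [upVal_update_one]; simp only [upVal, zmod4_add]; omega
        · exact absurd rfl he2
        · rw [upVal_update_three]; simp only [upVal, zmod4_add]; omega
      have hlow : -1 ≤ upVal (Function.update (fun j => (G j).val) 2 h) e := by
        rcases zmod4_cases e with rfl | rfl | rfl | rfl
        · rw [upVal_update_zero]; omega
        · rw [upVal_update_one]; omega
        · exact absurd rfl he2
        · rw [upVal_update_three]; omega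
      obtain ⟨c1, c2, -, c4⟩ := hcall _ (by rw [hFe]; exact hsub) hlow (by rw [hup]; exact hup2)
      rw [hFe] at c4
      rw [hup] at c2
      intro i hi
      by_cases hie : i = e
      · subst hie
        exact Or.inr ⟨hv, Or.inr ⟨hne, by simpa using c1, by simpa using c2, by simpa using c4 hv⟩⟩
      · exact Or.inl ⟨hrest i hi hie, by rw [Function.update_of_ne hie]; exact hFi i hie⟩
    · exact absurd (List.mem_cons_self) hno

end slots

lemma perm_three {α : Type*} {a b c x y z : α} (h : [x, y, z].Perm [a, b, c]) :
    (x = a ∧ y = b ∧ z = c) ∨ (x = a ∧ y = c ∧ z = b) ∨ (x = b ∧ y = a ∧ z = c) ∨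
    (x = b ∧ y = c ∧ z = a) ∨ (x = c ∧ y = a ∧ z = b) ∨ (x = c ∧ y = b ∧ z = a) := by
  have two : ∀ {p q r s : α}, [p, q].Perm [r, s] → (p = r ∧ q = s) ∨ (p = s ∧ q = r) := by
    intro p q r s hp
    have : p ∈ [r, s] := hp.subset (by simp)
    simp only [List.mem_cons, List.not_mem_nil, or_false] at this
    rcases this with rfl | rfl
    · exact Or.inl ⟨rfl, List.singleton_perm_singleton.1 hp.cons_inv⟩
    · exact Or.inr ⟨rfl, List.singleton_perm_singleton.1
        (List.Perm.cons_inv (hp.trans (List.Perm.swap _ _ _)))⟩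
  have : x ∈ [a, b, c] := h.subset (by simp)
  simp only [List.mem_cons, List.not_mem_nil, or_false] at this
  rcases this with rfl | rfl | rfl
  · rcases two h.cons_inv with ⟨h1, h2⟩ | ⟨h1, h2⟩ <;> simp [h1, h2]
  · rcases two (List.Perm.cons_inv (h.trans (List.Perm.swap _ _ _))) with ⟨h1, h2⟩ | ⟨h1, h2⟩ <;>
      simp [h1, h2]
  · have h' : [a, b, x].Perm [x, a, b] :=
      ((List.Perm.swap _ _ _).cons a).trans (List.Perm.swap _ _ _)
    rcases two (List.Perm.cons_inv (h.trans h')) with ⟨h1, h2⟩ | ⟨h1, h2⟩ <;> simp [h1, h2]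

/-- A subtree below a vertex after its call: it is unchanged and light, or balanced and heavy. -/
def Settled (p q : ℤ) (t₀ t : BTree) : Prop :=
  (t₀.val ≤ p ∧ t = t₀ ∧ ∀ H, t₀.val ≤ H → SubBal t H) ∨
    (p < t₀.val ∧ SubBal t p ∧ SubBal t q ∧ p < t.val)

lemma SlotOk.settled {h : ℤ} {G F : ZMod 4 → BTree} {i : ZMod 4} (hs : SlotOk h G [] F i)
    (hi : i ≠ 2) (hG : SubBal (node (G 0) (G 1) (G 3)) h) :
    Settled (upVal (Function.update (fun j => (G j).val) 2 h) i) (upVal (fun j => (G j).val) i)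
      (G i) (F i) := by
  rcases hs with ⟨h1, h2⟩ | ⟨h1, ⟨h2, -⟩ | ⟨-, h2⟩⟩
  · exact Or.inl ⟨h1, h2, fun H hH => by rw [h2]; exact (subBal_slot hG i hi).of_light h1 hH⟩
  · simp at h2
  · exact Or.inr ⟨h1, h2⟩

lemma Settled.val {p q : ℤ} {t₀ t : BTree} (h : Settled p q t₀ t) :
    (t₀.val ≤ p ∧ t.val = t₀.val) ∨ (p < t₀.val ∧ p < t.val) := by
  rcases h with ⟨a, b, -⟩ | ⟨a, -, -, d⟩
  · exact Or.inl ⟨a, by rw [b]⟩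
  · exact Or.inr ⟨a, d⟩

section settled

variable {h u : ℤ} {a₀ b₀ c₀ a b c : BTree}

/-- At most one child is heavy. If none is, nothing has changed. Otherwise the heavy child exceeds
all other values before and after its call, so the vertex also keeps its balance for `h`, and the
light children remain light. -/
lemma Settled.keep (hloc : LocBal h a₀.val b₀.val c₀.val) (hu : u = h ∨ u = h + 1)
    (sa : Settled (max h (max (b₀.val + 1) (c₀.val + 1))) (max u (max (b₀.val + 1) (c₀.val + 1))) a₀ a)
    (sb : Settled (max c₀.val (max (h + 1) (a₀.val + 1))) (max c₀.val (max (u + 1) (a₀.val + 1))) b₀ b)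
    (sc : Settled (max b₀.val (max (h + 1) (a₀.val + 1))) (max b₀.val (max (u + 1) (a₀.val + 1))) c₀ c)
    (hl : LocBal u a.val b.val c.val) :
    SubBal (node a b c) h ∧ SubBal (node a b c) u ∧
      ((node a₀ b₀ c₀).val ≤ h → node a b c = node a₀ b₀ c₀) ∧
      (h < (node a₀ b₀ c₀).val → h < (node a b c).val) := by
  rcases sa with ⟨la, rfl, fa⟩ | ⟨la, pa, qa, va⟩ <;>
    rcases sb with ⟨lb, rfl, fb⟩ | ⟨lb, pb, qb, vb⟩ <;>
    rcases sc with ⟨lc, rfl, fc⟩ | ⟨lc, pc, qc, vc⟩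
  · exact ⟨⟨hloc, fa _ la, fb _ lb, fc _ lc⟩, ⟨hl, fa _ (by omega), fb _ (by omega),
      fc _ (by omega)⟩, fun _ => rfl, fun hv => hv⟩
  · simp only [max_lt_iff] at lc vc
    clear la lb
    unfold LocBal at hloc
    refine ⟨⟨by unfold LocBal; omega, fa _ (by omega), fb _ (by omega), pc⟩,
      ⟨hl, fa _ (by omega), fb _ (by omega), qc⟩, ?_, ?_⟩ <;> simp only [val_node] <;> omega
  · simp only [max_lt_iff] at lb vb
    clear la lc
    unfold LocBal at hloc
    refine ⟨⟨by unfold LocBal; omega, fa _ (by omega), pb, fc _ (by omega)⟩,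
      ⟨hl, fa _ (by omega), qb, fc _ (by omega)⟩, ?_, ?_⟩ <;> simp only [val_node] <;> omega
  · simp only [max_lt_iff] at lb lc
    omega
  · simp only [max_lt_iff] at la va
    clear lb lc
    unfold LocBal at hloc
    refine ⟨⟨by unfold LocBal; omega, pa, fb _ (by omega), fc _ (by omega)⟩,
      ⟨hl, qa, fb _ (by omega), fc _ (by omega)⟩, ?_, ?_⟩ <;> simp only [val_node] <;> omega
  · simp only [max_lt_iff] at la lc
    omega
  · simp only [max_lt_iff] at la lb
    omega
  · simp only [max_lt_iff] at la lb
    omega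

/-- A heavy child that is moved ahead sees back the same value `h + 1` that it saw in the old state.
This is why `Call` and `Settled` record balance for the old back value and not only for the new one.
-/
lemma Settled.repair (hloc : LocBal h a₀.val b₀.val c₀.val) (hu : u = h ∨ u = h + 1)
    (sa : Settled (max h (max (b₀.val + 1) (c₀.val + 1))) (max u (max (b₀.val + 1) (c₀.val + 1))) a₀ a)
    (sb : Settled (max c₀.val (max (h + 1) (a₀.val + 1))) (max c₀.val (max (u + 1) (a₀.val + 1))) b₀ b)
    (sc : Settled (max b₀.val (max (h + 1) (a₀.val + 1))) (max b₀.val (max (u + 1) (a₀.val + 1))) c₀ c)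
    (hl : ¬ LocBal u a.val b.val c.val) {a' b' c' : BTree} (hp : [a', b', c'].Perm [a, b, c])
    (hl' : LocBal u a'.val b'.val c'.val) :
    SubBal (node a' b' c') h ∧ SubBal (node a' b' c') u ∧
      h < (node a₀ b₀ c₀).val ∧ h < (node a' b' c').val := by
  have key : u = h + 1 ∧ a.val = a₀.val ∧ a₀.val ≤ h ∧
      ((b.val = b₀.val ∧ c.val = c₀.val ∧ h ≤ b.val ∧ h ≤ c.val ∧ b.val ≤ h + 1 ∧ c.val ≤ h + 1 ∧
          (b.val = h ∨ c.val = h)) ∨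
        (h + 1 < b.val ∧ h + 1 < b₀.val ∧ c.val = c₀.val ∧ c.val = h) ∨
        (h + 1 < c.val ∧ h + 1 < c₀.val ∧ b.val = b₀.val ∧ b.val = h)) := by
    have va := sa.val
    have vb := sb.val
    have vc := sc.val
    clear hl' hp sa sb sc
    simp only [le_max_iff, max_lt_iff] at va vb vc
    rcases hloc with hloc | hloc
    · refine absurd (Or.inl ⟨?_, ?_, ?_, ?_⟩) hl <;> clear hl <;> omega
    · have ha : a.val = a₀.val ∧ a.val ≤ b.val ∧ a.val ≤ c.val ∧ h ≤ b.val ∧ h ≤ c.val := by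
        clear hl; omega
      have hu' : u = h + 1 ∧ (b.val = h ∨ c.val = h) := by
        by_contra hcon
        refine hl (Or.inr ⟨?_, ?_, ?_, ?_⟩) <;> clear hl va vb vc hloc <;> omega
      clear hl
      refine ⟨hu'.1, ha.1, by omega, ?_⟩
      rcases vb with vb | vb <;> rcases vc with vc | vc
      · left; omega
      · right; right; omega
      · right; left; omega
      · omega
  obtain ⟨rfl, k1, k2, key⟩ := key
  clear hloc hu
  -- Two values at most `h`, one of them equal to `h`, give a heavy child the back value `h + 1`: at
  -- the side before the rearrangement, and ahead after it, with `h` or with `h + 1` behind.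
  have hmax : ∀ {p q : ℤ}, p ≤ h → q ≤ h → (p = h ∨ q = h) →
      max h (max (p + 1) (q + 1)) = h + 1 ∧ max (h + 1) (max (p + 1) (q + 1)) = h + 1 ∧
      max p (max (h + 1) (q + 1)) = h + 1 := by
    intro p q _ _ _; omega
  have hge : ∀ {p q : ℤ}, h + 1 ≤ max p (max (h + 1) q) ∧ h + 1 ≤ max p (max (h + 1 + 1) q) := by
    intro p q; omega
  have hge' : ∀ {p q r : ℤ}, p = h ∨ q = h → r ≤ h + 1 →
      r ≤ max h (max (p + 1) (q + 1)) ∧ r ≤ max (h + 1) (max (p + 1) (q + 1)) := by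
    intro p q r _ _; omega
  unfold LocBal at hl hl'
  simp only [val_node, lt_max_iff]
  rcases sa with ⟨la, rfl, fa⟩ | ⟨la, -, -, -⟩
  swap
  · simp only [max_lt_iff] at la; omega
  rcases key with ⟨kb, kc, key⟩ | key | key
  · have fb : ∀ H, b.val ≤ H → SubBal b H := by
      rcases sb with ⟨lb, rfl, fb⟩ | ⟨lb, -, -, -⟩
      · exact fb
      · simp only [max_lt_iff] at lb; omega
    have fc : ∀ H, c.val ≤ H → SubBal c H := by
      rcases sc with ⟨lc, rfl, fc⟩ | ⟨lc, -, -, -⟩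
      · exact fc
      · simp only [max_lt_iff] at lc; omega
    have concl : ∀ x y z : BTree, (∀ H, x.val ≤ H → SubBal x H) → (∀ H, y.val ≤ H → SubBal y H) →
        (∀ H, z.val ≤ H → SubBal z H) → x.val ≤ h + 1 → y.val ≤ h + 1 → z.val ≤ h + 1 →
        LocBal (h + 1) x.val y.val z.val → LocBal h x.val y.val z.val →
        (y.val = h ∨ z.val = h) →
        SubBal (node x y z) h ∧ SubBal (node x y z) (h + 1) := by
      intro x y z fx fy fz x1 y1 z1 l1 l2 hyz
      exact ⟨⟨l2, fx _ (hge' hyz x1).1, fy _ (y1.trans hge.1), fz _ (z1.trans hge.1)⟩,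
        ⟨l1, fx _ (hge' hyz x1).2, fy _ (y1.trans hge.2), fz _ (z1.trans hge.2)⟩⟩
    have a1 : a.val ≤ h + 1 := by omega
    have b1 : b.val ≤ h + 1 := by omega
    have c1 : c.val ≤ h + 1 := by omega
    clear hmax hge hge' la sb sc
    rw [← and_assoc]
    have hgt : h < b.val ∨ h < b.val + 1 := Or.inr (by omega)
    rcases perm_three hp with ⟨rfl, rfl, rfl⟩ | ⟨rfl, rfl, rfl⟩ | ⟨rfl, rfl, rfl⟩ | ⟨rfl, rfl, rfl⟩ |
      ⟨rfl, rfl, rfl⟩ | ⟨rfl, rfl, rfl⟩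
    · exact absurd hl' hl
    · exact absurd (by omega) hl
    · exact ⟨concl _ _ _ fb fa fc b1 a1 c1 hl' (by unfold LocBal; omega) (by omega), by omega⟩
    · exact ⟨concl _ _ _ fb fc fa b1 c1 a1 hl' (by unfold LocBal; omega) (by omega), by omega⟩
    · exact ⟨concl _ _ _ fc fa fb c1 a1 b1 hl' (by unfold LocBal; omega) (by omega), by omega⟩
    · exact ⟨concl _ _ _ fc fb fa c1 b1 a1 hl' (by unfold LocBal; omega) (by omega), by omega⟩
  · have fc : ∀ H, c.val ≤ H → SubBal c H := by
      rcases sc with ⟨lc, rfl, fc⟩ | ⟨lc, -, -, -⟩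
      · exact fc
      · simp only [max_lt_iff] at lc; omega
    have pb : SubBal b (h + 1) := by
      rcases sb with ⟨lb, rfl, fb⟩ | ⟨lb, pb, -, -⟩
      · simp only [le_max_iff] at lb; omega
      · rwa [(hmax (by omega) k2 (by omega)).2.2] at pb
    have a1 : a.val ≤ h + 1 := by omega
    have c1 : c.val ≤ h + 1 := by omega
    -- With `h + 1` behind and the other two values at most `h`, only an arrangement with the heavy
    -- child ahead is balanced.
    rcases perm_three hp with ⟨rfl, rfl, rfl⟩ | ⟨rfl, rfl, rfl⟩ | ⟨rfl, rfl, rfl⟩ | ⟨rfl, rfl, rfl⟩ |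
      ⟨rfl, rfl, rfl⟩ | ⟨rfl, rfl, rfl⟩
    · exact absurd hl' hl
    · omega
    · clear hl
      refine ⟨⟨by unfold LocBal; omega, ?_, fa _ (a1.trans hge.1), fc _ (c1.trans hge.1)⟩,
        ⟨by unfold LocBal; omega, ?_, fa _ (a1.trans hge.2), fc _ (c1.trans hge.2)⟩, ?_, ?_⟩
      · rwa [(hmax k2 (by omega) (by omega)).1]
      · rwa [(hmax k2 (by omega) (by omega)).2.1]
      · omega
      · omega
    · clear hl
      refine ⟨⟨by unfold LocBal; omega, ?_, fc _ (c1.trans hge.1), fa _ (a1.trans hge.1)⟩,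
        ⟨by unfold LocBal; omega, ?_, fc _ (c1.trans hge.2), fa _ (a1.trans hge.2)⟩, ?_, ?_⟩
      · rwa [(hmax (by omega) k2 (by omega)).1]
      · rwa [(hmax (by omega) k2 (by omega)).2.1]
      · omega
      · omega
    · omega
    · omega
  · have fb : ∀ H, b.val ≤ H → SubBal b H := by
      rcases sb with ⟨lb, rfl, fb⟩ | ⟨lb, -, -, -⟩
      · exact fb
      · simp only [max_lt_iff] at lb; omega
    have pc : SubBal c (h + 1) := by
      rcases sc with ⟨lc, rfl, fc⟩ | ⟨lc, pc, -, -⟩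
      · simp only [le_max_iff] at lc; omega
      · rwa [(hmax (by omega) k2 (by omega)).2.2] at pc
    have a1 : a.val ≤ h + 1 := by omega
    have b1 : b.val ≤ h + 1 := by omega
    rcases perm_three hp with ⟨rfl, rfl, rfl⟩ | ⟨rfl, rfl, rfl⟩ | ⟨rfl, rfl, rfl⟩ | ⟨rfl, rfl, rfl⟩ |
      ⟨rfl, rfl, rfl⟩ | ⟨rfl, rfl, rfl⟩
    · exact absurd hl' hl
    · omega
    · omega
    · omega
    · clear hl
      refine ⟨⟨by unfold LocBal; omega, ?_, fa _ (a1.trans hge.1), fb _ (b1.trans hge.1)⟩,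
        ⟨by unfold LocBal; omega, ?_, fa _ (a1.trans hge.2), fb _ (b1.trans hge.2)⟩, ?_, ?_⟩
      · rwa [(hmax k2 (by omega) (by omega)).1]
      · rwa [(hmax k2 (by omega) (by omega)).2.1]
      · omega
      · omega
    · clear hl
      refine ⟨⟨by unfold LocBal; omega, ?_, fb _ (b1.trans hge.1), fa _ (a1.trans hge.1)⟩,
        ⟨by unfold LocBal; omega, ?_, fb _ (b1.trans hge.2), fa _ (a1.trans hge.2)⟩, ?_, ?_⟩
      · rwa [(hmax (by omega) k2 (by omega)).1]
      · rwa [(hmax (by omega) k2 (by omega)).2.1]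
      · omega
      · omega

end settled

/-- A call at a vertex: the calls for the trees below, then the balance step at the vertex. -/
theorem call_node {es : List (ZMod 4)} {G F F' : ZMod 4 → BTree} (hc : Calls es G F)
    (hnd : es.Nodup) (hes : ∀ i, i ∈ es ↔ i ≠ 2 ∧ G i ≠ nil)
    (hF : (LocBal (G 2).val (F 0).val (F 1).val (F 3).val ∧ F' = F) ∨
      (¬ LocBal (G 2).val (F 0).val (F 1).val (F 3).val ∧ [F' 0, F' 1, F' 3].Perm [F 0, F 1, F 3] ∧
        LocBal (G 2).val (F' 0).val (F' 1).val (F' 3).val)) :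
    Call (G 2).val (node (G 0) (G 1) (G 3)) (node (F' 0) (F' 1) (F' 3)) := by
  intro h hG hh hu
  have hinit : ∀ i, i ≠ 2 → SlotOk h G es G i := by
    intro i hi
    by_cases hl : (G i).val ≤ upVal (Function.update (fun j => (G j).val) 2 h) i
    · exact Or.inl ⟨hl, rfl⟩
    -- All back values are at least `-1`, so a heavy child is not virtual and its call is pending.
    · refine Or.inr ⟨not_le.1 hl, Or.inl ⟨(hes i).2 ⟨hi, fun hn => hl ?_⟩, rfl⟩⟩
      rw [hn, val_nil]
      unfold upVal
      refine le_trans ?_ (le_max_left _ _)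
      by_cases h2 : i + 2 = 2
      · rw [h2]; simpa using hh
      · rw [Function.update_of_ne h2]; exact neg_one_le_val _
  obtain ⟨hs, -⟩ := hc.slotOk hG hh hu hnd (fun h2 => ((hes 2).1 h2).1 rfl) hinit rfl
  have s0 := (hs 0 (by decide)).settled (by decide) hG
  have s1 := (hs 1 (by decide)).settled (by decide) hG
  have s3 := (hs 3 (by decide)).settled (by decide) hG
  rw [upVal_update_zero] at s0
  rw [upVal_update_one] at s1
  rw [upVal_update_three, max_comm ((G 0).val + 1)] at s3
  simp only [upVal, zmod4_add] at s0 s1 s3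
  rw [max_comm ((G 0).val + 1)] at s3
  rcases hF with ⟨hl, rfl⟩ | ⟨hl, hp, hl'⟩
  · exact Settled.keep hG.1 hu s0 s1 s3 hl
  · obtain ⟨h1, h2, h3, h4⟩ := Settled.repair hG.1 hu s0 s1 s3 hl hp hl'
    exact ⟨h1, h2, fun h5 => absurd h3 (not_lt.2 h5), fun _ => h4⟩

/-! ### Optimality of balanced rooted trees. -/

/-- Equality of rooted trees up to the positions of the subtrees. -/
inductive Iso : BTree → BTree → Prop
  | nil : Iso nil nil
  | node {a b c a₂ b₂ c₂ a' b' c' : BTree} : Iso a a₂ → Iso b b₂ → Iso c c₂ →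
      [a', b', c'].Perm [a₂, b₂, c₂] → Iso (node a b c) (node a' b' c')

/-- The maximum number of bends of a path between two leaves of the tree. -/
def dia : BTree → ℤ
  | nil => -1
  | node a b c => max (max a.dia (max b.dia c.dia))
      (max (a.val + b.val + 1) (max (a.val + c.val + 1) (b.val + c.val)))

/-- Only the child ahead costs no bend, so the maximum is least when the child of largest value is
there; the values of the children are least by induction. -/
lemma Srt.val_le {t t' : BTree} (h : Srt t) (hi : Iso t t') : t.val ≤ t'.val := by
  induction hi with
  | nil => exact le_rfl
  | node _ _ _ hp iha ihb ihc =>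
    obtain ⟨h1, h2, sa, sb, sc⟩ := h
    have := iha sa
    have := ihb sb
    have := ihc sc
    rcases perm_three hp with ⟨rfl, rfl, rfl⟩ | ⟨rfl, rfl, rfl⟩ | ⟨rfl, rfl, rfl⟩ |
      ⟨rfl, rfl, rfl⟩ | ⟨rfl, rfl, rfl⟩ | ⟨rfl, rfl, rfl⟩ <;> simp only [val_node] <;> omega

/-- A path turning at the root joins one part of at most `val` bends to another of at most `h`. A
side child sees `h + 1` behind it, but its own value is at most `val - 1`, so the induction closes.
-/
lemma SubBal.dia_le {t : BTree} : ∀ {h : ℤ}, SubBal t h → t.val ≤ h → 0 ≤ h →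
    t.dia ≤ t.val + h := by
  induction t with
  | nil => intro h _ _ _; simp only [dia, val_nil]; omega
  | node a b c iha ihb ihc =>
    rintro h ⟨hl, sa, sb, sc⟩ hv hh
    simp only [val_node] at hv
    have := iha sa (by omega) (by omega)
    have := ihb sb (by omega) (by omega)
    have := ihc sc (by omega) (by omega)
    unfold LocBal at hl
    simp only [val_node, dia]
    omega

/-- Up to exchanging the sides, an arrangement is determined by the child opposite to the direction
behind; hence the three cases. -/
lemma pieces_le {a b c a' b' c' : BTree} {h X : ℤ} (hp : [a', b', c'].Perm [a, b, c])
    (hX : max (node a' b' c').dia ((node a' b' c').val + h) ≤ X) :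
    a.dia ≤ X ∧ b.dia ≤ X ∧ c.dia ≤ X ∧
    ((a.val + h ≤ X ∧ b.val + c.val ≤ X ∧ b.val + h + 1 ≤ X ∧ c.val + h + 1 ≤ X ∧
        a.val + b.val + 1 ≤ X ∧ a.val + c.val + 1 ≤ X) ∨
      (b.val + h ≤ X ∧ a.val + c.val ≤ X ∧ a.val + h + 1 ≤ X ∧ c.val + h + 1 ≤ X ∧
        a.val + b.val + 1 ≤ X ∧ b.val + c.val + 1 ≤ X) ∨
      (c.val + h ≤ X ∧ a.val + b.val ≤ X ∧ a.val + h + 1 ≤ X ∧ b.val + h + 1 ≤ X ∧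
        b.val + c.val + 1 ≤ X ∧ a.val + c.val + 1 ≤ X)) := by
  simp only [dia, val_node, max_le_iff] at hX
  obtain ⟨⟨⟨x1, x2, x3⟩, x4, x5, x6⟩, x7⟩ := hX
  have y1 : a'.val + h ≤ X := by omega
  have y2 : b'.val + h + 1 ≤ X := by omega
  have y3 : c'.val + h + 1 ≤ X := by omega
  clear x7
  rcases perm_three hp with ⟨rfl, rfl, rfl⟩ | ⟨rfl, rfl, rfl⟩ | ⟨rfl, rfl, rfl⟩ |
    ⟨rfl, rfl, rfl⟩ | ⟨rfl, rfl, rfl⟩ | ⟨rfl, rfl, rfl⟩ <;>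
    refine ⟨by assumption, by assumption, by assumption, ?_⟩
  · exact Or.inl ⟨by omega, by omega, by omega, by omega, by omega, by omega⟩
  · exact Or.inl ⟨by omega, by omega, by omega, by omega, by omega, by omega⟩
  · exact Or.inr (Or.inl ⟨by omega, by omega, by omega, by omega, by omega, by omega⟩)
  · exact Or.inr (Or.inl ⟨by omega, by omega, by omega, by omega, by omega, by omega⟩)
  · exact Or.inr (Or.inr ⟨by omega, by omega, by omega, by omega, by omega, by omega⟩)
  · exact Or.inr (Or.inr ⟨by omega, by omega, by omega, by omega, by omega, by omega⟩)

/-- Among all drawings of a tree a balanced one has the least number of bends. -/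
theorem Iso.optimal {t t' : BTree} (hi : Iso t t') : ∀ {h : ℤ}, SubBal t h → 0 ≤ h →
    max t.dia (t.val + h) ≤ max t'.dia (t'.val + h) := by
  induction hi with
  | nil => intros; exact le_rfl
  | @node a b c a₂ b₂ c₂ a' b' c' ia ib ic hp iha ihb ihc =>
    -- The compared quantity is the largest number of bends when a path with `h` bends continues
    -- behind the root.
    intro h hs hh
    by_cases hlight : (BTree.node a b c).val ≤ h
    · have h1 := hs.dia_le hlight hh
      have h2 := (hs.srt hlight).val_le (Iso.node ia ib ic hp)
      exact le_trans (max_le (by omega) (by omega)) (le_max_right _ (_ + h))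
    obtain ⟨hl, sa, sb, sc⟩ := hs
    have lightA := fun hx => (sa.srt hx).val_le ia
    have lightB := fun hx => (sb.srt hx).val_le ib
    have lightC := fun hx => (sc.srt hx).val_le ic
    have diaA := fun hx => sa.dia_le hx (by omega)
    have diaB := fun hx => sb.dia_le hx (by omega)
    have diaC := fun hx => sc.dia_le hx (by omega)
    have optA := iha sa (by omega)
    have optB := ihb sb (by omega)
    have optC := ihc sc (by omega)
    clear iha ihb ihc sa sb sc
    have hX := pieces_le (h := h) hp le_rfl
    generalize max (BTree.node a' b' c').dia ((BTree.node a' b' c').val + h) = X at hX ⊢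
    obtain ⟨x1, x2, x3, hX⟩ := hX
    unfold LocBal at hl
    simp only [val_node] at hlight
    by_cases hA : a.val ≤ max h (max (b.val + 1) (c.val + 1))
    · by_cases hB : b.val ≤ max c.val (max (h + 1) (a.val + 1))
      · by_cases hC : c.val ≤ max b.val (max (h + 1) (a.val + 1))
        · have lA := lightA hA
          have lB := lightB hB
          have lC := lightC hC
          have dA := diaA hA
          have dB := diaB hB
          have dC := diaC hC
          clear lightA lightB lightC diaA diaB diaC optA optB optC hA hB hC
          -- All children are light. Only straight connections between opposite directions save the
          -- bend, and balance puts the two largest of the four values opposite to each other.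
          have core : a.val + h ≤ X ∧ b.val + h + 1 ≤ X ∧ c.val + h + 1 ≤ X ∧
              a.val + b.val + 1 ≤ X ∧ a.val + c.val + 1 ≤ X ∧ b.val + c.val ≤ X := by
            clear dA dB dC
            rcases hl with hl | hl <;> rcases hX with hX | hX | hX <;>
              refine ⟨?_, ?_, ?_, ?_, ?_, ?_⟩ <;> omega
          clear hX hl
          simp only [dia, val_node, max_le_iff]
          refine ⟨⟨⟨?_, ?_, ?_⟩, ?_, ?_, ?_⟩, ?_⟩ <;> omega
        · have lA := lightA hA
          have lB := lightB hB
          have dA := diaA hA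
          have dB := diaB hB
          clear lightA lightB lightC diaA diaB diaC optA optB hA hB
          -- A heavy child at the side makes the left-right pair dominant, so its back value is at
          -- most `b.val + 1`. In any arrangement it is joined to the three other directions, to
          -- only one of them without a bend.
          have hU : c₂.val + max b.val (max (h + 1) (a.val + 1)) ≤ X := by
            clear optC dA dB
            rcases hl with hl | hl <;> rcases hX with hX | hX | hX <;> omega
          have dC : c.dia ≤ X := by omega
          have hV : c.val + max b.val (max (h + 1) (a.val + 1)) ≤ X := by omega
          clear hX hl optC hU
          simp only [dia, val_node, max_le_iff]
          refine ⟨⟨⟨?_, ?_, ?_⟩, ?_, ?_, ?_⟩, ?_⟩ <;> omega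
      · have lA := lightA hA
        have lC := lightC (by omega)
        have dA := diaA hA
        have dC := diaC (by omega)
        clear lightA lightB lightC diaA diaB diaC optA optC hA
        have hU : b₂.val + max c.val (max (h + 1) (a.val + 1)) ≤ X := by
          clear optB dA dC
          rcases hl with hl | hl <;> rcases hX with hX | hX | hX <;> omega
        have dB : b.dia ≤ X := by omega
        have hV : b.val + max c.val (max (h + 1) (a.val + 1)) ≤ X := by omega
        clear hX hl optB hU
        simp only [dia, val_node, max_le_iff]
        refine ⟨⟨⟨?_, ?_, ?_⟩, ?_, ?_, ?_⟩, ?_⟩ <;> omega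
    · have lB := lightB (by omega)
      have lC := lightC (by omega)
      have dB := diaB (by omega)
      have dC := diaC (by omega)
      clear lightA lightB lightC diaA diaB diaC optB optC
      have hU : a₂.val + max h (max (b.val + 1) (c.val + 1)) ≤ X := by
        clear optA dB dC
        rcases hl with hl | hl <;> rcases hX with hX | hX | hX <;> omega
      have dA : a.dia ≤ X := by omega
      have hV : a.val + max h (max (b.val + 1) (c.val + 1)) ≤ X := by omega
      clear hX hl optA hU
      simp only [dia, val_node, max_le_iff]
      refine ⟨⟨⟨?_, ?_, ?_⟩, ?_, ?_, ?_⟩, ?_⟩ <;> omega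

end BTree
end StraightModel

namespace StraightModel

open BTree

/-! ### Branches of a tree at a vertex. -/

section sides

variable {V : Type*} {T : SimpleGraph V}

/-- The vertices that are reached from `v` without passing `q`. -/
def Side (T : SimpleGraph V) (q v x : V) : Prop :=
  ∃ w : T.Walk v x, w.IsPath ∧ q ∉ w.support

/-- The vertex set `S` contains the paths between its elements. -/
def PathClosed (T : SimpleGraph V) (S : Set V) : Prop :=
  ∀ x ∈ S, ∀ y ∈ S, ∀ w : T.Walk x y, w.IsPath → ∀ z ∈ w.support, z ∈ S

lemma walk_eq (hT : T.IsAcyclic) {x y : V} {p q : T.Walk x y} (hp : p.IsPath) (hq : q.IsPath) :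
    p = q :=
  congrArg Subtype.val ((hT.subsingleton_path x y).elim ⟨p, hp⟩ ⟨q, hq⟩)

lemma side_self {q v : V} (h : T.Adj q v) : Side T q v v :=
  ⟨.nil, .nil, by simpa using h.ne⟩

lemma not_side_self {q v : V} : ¬ Side T q v q := fun ⟨w, _, h⟩ => h w.end_mem_support

lemma Side.unique (hT : T.IsAcyclic) {p v w x : V} (hv : T.Adj p v) (hw : T.Adj p w)
    (h1 : Side T p v x) (h2 : Side T p w x) : v = w := by
  obtain ⟨a, ha, hpa⟩ := h1
  obtain ⟨b, hb, hpb⟩ := h2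
  have := walk_eq hT (ha.cons (h := hv) hpa) (hb.cons (h := hw) hpb)
  simp only [SimpleGraph.Walk.cons.injEq] at this
  exact this.1

/-- Otherwise the part of the path from `y` to `x` competes with the edge `y x`; it must have length
one, which forces `y = v`. -/
lemma not_mem_support_of_adj (hT : T.IsAcyclic) {u v x y : V} {q : T.Walk u v} {h : T.Adj v x}
    (hq : (q.concat h).IsPath) (hxy : T.Adj x y) (hy : y ≠ v) : y ∉ (q.concat h).support := by
  classical
  obtain ⟨hq, hx⟩ := SimpleGraph.Walk.concat_isPath_iff h |>.1 hq
  rw [SimpleGraph.Walk.support_concat]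
  simp only [List.mem_append, List.mem_singleton, not_or]
  refine ⟨fun hmem => hy ?_, hxy.ne'⟩
  have hd : ((q.dropUntil y hmem).concat h).IsPath :=
    (SimpleGraph.Walk.concat_isPath_iff h).2
      ⟨hq.dropUntil hmem, fun hh => hx (q.support_dropUntil_subset_support hmem hh)⟩
  have := congrArg SimpleGraph.Walk.length
    (walk_eq hT hd (SimpleGraph.Walk.IsPath.nil.cons (h := hxy.symm) (by simpa using hxy.ne')))
  simp only [SimpleGraph.Walk.length_concat, SimpleGraph.Walk.length_cons,
    SimpleGraph.Walk.length_nil] at this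
  exact SimpleGraph.Walk.eq_of_length_eq_zero (by omega : (q.dropUntil y hmem).length = 0)

/-- If the path met `q`, its beginning would give a second path from `v` to `q` beside the edge. -/
lemma Side.step (hT : T.IsAcyclic) {q v w x : V} (hqv : T.Adj q v) (hvw : T.Adj v w) (hwq : w ≠ q)
    (h : Side T v w x) : Side T q v x := by
  classical
  obtain ⟨p, hp, hv⟩ := h
  refine ⟨p.cons hvw, hp.cons hv, ?_⟩
  simp only [SimpleGraph.Walk.support_cons, List.mem_cons, not_or]
  refine ⟨hqv.ne, fun hmem => hwq ?_⟩
  have h1 : ((p.takeUntil q hmem).cons hvw).IsPath :=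
    (hp.takeUntil hmem).cons fun hh => hv (p.support_takeUntil_subset_support hmem hh)
  have := walk_eq hT h1 (SimpleGraph.Walk.IsPath.nil.cons (h := hqv.symm) (by simpa using hqv.ne'))
  simp only [SimpleGraph.Walk.cons.injEq] at this
  exact this.1

lemma Side.cases {q v x : V} (h : Side T q v x) :
    x = v ∨ ∃ w, T.Adj v w ∧ w ≠ q ∧ Side T v w x := by
  obtain ⟨p, hp, hq⟩ := h
  cases p with
  | nil => exact Or.inl rfl
  | @cons _ w _ ha p =>
    refine Or.inr ⟨w, ha, ?_, p, ((SimpleGraph.Walk.cons_isPath_iff ha p).1 hp).1,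
      ((SimpleGraph.Walk.cons_isPath_iff ha p).1 hp).2⟩
    rintro rfl
    simp at hq

lemma exists_side (hT : T.IsTree) {v x : V} (h : x ≠ v) : ∃ w, T.Adj v w ∧ Side T v w x := by
  obtain ⟨p, hp, -⟩ := hT.existsUnique_path v x
  cases p with
  | nil => exact absurd rfl h
  | @cons _ w _ ha p =>
    exact ⟨w, ha, p, ((SimpleGraph.Walk.cons_isPath_iff ha p).1 hp).1,
      ((SimpleGraph.Walk.cons_isPath_iff ha p).1 hp).2⟩

lemma mem_branch_iff (hT : T.IsAcyclic) {v u x : V} (h : T.Adj v u) :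
    x ∈ branch T v u ↔ x = v ∨ Side T v u x := by
  classical
  constructor
  · rintro (rfl | ⟨p, hp, hu⟩)
    · exact Or.inl rfl
    · cases p with
      | nil => exact Or.inl rfl
      | @cons _ w _ ha p =>
        obtain ⟨hp1, hp2⟩ := (SimpleGraph.Walk.cons_isPath_iff ha p).1 hp
        have hu' : u ∈ p.support := by
          simpa [h.ne'] using hu
        have h1 : ((p.takeUntil u hu').cons ha).IsPath :=
          (hp1.takeUntil hu').cons fun hh => hp2 (p.support_takeUntil_subset_support hu' hh)
        have := walk_eq hT h1 (SimpleGraph.Walk.IsPath.nil.cons (h := h) (by simpa using h.ne))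
        simp only [SimpleGraph.Walk.cons.injEq] at this
        obtain ⟨rfl, -⟩ := this
        exact Or.inr ⟨p, hp1, hp2⟩
  · rintro (rfl | ⟨p, hp, hv⟩)
    · exact Or.inl rfl
    · exact Or.inr ⟨p.cons h, hp.cons hv, by simp⟩

lemma PathClosed.side_mem {S : Set V} (hS : PathClosed T S) {v w x : V} (hv : v ∈ S) (hx : x ∈ S)
    (hvw : T.Adj v w) (h : Side T v w x) : w ∈ S := by
  obtain ⟨p, hp, hvp⟩ := h
  exact hS v hv x hx (p.cons hvw) (hp.cons hvp) w (by simp)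

end sides

/-! ### Direction systems -/

section dirsys

variable {V : Type*} {T : SimpleGraph V} {S : Set V} {nb nb' : V → ZMod 4 → Option V}

/-- `nb v d` is the neighbour in direction `d` of `v` in the tree induced by `S`. -/
structure DirSys (T : SimpleGraph V) (S : Set V) (nb : V → ZMod 4 → Option V) : Prop where
  mem : ∀ {v d x}, v ∈ S → nb v d = some x → x ∈ S ∧ T.Adj v x
  surj : ∀ {v x}, v ∈ S → x ∈ S → T.Adj v x → ∃ d, nb v d = some x
  inj : ∀ {v d e x}, v ∈ S → nb v d = some x → nb v e = some x → d = e
  opp : ∀ {v d x}, v ∈ S → nb v d = some x → nb x (d + 2) = some v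

/-- `Sees nb v d t`: the tree `t` is what is seen from `v` in direction `d`. -/
inductive Sees (nb : V → ZMod 4 → Option V) : V → ZMod 4 → BTree → Prop
  | nil {v : V} {d : ZMod 4} : nb v d = none → Sees nb v d nil
  | node {v x : V} {d : ZMod 4} {a b c : BTree} : nb v d = some x → Sees nb x d a →
      Sees nb x (d + 1) b → Sees nb x (d + 3) c → Sees nb v d (node a b c)

lemma Sees.unique {v : V} {d : ZMod 4} {t t' : BTree} (h : Sees nb v d t) (h' : Sees nb v d t') :
    t = t' := by
  induction h generalizing t' with
  | nil h =>
    cases h' with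
    | nil => rfl
    | node h1 => simp [h] at h1
  | node h _ _ _ iha ihb ihc =>
    cases h' with
    | nil h1 => simp [h] at h1
    | node h1 ha hb hc =>
      rw [h] at h1
      cases h1
      rw [iha ha, ihb hb, ihc hc]

lemma zmod4_turn_ne (d : ZMod 4) : d ≠ d + 2 ∧ d + 1 ≠ d + 2 ∧ d + 3 ≠ d + 2 := by
  revert d; decide

lemma zmod4_add_two_two (d : ZMod 4) : d + 2 + 2 = d := by
  revert d; decide

lemma zmod4_cases' (d e : ZMod 4) : e = d ∨ e = d + 1 ∨ e = d + 2 ∨ e = d + 3 := by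
  revert d e; decide

lemma DirSys.ne_back (hD : DirSys T S nb) {v x y : V} {d e : ZMod 4} (hv : v ∈ S)
    (hx : nb v d = some x) (hy : nb x e = some y) (he : e ≠ d + 2) : y ≠ v := by
  rintro rfl
  exact he (hD.inj (hD.mem hv hx).1 hy (hD.opp hv hx))

/-- The recursive description is finite because each step prolongs a path of the finite tree; `k`
bounds the number of steps that remain. -/
lemma DirSys.exists_sees [Finite V] (hT : T.IsAcyclic) (hD : DirSys T S nb) {v : V} (hv : v ∈ S)
    (d : ZMod 4) : ∃ t, Sees nb v d t := by
  have := Fintype.ofFinite V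
  suffices H : ∀ (k : ℕ) (u v : V) (d : ZMod 4) (q : T.Walk u v), v ∈ S → q.IsPath →
      Fintype.card V ≤ q.length + k → (∀ x, nb v d = some x → x ∉ q.support) →
      ∃ t, Sees nb v d t by
    refine H (Fintype.card V) v v d .nil hv .nil (by simp) fun x hx => ?_
    simpa using (hD.mem hv hx).2.ne'
  intro k
  induction k with
  | zero => intro u v d q _ hq hl; exact absurd hq.length_lt (by omega)
  | succ k ih =>
    intro u v d q hv hq hl hns
    rcases hx : nb v d with _ | x
    · exact ⟨_, Sees.nil hx⟩
    · have hadj := (hD.mem hv hx).2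
      have hxS := (hD.mem hv hx).1
      have hq' : (q.concat hadj).IsPath :=
        (SimpleGraph.Walk.concat_isPath_iff hadj).2 ⟨hq, hns x hx⟩
      have hrec : ∀ e, e ≠ d + 2 → ∃ t, Sees nb x e t := by
        intro e he
        refine ih u x e (q.concat hadj) hxS hq' ?_ fun y hy => ?_
        · rw [SimpleGraph.Walk.length_concat]; omega
        · exact not_mem_support_of_adj hT hq' (hD.mem hxS hy).2 (hD.ne_back hv hx hy he)
      obtain ⟨n0, n1, n3⟩ := zmod4_turn_ne d
      obtain ⟨a, ha⟩ := hrec _ n0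
      obtain ⟨b, hb⟩ := hrec _ n1
      obtain ⟨c, hc⟩ := hrec _ n3
      exact ⟨_, Sees.node hx ha hb hc⟩

open Classical in
/-- The tree that is seen from `v` in direction `d`. -/
noncomputable def see (nb : V → ZMod 4 → Option V) (v : V) (d : ZMod 4) : BTree :=
  if h : ∃ t, Sees nb v d t then h.choose else BTree.nil

lemma Sees.see_eq {v : V} {d : ZMod 4} {t : BTree} (h : Sees nb v d t) : see nb v d = t := by
  have : ∃ t, Sees nb v d t := ⟨t, h⟩
  rw [see, dif_pos this]
  exact this.choose_spec.unique h

lemma see_none {v : V} {d : ZMod 4} (h : nb v d = none) : see nb v d = BTree.nil :=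
  (Sees.nil h).see_eq

lemma DirSys.sees_see [Finite V] (hT : T.IsAcyclic) (hD : DirSys T S nb) {v : V} (hv : v ∈ S)
    (d : ZMod 4) : Sees nb v d (see nb v d) := by
  obtain ⟨t, ht⟩ := hD.exists_sees hT hv d
  rwa [ht.see_eq]

lemma DirSys.see_some [Finite V] (hT : T.IsAcyclic) (hD : DirSys T S nb) {v x : V} {d : ZMod 4} (hv : v ∈ S)
    (h : nb v d = some x) :
    see nb v d = BTree.node (see nb x d) (see nb x (d + 1)) (see nb x (d + 3)) :=
  have hx := (hD.mem hv h).1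
  (Sees.node h (hD.sees_see hT hx _) (hD.sees_see hT hx _) (hD.sees_see hT hx _)).see_eq

lemma DirSys.see_eq_nil_iff [Finite V] (hT : T.IsAcyclic) (hD : DirSys T S nb) {v : V} {d : ZMod 4}
    (hv : v ∈ S) : see nb v d = BTree.nil ↔ nb v d = none := by
  refine ⟨fun h => ?_, see_none⟩
  rcases hx : nb v d with _ | x
  · rfl
  · rw [hD.see_some hT hv hx] at h
    cases h

/-- Induction along the edges that point away from a vertex. -/
lemma DirSys.induct [Finite V] (hT : T.IsAcyclic) (hD : DirSys T S nb) {P : V → ZMod 4 → V → Prop}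
    (h : ∀ q d v, q ∈ S → nb q d = some v →
      (∀ e x, e ≠ d + 2 → nb v e = some x → P v e x) → P q d v)
    {q v : V} {d : ZMod 4} (hq : q ∈ S) (hv : nb q d = some v) : P q d v := by
  have hs := hD.sees_see hT hq d
  generalize see nb q d = t at hs
  induction hs generalizing v with
  | nil h1 => simp [hv] at h1
  | @node q x d a b c h1 _ _ _ iha ihb ihc =>
    have hx := (hD.mem hq h1).1
    obtain rfl : x = v := Option.some.inj (h1.symm.trans hv)
    refine h q d x hq hv fun e y he hy => ?_
    rcases zmod4_cases' d e with rfl | rfl | rfl | rfl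
    · exact iha hx hy
    · exact ihb hx hy
    · exact absurd rfl he
    · exact ihc hx hy

/-- The value seen from `v` in direction `d`. -/
noncomputable def seeVal (nb : V → ZMod 4 → Option V) (v : V) (d : ZMod 4) : ℤ := (see nb v d).val

/-- `v` is balanced, in terms of directions. -/
def BalAt (nb : V → ZMod 4 → Option V) (v : V) : Prop :=
  LocBal (seeVal nb v 2) (seeVal nb v 0) (seeVal nb v 1) (seeVal nb v 3)

lemma LocBal.rotate {f : ZMod 4 → ℤ} (d : ZMod 4) :
    LocBal (f (d + 2)) (f d) (f (d + 1)) (f (d + 3)) ↔ LocBal (f 2) (f 0) (f 1) (f 3) := by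
  rcases zmod4_cases d with rfl | rfl | rfl | rfl <;> simp only [zmod4_add, LocBal] <;> tauto

lemma balAt_iff {v : V} (d : ZMod 4) : BalAt nb v ↔
    LocBal (seeVal nb v (d + 2)) (seeVal nb v d) (seeVal nb v (d + 1)) (seeVal nb v (d + 3)) :=
  (LocBal.rotate (f := seeVal nb v) d).symm

lemma DirSys.seeVal_back [Finite V] (hT : T.IsAcyclic) (hD : DirSys T S nb) {v x : V} {d : ZMod 4}
    (hv : v ∈ S) (h : nb v d = some x) : seeVal nb x (d + 2) = upVal (seeVal nb v) d := by
  have hx := (hD.mem hv h).1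
  rw [seeVal, hD.see_some hT hx (hD.opp hv h), val_node, upVal]
  rw [show d + 2 + 1 = d + 3 by ring, show d + 2 + 3 = d + 1 by
    rw [add_assoc]; congr 1]
  rw [max_comm ((see nb v (d + 3)).val + 1)]
  rfl

lemma upVal_turns (f : ZMod 4 → ℤ) (d : ZMod 4) :
    upVal f d = max (f (d + 2)) (max (f (d + 1) + 1) (f (d + 3) + 1)) ∧
    upVal f (d + 1) = max (f (d + 3)) (max (f (d + 2) + 1) (f d + 1)) ∧
    upVal f (d + 3) = max (f (d + 1)) (max (f d + 1) (f (d + 2) + 1)) := by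
  rcases zmod4_cases d with rfl | rfl | rfl | rfl <;> simp only [upVal, zmod4_add, and_self]

lemma DirSys.subBal_of_balAt [Finite V] (hT : T.IsAcyclic) (hD : DirSys T S nb) (hb : ∀ v ∈ S, BalAt nb v)
    {q v : V} {d : ZMod 4} (hq : q ∈ S) (hv : nb q d = some v) :
    SubBal (see nb q d) (seeVal nb v (d + 2)) := by
  refine hD.induct hT (P := fun q d v => SubBal (see nb q d) (seeVal nb v (d + 2))) ?_ hq hv
  intro q d v hq hv ih
  have hvS := (hD.mem hq hv).1
  rw [hD.see_some hT hq hv]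
  have key : ∀ e, e ≠ d + 2 → SubBal (see nb v e) (upVal (seeVal nb v) e) := by
    intro e he
    rcases hx : nb v e with _ | x
    · rw [see_none hx]; trivial
    · rw [← hD.seeVal_back hT hvS hx]
      exact ih e x he hx
  obtain ⟨n0, n1, n3⟩ := zmod4_turn_ne d
  have k0 := key _ n0
  have k1 := key _ n1
  have k3 := key _ n3
  obtain ⟨u0, u1, u3⟩ := upVal_turns (seeVal nb v) d
  rw [u0] at k0
  rw [u1] at k1
  rw [u3, max_comm (seeVal nb v d + 1)] at k3
  exact ⟨(balAt_iff d).1 (hb v hvS), k0, k1, k3⟩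

lemma DirSys.balAt_of_subBal_side [Finite V] (hT : T.IsAcyclic) (hD : DirSys T S nb) (hS : PathClosed T S)
    {q v : V} {d : ZMod 4} (hq : q ∈ S) (hv : nb q d = some v)
    (hb : SubBal (see nb q d) (seeVal nb v (d + 2))) : ∀ z ∈ S, Side T q v z → BalAt nb z := by
  revert hb
  refine hD.induct hT (P := fun q d v => SubBal (see nb q d) (seeVal nb v (d + 2)) →
    ∀ z ∈ S, Side T q v z → BalAt nb z) ?_ hq hv
  intro q d v hq hv ih hb z hz hs
  have hvS := (hD.mem hq hv).1
  rw [hD.see_some hT hq hv] at hb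
  obtain ⟨hl, k0, k1, k3⟩ := hb
  obtain ⟨u0, u1, u3⟩ := upVal_turns (seeVal nb v) d
  change SubBal _ (max (seeVal nb v (d + 2)) (max (seeVal nb v (d + 1) + 1) (seeVal nb v (d + 3) + 1)))
    at k0
  change SubBal _ (max (seeVal nb v (d + 3)) (max (seeVal nb v (d + 2) + 1) (seeVal nb v d + 1)))
    at k1
  change SubBal _ (max (seeVal nb v (d + 1)) (max (seeVal nb v (d + 2) + 1) (seeVal nb v d + 1)))
    at k3
  rw [← u0] at k0
  rw [← u1] at k1
  rw [max_comm (seeVal nb v (d + 2) + 1), ← u3] at k3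
  rcases hs.cases with rfl | ⟨w, hw, hwq, hs'⟩
  · exact (balAt_iff d).2 hl
  · have hwS := hS.side_mem hvS hz hw hs'
    obtain ⟨e, he⟩ := hD.surj hvS hwS hw
    have he2 : e ≠ d + 2 := by
      rintro rfl
      rw [hD.opp hq hv] at he
      cases he
      exact hwq rfl
    refine ih e w he2 he ?_ z hz hs'
    rw [hD.seeVal_back hT hvS he]
    rcases zmod4_cases' d e with rfl | rfl | rfl | rfl
    · exact k0
    · exact k1
    · exact absurd rfl he2
    · exact k3

/-- A model is balanced everywhere if it is balanced at one vertex, and from there on. -/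
lemma DirSys.balAt_of_center [Finite V] (hT : T.IsTree) (hD : DirSys T S nb) (hS : PathClosed T S)
    {c : V} (hc : c ∈ S) (hb : BalAt nb c)
    (h : ∀ d, SubBal (see nb c d) (upVal (seeVal nb c) d)) : ∀ z ∈ S, BalAt nb z := by
  intro z hz
  by_cases hzc : z = c
  · exact hzc ▸ hb
  · obtain ⟨w, hw, hs⟩ := exists_side hT hzc
    have hwS := hS.side_mem hc hz hw hs
    obtain ⟨d, hd⟩ := hD.surj hc hwS hw
    refine hD.balAt_of_subBal_side hT.isAcyclic hS hc hd ?_ z hz hs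
    rw [hD.seeVal_back hT.isAcyclic hc hd]
    exact h d

/-- The two direction systems agree at `z`, up to a rotation. -/
def Loc (nb nb' : V → ZMod 4 → Option V) (z : V) : Prop := ∃ k, ∀ e, nb' z (e + k) = nb z e

lemma Loc.refl (nb : V → ZMod 4 → Option V) (z : V) : Loc nb nb z := ⟨0, fun e => by rw [add_zero]⟩

lemma Loc.trans {nb nb' nb'' : V → ZMod 4 → Option V} {z : V} (h : Loc nb nb' z)
    (h' : Loc nb' nb'' z) : Loc nb nb'' z := by
  obtain ⟨k, hk⟩ := h
  obtain ⟨l, hl⟩ := h'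
  exact ⟨k + l, fun e => by rw [← add_assoc, hl, hk]⟩

/-- What is seen through an edge depends only on relative directions at the vertices beyond it. A
local rotation is harmless since the edge by which the vertex is entered turns with it. -/
lemma DirSys.see_congr [Finite V] (hT : T.IsAcyclic) {S' : Set V} (hD : DirSys T S nb) (hD' : DirSys T S' nb')
    {q v : V} {d d' : ZMod 4} (hq : q ∈ S) (hv : nb q d = some v) (hq' : q ∈ S')
    (hv' : nb' q d' = some v) (hl : ∀ z ∈ S, Side T q v z → Loc nb nb' z) :
    see nb' q d' = see nb q d := by
  revert d' hl hq'
  suffices H : ∀ d', q ∈ S' → nb' q d' = some v →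
      (∀ z ∈ S, Side T q v z → Loc nb nb' z) → see nb' q d' = see nb q d by
    intro d' hq' hv' hl
    exact H d' hq' hv' hl
  refine hD.induct hT (P := fun q d v => ∀ d', q ∈ S' → nb' q d' = some v →
    (∀ z ∈ S, Side T q v z → Loc nb nb' z) → see nb' q d' = see nb q d) ?_ hq hv
  · intro q d v hq hv ih d' hq' hv' hl
    obtain ⟨hvS, hadj⟩ := hD.mem hq hv
    have hvS' := (hD'.mem hq' hv').1
    obtain ⟨k, hk⟩ := hl v hvS (side_self hadj)
    have h1 := hk (d + 2)
    rw [hD.opp hq hv] at h1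
    -- The edge back to `q` determines the rotation at `v`: it is the one that carries `d` to `d'`.
    have h2 := hD'.inj hvS' h1 (hD'.opp hq' hv')
    obtain rfl : d' = d + k := by
      have := congrArg (· + 2) h2
      simp only [zmod4_add_two_two] at this
      rw [← this, show d + 2 + k + 2 = (d + k) + 2 + 2 by ring, zmod4_add_two_two]
    rw [hD.see_some hT hq hv, hD'.see_some hT hq' hv']
    have key : ∀ e, e ≠ d + 2 → see nb' v (e + k) = see nb v e := by
      intro e he
      rcases hx : nb v e with _ | x
      · rw [see_none hx, see_none ((hk e).trans hx)]
      · refine ih e x he hx (e + k) hvS' ((hk e).trans hx) fun z hz hs => hl z hz ?_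
        exact hs.step hT hadj (hD.mem hvS hx).2 (hD.ne_back hq hv hx he)
    obtain ⟨n0, n1, n3⟩ := zmod4_turn_ne d
    rw [key _ n0, show d + k + 1 = d + 1 + k by ring, key _ n1,
      show d + k + 3 = d + 3 + k by ring, key _ n3]

end dirsys
end StraightModel

namespace StraightModel

/-! ### Directions of edges in a model. -/

section geometry

variable {V : Type*} {T : SimpleGraph V} {S : Set V} {M M' : V → GridPoint}

/-- The unit vectors: east, north, west, south. -/
def uvec (d : ZMod 4) : ℤ × ℤ :=
  if d = 0 then (1, 0) else if d = 1 then (0, 1) else if d = 2 then (-1, 0) else (0, -1)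

lemma uvec_zero : uvec 0 = (1, 0) := rfl
lemma uvec_one : uvec 1 = (0, 1) := rfl
lemma uvec_two : uvec 2 = (-1, 0) := rfl
lemma uvec_three : uvec 3 = (0, -1) := rfl

lemma uvec_injective : Function.Injective uvec := by
  intro d e
  revert d e
  decide

lemma quarterTurn_uvec (d : ZMod 4) : quarterTurn (uvec d) = uvec (d + 1) := by
  revert d; decide

lemma quarterTurn_iterate_uvec (k : ℕ) (d : ZMod 4) :
    quarterTurn^[k] (uvec d) = uvec (d + k) := by
  induction k generalizing d with
  | zero => simp
  | succ k ih =>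
    rw [Function.iterate_succ_apply, quarterTurn_uvec, ih]
    push_cast
    rw [add_assoc, add_comm (1 : ZMod 4)]

lemma mem_segment {p a b : GridPoint} : p ∈ segment a b ↔
    (min a.1 b.1 ≤ p.1 ∧ p.1 ≤ max a.1 b.1) ∧ (min a.2 b.2 ≤ p.2 ∧ p.2 ≤ max a.2 b.2) := by
  simp only [segment, Set.uIcc, Set.mem_Icc, Prod.le_def, Prod.fst_inf, Prod.snd_inf,
    Prod.fst_sup, Prod.snd_sup]
  tauto

lemma direction_eq_zero_iff {a b : GridPoint} : direction a b = uvec 0 ↔ a.1 < b.1 ∧ a.2 = b.2 := by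
  simp only [direction, uvec_zero, Prod.mk.injEq, Int.sign_eq_one_iff_pos, Int.sign_eq_zero_iff_zero]
  omega

lemma direction_eq_one_iff {a b : GridPoint} : direction a b = uvec 1 ↔ a.1 = b.1 ∧ a.2 < b.2 := by
  simp only [direction, uvec_one, Prod.mk.injEq, Int.sign_eq_one_iff_pos, Int.sign_eq_zero_iff_zero]
  omega

lemma direction_eq_two_iff {a b : GridPoint} : direction a b = uvec 2 ↔ b.1 < a.1 ∧ a.2 = b.2 := by
  simp only [direction, uvec_two, Prod.mk.injEq, Int.sign_eq_neg_one_iff_neg,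
    Int.sign_eq_zero_iff_zero]
  omega

lemma direction_eq_three_iff {a b : GridPoint} :
    direction a b = uvec 3 ↔ a.1 = b.1 ∧ b.2 < a.2 := by
  simp only [direction, uvec_three, Prod.mk.injEq, Int.sign_eq_neg_one_iff_neg,
    Int.sign_eq_zero_iff_zero]
  omega

lemma direction_cases {a b : GridPoint} {d : ZMod 4} : direction a b = uvec d ↔
    (d = 0 ∧ a.1 < b.1 ∧ a.2 = b.2) ∨ (d = 1 ∧ a.1 = b.1 ∧ a.2 < b.2) ∨
    (d = 2 ∧ b.1 < a.1 ∧ a.2 = b.2) ∨ (d = 3 ∧ a.1 = b.1 ∧ b.2 < a.2) := by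
  rcases BTree.zmod4_cases d with rfl | rfl | rfl | rfl
  · rw [direction_eq_zero_iff]; simp [show (0 : ZMod 4) ≠ 1 by decide,
      show (0 : ZMod 4) ≠ 2 by decide, show (0 : ZMod 4) ≠ 3 by decide]
  · rw [direction_eq_one_iff]; simp [show (1 : ZMod 4) ≠ 0 by decide,
      show (1 : ZMod 4) ≠ 2 by decide, show (1 : ZMod 4) ≠ 3 by decide]
  · rw [direction_eq_two_iff]; simp [show (2 : ZMod 4) ≠ 0 by decide,
      show (2 : ZMod 4) ≠ 1 by decide, show (2 : ZMod 4) ≠ 3 by decide]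
  · rw [direction_eq_three_iff]; simp [show (3 : ZMod 4) ≠ 0 by decide,
      show (3 : ZMod 4) ≠ 1 by decide, show (3 : ZMod 4) ≠ 2 by decide]

lemma direction_back {a b : GridPoint} {d : ZMod 4} (h : direction a b = uvec d) :
    direction b a = uvec (d + 2) := by
  rw [direction_cases] at h ⊢
  rcases h with ⟨rfl, h⟩ | ⟨rfl, h⟩ | ⟨rfl, h⟩ | ⟨rfl, h⟩
  · exact Or.inr (Or.inr (Or.inl ⟨rfl, h.1, h.2.symm⟩))
  · exact Or.inr (Or.inr (Or.inr ⟨rfl, h.1.symm, h.2⟩))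
  · exact Or.inl ⟨rfl, h.1, h.2.symm⟩
  · exact Or.inr (Or.inl ⟨rfl, h.1.symm, h.2⟩)

lemma IsSModel.exists_direction (hM : IsSModel T S M) {x y : V} (hx : x ∈ S) (hy : y ∈ S)
    (h : T.Adj x y) : ∃ d, direction (M x) (M y) = uvec d := by
  have hne : M x ≠ M y := fun he => h.ne (hM.injOn hx hy he)
  rw [Ne, Prod.ext_iff, not_and_or] at hne
  rcases hM.straight x hx y hy h with h1 | h1
  · rcases lt_trichotomy (M x).2 (M y).2 with h2 | h2 | h2
    · exact ⟨1, direction_eq_one_iff.2 ⟨h1, h2⟩⟩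
    · omega
    · exact ⟨3, direction_eq_three_iff.2 ⟨h1, h2⟩⟩
  · rcases lt_trichotomy (M x).1 (M y).1 with h2 | h2 | h2
    · exact ⟨0, direction_eq_zero_iff.2 ⟨h2, h1⟩⟩
    · omega
    · exact ⟨2, direction_eq_two_iff.2 ⟨h2, h1⟩⟩

/-- Of two neighbours in the same direction the nearer one would lie on the edge to the other. -/
lemma IsSModel.direction_inj (hM : IsSModel T S M) {v x y : V} (hv : v ∈ S) (hx : x ∈ S)
    (hy : y ∈ S) (hvx : T.Adj v x) (hvy : T.Adj v y) {d : ZMod 4}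
    (h1 : direction (M v) (M x) = uvec d) (h2 : direction (M v) (M y) = uvec d) : x = y := by
  have key : M x ∈ segment (M v) (M y) ∨ M y ∈ segment (M v) (M x) := by
    rw [direction_cases] at h1 h2
    rw [mem_segment, mem_segment]
    rcases h1 with ⟨rfl, h1⟩ | ⟨rfl, h1⟩ | ⟨rfl, h1⟩ | ⟨rfl, h1⟩ <;>
      rcases h2 with ⟨h0, h2⟩ | ⟨h0, h2⟩ | ⟨h0, h2⟩ | ⟨h0, h2⟩ <;>
      first
        | exact absurd h0 (by decide)
        | omega
  rcases key with h | h
  · exact (hM.vertex_edge v hv y hy x hx hvy h).resolve_left hvx.ne'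
  · exact ((hM.vertex_edge v hv x hx y hy hvx h).resolve_left hvy.ne').symm

open Classical in
/-- The neighbour of `v` in direction `d` in the model `M`. -/
noncomputable def nbAt (T : SimpleGraph V) (S : Set V) (M : V → GridPoint) (v : V) (d : ZMod 4) :
    Option V :=
  if h : ∃ x, x ∈ S ∧ T.Adj v x ∧ direction (M v) (M x) = uvec d then some h.choose else none

lemma nbAt_spec {v x : V} {d : ZMod 4} (h : nbAt T S M v d = some x) :
    x ∈ S ∧ T.Adj v x ∧ direction (M v) (M x) = uvec d := by
  unfold nbAt at h
  split_ifs at h with h1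
  cases h
  exact h1.choose_spec

lemma IsSModel.nbAt_eq (hM : IsSModel T S M) {v x : V} {d : ZMod 4} (hv : v ∈ S) (hx : x ∈ S)
    (h : T.Adj v x) (hd : direction (M v) (M x) = uvec d) : nbAt T S M v d = some x := by
  have h1 : ∃ x, x ∈ S ∧ T.Adj v x ∧ direction (M v) (M x) = uvec d := ⟨x, hx, h, hd⟩
  rw [nbAt, dif_pos h1]
  obtain ⟨a, b, c⟩ := h1.choose_spec
  exact congrArg some (hM.direction_inj hv a hx b h c hd)

lemma IsSModel.dirSys (hM : IsSModel T S M) : DirSys T S (nbAt T S M) where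
  mem _ h := ⟨(nbAt_spec h).1, (nbAt_spec h).2.1⟩
  surj hv hx h := by
    obtain ⟨d, hd⟩ := hM.exists_direction hv hx h
    exact ⟨d, hM.nbAt_eq hv hx h hd⟩
  inj _ h h' := uvec_injective ((nbAt_spec h).2.2.symm.trans (nbAt_spec h').2.2)
  opp hv h := by
    obtain ⟨a, b, c⟩ := nbAt_spec h
    exact hM.nbAt_eq a hv b.symm (direction_back c)

lemma turnsAt_iff {q v x : V} {d e : ZMod 4} (h1 : direction (M q) (M v) = uvec d)
    (h2 : direction (M v) (M x) = uvec e) (he : e ≠ d + 2) :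
    TurnsAt (M q) (M v) (M x) ↔ e ≠ d := by
  rw [direction_cases] at h1 h2
  unfold TurnsAt
  rcases h1 with ⟨rfl, h1⟩ | ⟨rfl, h1⟩ | ⟨rfl, h1⟩ | ⟨rfl, h1⟩ <;>
    rcases h2 with ⟨rfl, h2⟩ | ⟨rfl, h2⟩ | ⟨rfl, h2⟩ | ⟨rfl, h2⟩ <;>
    first
      | exact absurd rfl he
      | exact iff_of_true (by omega) (by decide)
      | exact iff_of_false (by omega) (by decide)

lemma sameLine_iff {v x y : V} {d e : ZMod 4} (h1 : direction (M v) (M x) = uvec d)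
    (h2 : direction (M v) (M y) = uvec e) (he : e ≠ d) :
    SameLine (M x) (M y) ↔ e = d + 2 := by
  rw [direction_cases] at h1 h2
  unfold SameLine
  rcases h1 with ⟨rfl, h1⟩ | ⟨rfl, h1⟩ | ⟨rfl, h1⟩ | ⟨rfl, h1⟩ <;>
    rcases h2 with ⟨rfl, h2⟩ | ⟨rfl, h2⟩ | ⟨rfl, h2⟩ | ⟨rfl, h2⟩ <;>
    first
      | exact absurd rfl he
      | exact iff_of_true (by omega) (by decide)
      | exact iff_of_false (by omega) (by decide)

/-! ### Making room for a new vertex -/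

/-- Insertion of an empty grid line at `q`. -/
def shiftAt (q t : ℤ) : ℤ := if q ≤ t then t + 1 else t

lemma shiftAt_spec (q t : ℤ) : (q ≤ t ∧ shiftAt q t = t + 1) ∨ (t < q ∧ shiftAt q t = t) := by
  unfold shiftAt
  split_ifs with h
  · exact Or.inl ⟨h, rfl⟩
  · exact Or.inr ⟨not_le.1 h, rfl⟩

lemma direction_shiftAt {a b a' b' : GridPoint} {q : ℤ} (ha : a' = (shiftAt q a.1, a.2))
    (hb : b' = (shiftAt q b.1, b.2)) : direction a' b' = direction a b := by
  subst ha hb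
  simp only [direction, Prod.mk.injEq, and_true]
  rcases lt_trichotomy a.1 b.1 with h | h | h
  · rw [Int.sign_eq_one_of_pos (a := b.1 - a.1) (by omega), Int.sign_eq_one_of_pos]
    have := shiftAt_spec q a.1
    have := shiftAt_spec q b.1
    omega
  · rw [h]; simp
  · rw [Int.sign_eq_neg_one_of_neg (a := b.1 - a.1) (by omega), Int.sign_eq_neg_one_of_neg]
    have := shiftAt_spec q a.1
    have := shiftAt_spec q b.1
    omega

/-- A new vertex can be attached horizontally, in a new column. -/
theorem IsSModel.insert_column (hM : IsSModel T S M) {r p : V} {q : ℤ} {d : ZMod 4} (hr : r ∉ S)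
    (hp : p ∈ S) (hadj : ∀ z ∈ S, T.Adj r z ↔ z = p)
    (hq : (d = 0 ∧ q = (M p).1 + 1) ∨ (d = 2 ∧ q = (M p).1))
    (hfree : ∀ z ∈ S, T.Adj p z → direction (M p) (M z) ≠ uvec d)
    (hS : ∀ u ∈ S, M' u = (shiftAt q (M u).1, (M u).2)) (hr' : M' r = (q, (M p).2)) :
    IsSModel T (insert r S) M' ∧
      (∀ x ∈ S, ∀ y ∈ S, direction (M' x) (M' y) = direction (M x) (M y)) ∧
      direction (M' p) (M' r) = uvec d := by
  have notq : ∀ u ∈ S, (M' u).1 ≠ q := by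
    intro u hu
    rw [hS u hu]
    have := shiftAt_spec q (M u).1
    simp only
    omega
  have hrp : T.Adj r p := (hadj p hp).2 rfl
  -- An edge through the new point crosses the empty column, so it is horizontal, and before the
  -- shift it contained `p`. Hence it ends at `p` and occupies the direction that is assumed to be
  -- free.
  have key : ∀ z ∈ S, ∀ w ∈ S, T.Adj z w → M' r ∉ segment (M' z) (M' w) := by
    intro z hz w hw hzw hmem
    rw [hr', hS z hz, hS w hw, mem_segment] at hmem
    simp only at hmem
    obtain ⟨⟨m1, m2⟩, m3, m4⟩ := hmem
    have sz := shiftAt_spec q (M z).1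
    have sw := shiftAt_spec q (M w).1
    have hline : (M z).2 = (M w).2 := by
      rcases hM.straight z hz w hw hzw with h | h
      · rw [h] at m1 m2; omega
      · exact h
    have hpm : M p ∈ segment (M z) (M w) := by
      rw [mem_segment]; omega
    rcases hM.vertex_edge z hz w hw p hp hzw hpm with rfl | rfl
    · refine hfree w hw hzw (direction_cases.2 ?_)
      rcases hq with ⟨rfl, h⟩ | ⟨rfl, h⟩
      · exact Or.inl ⟨rfl, by omega⟩
      · exact Or.inr (Or.inr (Or.inl ⟨rfl, by omega⟩))
    · refine hfree z hz hzw.symm (direction_cases.2 ?_)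
      rcases hq with ⟨rfl, h⟩ | ⟨rfl, h⟩
      · exact Or.inl ⟨rfl, by omega⟩
      · exact Or.inr (Or.inr (Or.inl ⟨rfl, by omega⟩))
  -- The new edge has length one and contains no grid points but its ends.
  have hnew : ∀ x, x ∈ segment (M' r) (M' p) → x = M' r ∨ x = M' p := by
    intro x hx
    rw [hr', hS p hp, mem_segment] at hx
    rw [hr', hS p hp, Prod.ext_iff, Prod.ext_iff]
    simp only at hx ⊢
    have := shiftAt_spec q (M p).1
    omega
  have inj : ∀ x ∈ S, ∀ y ∈ S, M' x = M' y → x = y := by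
    intro x hx y hy h
    rw [hS x hx, hS y hy, Prod.mk.injEq] at h
    have := shiftAt_spec q (M x).1
    have := shiftAt_spec q (M y).1
    exact hM.injOn hx hy (Prod.ext (by omega) h.2)
  have hnr : ∀ x ∈ S, M' x ≠ M' r := fun x hx h => notq x hx (by rw [h, hr'])
  have segcomm : ∀ a b : GridPoint, segment a b = segment b a := fun a b => Set.uIcc_comm a b
  have onNew : ∀ z ∈ S, M' z ∈ segment (M' r) (M' p) → z = p := fun z hz h =>
    inj z hz p hp ((hnew _ h).resolve_left (hnr z hz))
  have cross : ∀ z ∈ S, ∀ w ∈ S, T.Adj z w → ∀ x, x ∈ segment (M' r) (M' p) →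
      x ∈ segment (M' z) (M' w) → (p = z ∨ p = w) ∧ x = M' p := by
    intro z hz w hw hzw x hx hx'
    rcases hnew x hx with rfl | rfl
    · exact absurd hx' (key z hz w hw hzw)
    · refine ⟨hM.vertex_edge z hz w hw p hp hzw ?_, rfl⟩
      rw [hS z hz, hS w hw, hS p hp, mem_segment] at hx'
      rw [mem_segment]
      have := shiftAt_spec q (M z).1
      have := shiftAt_spec q (M w).1
      have := shiftAt_spec q (M p).1
      simp only at hx'
      omega
  refine ⟨⟨?_, ?_, ?_, ?_⟩, fun x hx y hy => direction_shiftAt (hS x hx) (hS y hy), ?_⟩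
  · rintro x (rfl | hx) y (rfl | hy) h
    · rfl
    · exact absurd h.symm (hnr y hy)
    · exact absurd h (hnr x hx)
    · exact inj x hx y hy h
  · rintro x (rfl | hx) y (rfl | hy) h
    · exact absurd rfl h.ne
    · obtain rfl := (hadj y hy).1 h
      exact Or.inr (by rw [hr', hS y hy])
    · obtain rfl := (hadj x hx).1 h.symm
      exact Or.inr (by rw [hr', hS x hx])
    · rw [hS x hx, hS y hy]
      rcases hM.straight x hx y hy h with h | h
      · exact Or.inl (by simp [h])
      · exact Or.inr h
  · rintro x (rfl | hx) y (rfl | hy) z (rfl | hz) h hm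
    · exact Or.inl rfl
    · exact absurd rfl h.ne
    · exact Or.inl rfl
    · obtain rfl := (hadj y hy).1 h
      exact Or.inr (onNew z hz hm)
    · exact Or.inr rfl
    · obtain rfl := (hadj x hx).1 h.symm
      rw [segcomm] at hm
      exact Or.inl (onNew z hz hm)
    · exact absurd hm (key x hx y hy h)
    · refine hM.vertex_edge x hx y hy z hz h ?_
      rw [hS z hz, hS x hx, hS y hy, mem_segment] at hm
      rw [mem_segment]
      have := shiftAt_spec q (M z).1
      have := shiftAt_spec q (M x).1
      have := shiftAt_spec q (M y).1
      simp only at hm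
      omega
  · rintro x hx y hy z hz w hw hxy hzw hne g ⟨hg1, hg2⟩
    have edge : ∀ a ∈ insert r S, ∀ b ∈ insert r S, T.Adj a b →
        (a ∈ S ∧ b ∈ S) ∨ (a = r ∧ b = p) ∨ (a = p ∧ b = r) := by
      rintro a (rfl | ha) b (rfl | hb) h
      · exact absurd rfl h.ne
      · exact Or.inr (Or.inl ⟨rfl, (hadj b hb).1 h⟩)
      · exact Or.inr (Or.inr ⟨(hadj a ha).1 h.symm, rfl⟩)
      · exact Or.inl ⟨ha, hb⟩
    rcases edge x hx y hy hxy with ⟨hx', hy'⟩ | ⟨rfl, rfl⟩ | ⟨rfl, rfl⟩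
    · rcases edge z hz w hw hzw with ⟨hz', hw'⟩ | ⟨rfl, rfl⟩ | ⟨rfl, rfl⟩
      · rw [hS x hx', hS y hy', mem_segment] at hg1
        rw [hS z hz', hS w hw', mem_segment] at hg2
        have sx := shiftAt_spec q (M x).1
        have sy := shiftAt_spec q (M y).1
        have sz := shiftAt_spec q (M z).1
        have sw := shiftAt_spec q (M w).1
        simp only at hg1 hg2
        -- In the empty column both edges are horizontal, so before the shift they share a point of
        -- column `q` and one of column `q - 1`. Both points are common endpoints, so the edges
        -- coincide. Outside this column the shift can be undone.
        by_cases hgq : g.1 = q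
        · exfalso
          have l1 := hM.straight x hx' y hy' hxy
          have l2 := hM.straight z hz' w hw' hzw
          have e1 : (M x).2 = (M y).2 := l1.resolve_left (by intro h; rw [h] at sx hg1; omega)
          have e2 : (M z).2 = (M w).2 := l2.resolve_left (by intro h; rw [h] at sz hg2; omega)
          obtain ⟨c, c1, c2, c3⟩ := hM.edge_edge x hx' y hy' z hz' w hw' hxy hzw hne (q, g.2)
            ⟨by rw [mem_segment]; simp only; omega, by rw [mem_segment]; simp only; omega⟩
          obtain ⟨c', c1', c2', c3'⟩ := hM.edge_edge x hx' y hy' z hz' w hw' hxy hzw hne (q - 1, g.2)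
            ⟨by rw [mem_segment]; simp only; omega, by rw [mem_segment]; simp only; omega⟩
          have hcc : c ≠ c' := by
            rintro rfl
            rw [← c3, Prod.mk.injEq] at c3'
            omega
          exact hne (((Sym2.mem_and_mem_iff hcc).1 ⟨Sym2.mem_iff.2 c1, Sym2.mem_iff.2 c1'⟩).trans
            ((Sym2.mem_and_mem_iff hcc).1 ⟨Sym2.mem_iff.2 c2, Sym2.mem_iff.2 c2'⟩).symm)
        · obtain ⟨k, hk⟩ : ∃ k, shiftAt q k = g.1 := by
            rcases lt_or_gt_of_ne hgq with h | h
            · exact ⟨g.1, by have := shiftAt_spec q g.1; omega⟩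
            · exact ⟨g.1 - 1, by have := shiftAt_spec q (g.1 - 1); omega⟩
          have sk := shiftAt_spec q k
          obtain ⟨c, c1, c2, c3⟩ := hM.edge_edge x hx' y hy' z hz' w hw' hxy hzw hne (k, g.2)
            ⟨by rw [mem_segment]; simp only; omega, by rw [mem_segment]; simp only; omega⟩
          refine ⟨c, c1, c2, ?_⟩
          have hc : c ∈ S := by rcases c1 with rfl | rfl <;> assumption
          rw [hS c hc, ← c3]
          exact Prod.ext hk.symm rfl
      · obtain ⟨h1, h2⟩ := cross x hx' y hy' hxy g hg2 hg1
        exact ⟨w, h1, Or.inr rfl, h2⟩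
      · rw [segcomm] at hg2
        obtain ⟨h1, h2⟩ := cross x hx' y hy' hxy g hg2 hg1
        exact ⟨z, h1, Or.inl rfl, h2⟩
    · rcases edge z hz w hw hzw with ⟨hz', hw'⟩ | ⟨rfl, rfl⟩ | ⟨rfl, rfl⟩
      · obtain ⟨h1, h2⟩ := cross z hz' w hw' hzw g hg1 hg2
        exact ⟨y, Or.inr rfl, h1, h2⟩
      · exact absurd rfl hne
      · exact absurd Sym2.eq_swap hne
    · rcases edge z hz w hw hzw with ⟨hz', hw'⟩ | ⟨rfl, rfl⟩ | ⟨rfl, rfl⟩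
      · rw [segcomm] at hg1
        obtain ⟨h1, h2⟩ := cross z hz' w hw' hzw g hg1 hg2
        exact ⟨x, Or.inl rfl, h1, h2⟩
      · exact absurd Sym2.eq_swap hne
      · exact absurd rfl hne
  · rw [direction_cases, hr', hS p hp]
    have := shiftAt_spec q (M p).1
    rcases hq with ⟨rfl, h⟩ | ⟨rfl, h⟩
    · refine Or.inl ⟨rfl, ?_, rfl⟩
      change shiftAt q (M p).1 < q
      omega
    · refine Or.inr (Or.inr (Or.inl ⟨rfl, ?_, rfl⟩))
      change q < shiftAt q (M p).1
      omega

lemma IsSModel.swap (hM : IsSModel T S M) : IsSModel T S fun u => (M u).swap := by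
  have hseg : ∀ a b c : GridPoint, c ∈ segment a.swap b.swap ↔ c.swap ∈ segment a b := by
    intro a b c
    rw [mem_segment, mem_segment]
    simp only [Prod.fst_swap, Prod.snd_swap]
    tauto
  refine ⟨fun x hx y hy h => hM.injOn hx hy (Prod.swap_injective h),
    fun x hx y hy h => (hM.straight x hx y hy h).symm, fun x hx y hy z hz h hm => ?_,
    fun x hx y hy z hz w hw h h' hne g hg => ?_⟩
  · rw [hseg, Prod.swap_swap] at hm
    exact hM.vertex_edge x hx y hy z hz h hm
  · rw [Set.mem_inter_iff, hseg, hseg] at hg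
    obtain ⟨c, c1, c2, c3⟩ := hM.edge_edge x hx y hy z hz w hw h h' hne g.swap hg
    exact ⟨c, c1, c2, by rw [← c3, Prod.swap_swap]⟩

lemma direction_swap (a b : GridPoint) : direction a.swap b.swap = (direction a b).swap := rfl

lemma uvec_swap (d : ZMod 4) : (uvec d).swap = uvec (1 - d) := by
  revert d; decide

/-- A new vertex can be attached vertically, in a new row. -/
theorem IsSModel.insert_row (hM : IsSModel T S M) {r p : V} {q : ℤ} {d : ZMod 4} (hr : r ∉ S)
    (hp : p ∈ S) (hadj : ∀ z ∈ S, T.Adj r z ↔ z = p)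
    (hq : (d = 1 ∧ q = (M p).2 + 1) ∨ (d = 3 ∧ q = (M p).2))
    (hfree : ∀ z ∈ S, T.Adj p z → direction (M p) (M z) ≠ uvec d)
    (hS : ∀ u ∈ S, M' u = ((M u).1, shiftAt q (M u).2)) (hr' : M' r = ((M p).1, q)) :
    IsSModel T (insert r S) M' ∧
      (∀ x ∈ S, ∀ y ∈ S, direction (M' x) (M' y) = direction (M x) (M y)) ∧
      direction (M' p) (M' r) = uvec d := by
  have hq' : (1 - d = 0 ∧ q = (M p).2 + 1) ∨ (1 - d = 2 ∧ q = (M p).2) := by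
    rcases hq with ⟨rfl, h⟩ | ⟨rfl, h⟩
    · exact Or.inl ⟨rfl, h⟩
    · exact Or.inr ⟨rfl, h⟩
  have hfree' : ∀ z ∈ S, T.Adj p z → direction (M p).swap (M z).swap ≠ uvec (1 - d) := by
    intro z hz h
    rw [direction_swap, ← uvec_swap]
    exact fun he => hfree z hz h (Prod.swap_injective he)
  obtain ⟨h1, h2, h3⟩ := hM.swap.insert_column (M' := fun u => (M' u).swap) (q := q) (d := 1 - d)
    hr hp hadj hq' hfree' (fun u hu => by rw [hS u hu]; rfl) (by rw [hr']; rfl)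
  refine ⟨by simpa using h1.swap, fun x hx y hy => ?_, ?_⟩
  · have := h2 x hx y hy
    rw [direction_swap, direction_swap] at this
    exact Prod.swap_injective this
  · rw [direction_swap, ← uvec_swap] at h3
    exact Prod.swap_injective h3

/-- A new vertex can be attached in any free direction. -/
theorem IsSModel.exists_insert (hM : IsSModel T S M) {r p : V} (d : ZMod 4) (hr : r ∉ S)
    (hp : p ∈ S) (hadj : ∀ z ∈ S, T.Adj r z ↔ z = p)
    (hfree : ∀ z ∈ S, T.Adj p z → direction (M p) (M z) ≠ uvec d) :
    ∃ M', IsSModel T (insert r S) M' ∧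
      (∀ x ∈ S, ∀ y ∈ S, direction (M' x) (M' y) = direction (M x) (M y)) ∧
      direction (M' p) (M' r) = uvec d := by
  classical
  have hne : ∀ u ∈ S, u ≠ r := fun u hu h => hr (h ▸ hu)
  have col : ∀ q, ((d = 0 ∧ q = (M p).1 + 1) ∨ (d = 2 ∧ q = (M p).1)) → _ := fun q hq =>
    hM.insert_column (M' := fun u => if u = r then (q, (M p).2) else (shiftAt q (M u).1, (M u).2))
      hr hp hadj hq hfree (fun u hu => by simp [hne u hu]) (by simp)
  have row : ∀ q, ((d = 1 ∧ q = (M p).2 + 1) ∨ (d = 3 ∧ q = (M p).2)) → _ := fun q hq =>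
    hM.insert_row (M' := fun u => if u = r then ((M p).1, q) else ((M u).1, shiftAt q (M u).2))
      hr hp hadj hq hfree (fun u hu => by simp [hne u hu]) (by simp)
  rcases BTree.zmod4_cases d with rfl | rfl | rfl | rfl
  · exact ⟨_, col _ (Or.inl ⟨rfl, rfl⟩)⟩
  · exact ⟨_, row _ (Or.inl ⟨rfl, rfl⟩)⟩
  · exact ⟨_, col _ (Or.inr ⟨rfl, rfl⟩)⟩
  · exact ⟨_, row _ (Or.inr ⟨rfl, rfl⟩)⟩

end geometry
end StraightModel

/-! ### Numbers of bends and balance of a model in terms of the trees seen from its vertices. -/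

namespace StraightModel

open BTree

namespace BTree

/-- `max dia (val + h)` cannot increase when the edge of view moves on to a child, with the rest of
the tree behind it. -/
lemma arms_le {a b c : BTree} {h X : ℤ} (hX : max (node a b c).dia ((node a b c).val + h) ≤ X) :
    max a.dia (a.val + max h (max (b.val + 1) (c.val + 1))) ≤ X ∧
    max b.dia (b.val + max c.val (max (h + 1) (a.val + 1))) ≤ X ∧
    max c.dia (c.val + max b.val (max (a.val + 1) (h + 1))) ≤ X := by
  simp only [dia, val_node, ← max_add_add_right, ← max_add_add_left, max_le_iff] at hX ⊢
  obtain ⟨⟨⟨x1, x2, x3⟩, x4, x5, x6⟩, x7, x8, x9⟩ := hX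
  refine ⟨⟨x1, x7, ?_, ?_⟩, ⟨x2, ?_, ?_, ?_⟩, ⟨x3, ?_, ?_, ?_⟩⟩ <;> omega

/-- A path counted at the vertex lies in a child, or leaves a child through the vertex, so it is
also counted at some child. The terms of virtual children are harmless because `0 ≤ h`, and one
child must be real. -/
lemma le_of_arms {a b c : BTree} {h X : ℤ} (hh : 0 ≤ h) (hne : ¬(a = nil ∧ b = nil ∧ c = nil))
    (ha : a ≠ nil → max a.dia (a.val + max h (max (b.val + 1) (c.val + 1))) ≤ X)
    (hb : b ≠ nil → max b.dia (b.val + max c.val (max (h + 1) (a.val + 1))) ≤ X)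
    (hc : c ≠ nil → max c.dia (c.val + max b.val (max (a.val + 1) (h + 1))) ≤ X) :
    max (node a b c).dia ((node a b c).val + h) ≤ X := by
  have key : ∀ {t : BTree} {u : ℤ}, (t ≠ nil → max t.dia (t.val + u) ≤ X) →
      (t.val = -1 ∧ t.dia = -1) ∨ (0 ≤ t.val ∧ t.dia ≤ X ∧ t.val + u ≤ X) := by
    intro t u ht
    by_cases h0 : t = nil
    · rw [h0]; exact Or.inl ⟨rfl, rfl⟩
    · exact Or.inr ⟨val_nonneg h0, max_le_iff.1 (ht h0)⟩
  have hne' : 0 ≤ a.val ∨ 0 ≤ b.val ∨ 0 ≤ c.val := by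
    by_contra hcon
    push Not at hcon
    exact hne ⟨eq_nil_of_val_neg hcon.1, eq_nil_of_val_neg hcon.2.1, eq_nil_of_val_neg hcon.2.2⟩
  have ka := key ha
  have kb := key hb
  have kc := key hc
  clear key ha hb hc hne
  simp only [dia, val_node, ← max_add_add_right, max_le_iff]
  rcases ka with ⟨a1, a2⟩ | ⟨a1, a2, a3⟩ <;> rcases kb with ⟨b1, b2⟩ | ⟨b1, b2, b3⟩ <;>
    rcases kc with ⟨c1, c2⟩ | ⟨c1, c2, c3⟩ <;>
    (try simp only [← max_add_add_left, max_le_iff] at a3) <;>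
    (try simp only [← max_add_add_left, max_le_iff] at b3) <;>
    (try simp only [← max_add_add_left, max_le_iff] at c3) <;>
    refine ⟨⟨⟨?_, ?_, ?_⟩, ?_, ?_, ?_⟩, ?_, ?_, ?_⟩ <;> omega

end BTree

section bridge

variable {V : Type*} {T : SimpleGraph V} {S : Set V} {M M' : V → GridPoint}

lemma exists_eq_cons (hT : T.IsAcyclic) {q v f : V} (h : T.Adj q v) {w : T.Walk q f} (hw : w.IsPath)
    (hv : v ∈ w.support) : ∃ w' : T.Walk v f, w = w'.cons h := by
  classical
  cases w with
  | nil => simp [h.ne'] at hv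
  | @cons _ y _ ha p =>
    obtain ⟨hp1, hp2⟩ := (SimpleGraph.Walk.cons_isPath_iff ha p).1 hw
    have hv' : v ∈ p.support := by simpa [h.ne'] using hv
    obtain rfl := Side.unique hT ha h (x := v)
      ⟨p.takeUntil v hv', hp1.takeUntil hv',
        fun hh => hp2 (p.support_takeUntil_subset_support hv' hh)⟩ (side_self h)
    exact ⟨p, rfl⟩

lemma bendCount_cons_cons {q v x f : V} (h : T.Adj q v) (h' : T.Adj v x) (w : T.Walk x f) :
    bendCount M ((w.cons h').cons h).support =
      (if TurnsAt (M q) (M v) (M x) then 1 else 0) + bendCount M (w.cons h').support := by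
  simp only [SimpleGraph.Walk.support_cons]
  rw [← w.cons_tail_support]
  rfl

lemma IsLeaf.nbr_unique {v x y : V} (h : IsLeaf T S v) (hx : x ∈ S) (hy : y ∈ S)
    (hvx : T.Adj v x) (hvy : T.Adj v y) : x = y :=
  h.2.unique ⟨hx, hvx⟩ ⟨hy, hvy⟩

lemma DirSys.isLeaf {nb : V → ZMod 4 → Option V} (hD : DirSys T S nb) {q v : V} {d : ZMod 4}
    (hq : q ∈ S) (hv : nb q d = some v) (h : ∀ e, e ≠ d + 2 → nb v e = none) : IsLeaf T S v := by
  obtain ⟨hvS, hadj⟩ := hD.mem hq hv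
  refine ⟨hvS, q, ⟨hq, hadj.symm⟩, fun y hy => ?_⟩
  obtain ⟨e, he⟩ := hD.surj hvS hy.1 hy.2
  by_cases h2 : e = d + 2
  · rw [h2, hD.opp hq hv] at he
    exact (Option.some.inj he).symm
  · rw [h e h2] at he
    cases he

/-- The numbers of bends of the paths from `q` through `v` to a leaf. -/
def leafBendSet (T : SimpleGraph V) (S : Set V) (M : V → GridPoint) (q v : V) : Set ℕ :=
  {k | ∃ f, IsLeaf T S f ∧ ∃ w : T.Walk q f, w.IsPath ∧ v ∈ w.support ∧ bendCount M w.support = k}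

variable [Finite V]

/-- Induction along the edges pointing away from `q`: going on from `v` in direction `e` costs one
bend unless `e = d`. -/
lemma IsSModel.isGreatest_leafBendSet (hT : T.IsAcyclic) (hS : PathClosed T S)
    (hM : IsSModel T S M) {q v : V} {d : ZMod 4} (hq : q ∈ S) (hv : nbAt T S M q d = some v) :
    ∃ k : ℕ, (k : ℤ) = seeVal (nbAt T S M) q d ∧ IsGreatest (leafBendSet T S M q v) k := by
  have hD := hM.dirSys
  refine hD.induct hT (P := fun q d v => ∃ k : ℕ, (k : ℤ) = seeVal (nbAt T S M) q d ∧
    IsGreatest (leafBendSet T S M q v) k) ?_ hq hv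
  intro q d v hq hv ih
  obtain ⟨hvS, hadj, hdir⟩ := nbAt_spec hv
  have hsee : seeVal (nbAt T S M) q d = max (seeVal (nbAt T S M) v d)
      (max (seeVal (nbAt T S M) v (d + 1) + 1) (seeVal (nbAt T S M) v (d + 3) + 1)) := by
    rw [seeVal, hD.see_some hT hq hv, val_node]; rfl
  have hturn : ∀ {e x}, nbAt T S M v e = some x → e ≠ d + 2 →
      (if TurnsAt (M q) (M v) (M x) then 1 else 0) = if e = d then 0 else 1 := by
    intro e x he h2
    rw [if_congr (turnsAt_iff hdir (nbAt_spec he).2.2 h2) rfl rfl]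
    by_cases h : e = d <;> simp [h]
  have hle : ∀ e, e ≠ d + 2 →
      (if e = d then 0 else 1) + seeVal (nbAt T S M) v e ≤ seeVal (nbAt T S M) q d := by
    intro e he
    rw [hsee]
    obtain ⟨-, n1, n3⟩ := zmod4_add_ne d
    rcases zmod4_cases' d e with rfl | rfl | rfl | rfl
    · rw [if_pos rfl]; omega
    · rw [if_neg n1]; omega
    · exact absurd rfl he
    · rw [if_neg n3]; omega
  have hupper : ∀ j ∈ leafBendSet T S M q v, (j : ℤ) ≤ seeVal (nbAt T S M) q d := by
    rintro j ⟨f, hf, w, hw, hvw, rfl⟩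
    obtain ⟨w', rfl⟩ := exists_eq_cons hT hadj hw hvw
    cases w' with
    | nil =>
      have h1 := neg_one_le_val (see (nbAt T S M) v (d + 1))
      change -1 ≤ seeVal (nbAt T S M) v (d + 1) at h1
      have h2 : bendCount M (SimpleGraph.Walk.cons hadj .nil).support = 0 := rfl
      rw [h2, hsee]
      push_cast
      omega
    | @cons _ x _ h' w'' =>
      have hxS : x ∈ S := hS q hq f hf.1 _ hw x (by simp)
      obtain ⟨e, he⟩ := hD.surj hvS hxS h'
      have he2 : e ≠ d + 2 := by
        rintro rfl
        rw [hD.opp hq hv] at he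
        cases he
        simp [SimpleGraph.Walk.cons_isPath_iff] at hw
      obtain ⟨kx, hkx, hgx⟩ := ih e x he2 he
      have := hgx.2 ⟨f, hf, w''.cons h', ((SimpleGraph.Walk.cons_isPath_iff hadj _).1 hw).1,
        by simp, rfl⟩
      rw [bendCount_cons_cons, hturn he he2]
      have h3 := hle e he2
      push_cast
      omega
  by_cases hall : ∀ e, e ≠ d + 2 → nbAt T S M v e = none
  · have hleaf := hD.isLeaf hq hv hall
    have hval : seeVal (nbAt T S M) q d = 0 := by
      obtain ⟨n0, n1, n3⟩ := zmod4_turn_ne d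
      rw [hsee, seeVal, seeVal, seeVal, see_none (hall _ n0), see_none (hall _ n1),
        see_none (hall _ n3)]
      simp
    refine ⟨0, by rw [hval]; rfl, ⟨v, hleaf, .cons hadj .nil,
      SimpleGraph.Walk.IsPath.nil.cons (by simpa using hadj.ne), by simp, rfl⟩, fun j hj => ?_⟩
    have := hupper j hj
    omega
  · push Not at hall
    obtain ⟨e₀, he₀, hne₀⟩ := hall
    have hpos : 0 ≤ seeVal (nbAt T S M) v e₀ :=
      val_nonneg fun h => hne₀ ((hD.see_eq_nil_iff hT hvS).1 h)
    -- A virtual direction contributes at most `-1 + 1 = 0`, and a real one at least `0`, so the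
    -- maximum is attained at a real one.
    obtain ⟨e, he2, hsome, hmax⟩ : ∃ e, e ≠ d + 2 ∧ nbAt T S M v e ≠ none ∧
        seeVal (nbAt T S M) q d = (if e = d then 0 else 1) + seeVal (nbAt T S M) v e := by
      obtain ⟨n0, n1, n3⟩ := zmod4_turn_ne d
      obtain ⟨-, m1, m3⟩ := zmod4_add_ne d
      have hnn : ∀ e, nbAt T S M v e = none → seeVal (nbAt T S M) v e = -1 := by
        intro e he
        rw [seeVal, see_none he, val_nil]
      by_contra hcon
      have g : ∀ e, e ≠ d + 2 → seeVal (nbAt T S M) v e = -1 ∨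
          seeVal (nbAt T S M) q d ≠ (if e = d then 0 else 1) + seeVal (nbAt T S M) v e := by
        intro e he
        by_cases hn : nbAt T S M v e = none
        · exact Or.inl (hnn e hn)
        · exact Or.inr fun h => hcon ⟨e, he, hn, h⟩
      have g0 := g _ n0
      have g1 := g _ n1
      have g3 := g _ n3
      have l0 := hle _ n0
      have l1 := hle _ n1
      have l3 := hle _ n3
      rw [if_pos rfl] at g0 l0
      rw [if_neg m1] at g1 l1
      rw [if_neg m3] at g3 l3
      have hv0 : seeVal (nbAt T S M) v d = seeVal (nbAt T S M) v e₀ ∨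
          seeVal (nbAt T S M) v (d + 1) = seeVal (nbAt T S M) v e₀ ∨
          seeVal (nbAt T S M) v (d + 3) = seeVal (nbAt T S M) v e₀ := by
        rcases zmod4_cases' d e₀ with rfl | rfl | rfl | rfl <;> simp_all
      omega
    obtain ⟨x, hx⟩ := Option.ne_none_iff_exists'.1 hsome
    obtain ⟨hxS, hvx⟩ := hD.mem hvS hx
    obtain ⟨kx, hkx, ⟨f, hf, w, hw, hxw, hwk⟩, -⟩ := ih e x he2 hx
    obtain ⟨w', rfl⟩ := exists_eq_cons hT hvx hw hxw
    obtain ⟨hw1, hw2⟩ := (SimpleGraph.Walk.cons_isPath_iff hvx w').1 hw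
    obtain ⟨w₂, hw₂, hqw₂⟩ := Side.step hT hadj hvx (hD.ne_back hq hv hx he2) ⟨w', hw1, hw2⟩
    obtain rfl := walk_eq hT hw hw₂
    refine ⟨(if e = d then 0 else 1) + kx, ?_, ⟨f, hf, _, hw.cons (h := hadj) hqw₂, by simp, ?_⟩,
      fun j hj => ?_⟩
    · rw [hmax, ← hkx]; push_cast; rfl
    · rw [bendCount_cons_cons, hturn hx he2, hwk]
    · have := hupper j hj
      rw [hmax, ← hkx] at this
      exact_mod_cast this

lemma IsSModel.leafBends_eq (hT : T.IsAcyclic) (hS : PathClosed T S) (hM : IsSModel T S M)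
    {q v : V} {d : ZMod 4} (hq : q ∈ S) (hv : nbAt T S M q d = some v) :
    (leafBends T S M q v : ℤ) = seeVal (nbAt T S M) q d := by
  obtain ⟨k, hk, hg⟩ := hM.isGreatest_leafBendSet hT hS hq hv
  rw [← hk]
  exact congrArg _ hg.csSup_eq

lemma IsSModel.nbrValue_eq (hT : T.IsAcyclic) (hS : PathClosed T S) (hM : IsSModel T S M)
    {v : V} (hv : v ∈ S) (d : ZMod 4) :
    nbrValue T S M v (nbAt T S M v d) = seeVal (nbAt T S M) v d := by
  rcases hx : nbAt T S M v d with _ | x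
  · rw [seeVal, see_none hx]; rfl
  · exact hM.leafBends_eq hT hS hv hx

lemma locBal_iff_exists {f : ZMod 4 → ℤ} : LocBal (f 2) (f 0) (f 1) (f 3) ↔
    ∃ d, f (d + 1) ≤ f d ∧ f (d + 1) ≤ f (d + 2) ∧ f (d + 3) ≤ f d ∧ f (d + 3) ≤ f (d + 2) := by
  constructor
  · rintro (h | h)
    · exact ⟨0, by simpa only [zmod4_add] using ⟨h.2.2.1, h.1, h.2.2.2, h.2.1⟩⟩
    · exact ⟨1, by simpa only [zmod4_add] using ⟨h.1, h.2.1, h.2.2.1, h.2.2.2⟩⟩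
  · rintro ⟨d, h⟩
    rw [← LocBal.rotate d]
    exact Or.inl ⟨h.2.1, h.2.2.2, h.1, h.2.2.1⟩

/-- Balance in terms of directions. -/
theorem IsSModel.balanced_iff (hT : T.IsAcyclic) (hS : PathClosed T S) (hM : IsSModel T S M)
    {v : V} (hv : v ∈ S) : Balanced T S M v ↔ BalAt (nbAt T S M) v := by
  have hD := hM.dirSys
  have hval := hM.nbrValue_eq hT hS hv
  rw [BalAt, locBal_iff_exists]
  set f := seeVal (nbAt T S M) v with hf
  have hlow : ∀ d, -1 ≤ f d := fun d => neg_one_le_val _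
  constructor
  · rintro ⟨u, ⟨hmem, huniq, hanti⟩, hline⟩
    have hidx : ∀ d, f d = -1 ∨ ∃ i x, u i = some x ∧ nbAt T S M v d = some x := by
      intro d
      rcases hx : nbAt T S M v d with _ | x
      · left; rw [hf, seeVal, see_none hx]; rfl
      · obtain ⟨i, hi⟩ := (hmem x).2 (hD.mem hv hx)
        exact Or.inr ⟨i, x, hi, rfl⟩
    have hvi : ∀ {i x d}, u i = some x → nbAt T S M v d = some x →
        nbrValue T S M v (u i) = f d := by
      intro i x d h1 h2
      rw [h1, ← h2, hval]
    rcases h0 : u 0 with _ | x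
    · refine ⟨0, ?_⟩
      have : ∀ d, f d = -1 := by
        intro d
        rcases hidx d with h | ⟨i, x, hi, hd⟩
        · exact h
        · have h1 := hanti (Fin.zero_le i)
          change nbrValue T S M v (u i) ≤ nbrValue T S M v (u 0) at h1
          rw [hvi hi hd, h0] at h1
          exact le_antisymm h1 (hlow d)
      simp [this]
    · obtain ⟨hxS, hadj⟩ := (hmem x).1 ⟨0, h0⟩
      obtain ⟨d, hd⟩ := hD.surj hv hxS hadj
      refine ⟨d, ?_⟩
      obtain ⟨n2, n1, n3⟩ := zmod4_add_ne d
      rcases h1 : u 1 with _ | y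
      · have : ∀ e, e ≠ d → f e = -1 := by
          intro e hed
          rcases hidx e with h | ⟨i, z, hi, he⟩
          · exact h
          · have hi0 : i ≠ 0 := by
              intro hi0
              rw [hi0, h0] at hi
              cases hi
              exact hed (hD.inj hv he hd)
            have h2 := hanti (Fin.one_le_of_ne_zero hi0)
            change nbrValue T S M v (u i) ≤ nbrValue T S M v (u 1) at h2
            rw [hvi hi he, h1] at h2
            exact le_antisymm h2 (hlow e)
        rw [this _ n1, this _ n2, this _ n3]
        exact ⟨hlow d, le_rfl, hlow d, le_rfl⟩
      · obtain ⟨hyS, hadj'⟩ := (hmem y).1 ⟨1, h1⟩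
        obtain ⟨e, he⟩ := hD.surj hv hyS hadj'
        have hed : e ≠ d := by
          rintro rfl
          rw [hd] at he
          cases he
          exact absurd (huniq 0 1 _ h0 h1) (by decide)
        have he2 : e = d + 2 :=
          (sameLine_iff (nbAt_spec hd).2.2 (nbAt_spec he).2.2 hed).1 (hline x y h0 h1)
        subst he2
        have : ∀ g, g ≠ d → g ≠ d + 2 → f g ≤ f d ∧ f g ≤ f (d + 2) := by
          intro g g1 g2
          rcases hidx g with h | ⟨i, z, hi, hg⟩
          · rw [h]; exact ⟨hlow _, hlow _⟩
          · have hi1 : (1 : Fin 4) ≤ i := by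
              refine Fin.one_le_of_ne_zero ?_
              intro hi0
              rw [hi0, h0] at hi
              cases hi
              exact g1 (hD.inj hv hg hd)
            have a1 := hanti (Fin.zero_le i)
            have a2 := hanti hi1
            change nbrValue T S M v (u i) ≤ nbrValue T S M v (u 0) at a1
            change nbrValue T S M v (u i) ≤ nbrValue T S M v (u 1) at a2
            rw [hvi hi hg, hvi h0 hd] at a1
            rw [hvi hi hg, hvi h1 he] at a2
            exact ⟨a1, a2⟩
        obtain ⟨-, m1, m3⟩ := zmod4_turn_ne d
        exact ⟨(this _ n1 m1).1, (this _ n1 m1).2, (this _ n3 m3).1, (this _ n3 m3).2⟩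
  · rintro ⟨d, h⟩
    -- The order puts the dominating opposite pair before the other pair, each pair sorted by
    -- itself.
    suffices H : ∀ a b c e : ZMod 4, (∀ g, g = a ∨ g = b ∨ g = c ∨ g = e) → [a, b, c, e].Nodup →
        b = a + 2 → f b ≤ f a → f c ≤ f b → f e ≤ f c → Balanced T S M v by
      have all : ∀ d g : ZMod 4, g = d ∨ g = d + 2 ∨ g = d + 1 ∨ g = d + 3 := by decide
      have all' : ∀ d g : ZMod 4, g = d ∨ g = d + 2 ∨ g = d + 3 ∨ g = d + 1 := by decide
      have al2 : ∀ d g : ZMod 4, g = d + 2 ∨ g = d ∨ g = d + 1 ∨ g = d + 3 := by decide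
      have al2' : ∀ d g : ZMod 4, g = d + 2 ∨ g = d ∨ g = d + 3 ∨ g = d + 1 := by decide
      have nd : ∀ d : ZMod 4, [d, d + 2, d + 1, d + 3].Nodup ∧ [d, d + 2, d + 3, d + 1].Nodup ∧
        [d + 2, d, d + 1, d + 3].Nodup ∧ [d + 2, d, d + 3, d + 1].Nodup := by decide
      obtain ⟨nd1, nd2, nd3, nd4⟩ := nd d
      rcases le_total (f (d + 2)) (f d) with h1 | h1 <;>
        rcases le_total (f (d + 3)) (f (d + 1)) with h2 | h2
      · exact H _ _ _ _ (all d) nd1 rfl h1 h.2.1 h2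
      · exact H _ _ _ _ (all' d) nd2 rfl h1 h.2.2.2 h2
      · exact H _ _ _ _ (al2 d) nd3 (zmod4_add_two_two d).symm h1 h.1 h2
      · exact H _ _ _ _ (al2' d) nd4 (zmod4_add_two_two d).symm h1 h.2.2.1 h2
    intro a b c e hall hnd hba h1 h2 h3
    have hpi : Function.Injective ![a, b, c, e] := by
      rw [← List.nodup_ofFn]
      simpa [List.ofFn_succ] using hnd
    refine ⟨fun i => nbAt T S M v (![a, b, c, e] i), ⟨fun w => ⟨?_, fun hw => ?_⟩,
      fun i j w hi hj => hpi (hD.inj hv hi hj), ?_⟩, fun x y hx hy => ?_⟩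
    · rintro ⟨i, hi⟩
      exact hD.mem hv hi
    · obtain ⟨g, hg⟩ := hD.surj hv hw.1 hw.2
      rcases hall g with rfl | rfl | rfl | rfl
      · exact ⟨0, hg⟩
      · exact ⟨1, hg⟩
      · exact ⟨2, hg⟩
      · exact ⟨3, hg⟩
    · simp only [hval]
      rw [Fin.antitone_iff_succ_le]
      intro i
      fin_cases i
      · exact h1
      · exact h2
      · exact h3
    · refine (sameLine_iff (nbAt_spec hx).2.2 (nbAt_spec hy).2.2 ?_).2 hba
      intro hh
      exact absurd (hpi hh) (by decide)

/-- The number of bends of a model, from the drawing of the tree as seen from a leaf. -/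
theorem IsSModel.modelBends_eq (hT : T.IsTree) (hS : PathClosed T S) (hM : IsSModel T S M)
    {r p : V} {d : ZMod 4} (hr : IsLeaf T S r) (hp : nbAt T S M r d = some p) :
    (modelBends T S M : ℤ) = max (see (nbAt T S M) r d).dia (see (nbAt T S M) r d).val := by
  have hA := hT.isAcyclic
  have hD := hM.dirSys
  have hrS := hr.1
  obtain ⟨hpS, hadj⟩ := hD.mem hrS hp
  have honly : ∀ e, e ≠ d → nbAt T S M r e = none := by
    intro e he
    rcases hx : nbAt T S M r e with _ | x
    · rfl
    · obtain ⟨hxS, hrx⟩ := hD.mem hrS hx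
      obtain rfl := hr.nbr_unique hxS hpS hrx hadj
      exact absurd (hD.inj hrS hx hp) he
  -- Nothing but the leaf `r` lies behind, so the term `h` of the general quantity vanishes.
  have hup : seeVal (nbAt T S M) p (d + 2) = 0 := by
    obtain ⟨n2, n1, n3⟩ := zmod4_add_ne d
    rw [hD.seeVal_back hA hrS hp, upVal, seeVal, seeVal, seeVal, see_none (honly _ n2),
      see_none (honly _ n1), see_none (honly _ n3)]
    simp
  -- By `arms_le` the quantity does not increase on the way to the leaf `x`, where it is at least
  -- the value seen from `x`.
  have upper : ∀ x, IsLeaf T S x → Side T r p x → ∀ e y, nbAt T S M x e = some y →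
      seeVal (nbAt T S M) x e ≤ max (see (nbAt T S M) r d).dia
        ((see (nbAt T S M) r d).val + seeVal (nbAt T S M) p (d + 2)) := by
    refine hD.induct hA (P := fun q d v => ∀ x, IsLeaf T S x → Side T q v x → ∀ e y,
      nbAt T S M x e = some y → seeVal (nbAt T S M) x e ≤ max (see (nbAt T S M) q d).dia
        ((see (nbAt T S M) q d).val + seeVal (nbAt T S M) v (d + 2))) ?_ hrS hp
    intro q d v hq hv ih x hx hs e y hy
    obtain ⟨hvS, hqv⟩ := hD.mem hq hv
    rcases hs.cases with rfl | ⟨w, hw, hwq, hs'⟩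
    · obtain ⟨hyS, hxy⟩ := hD.mem hvS hy
      obtain rfl := hx.nbr_unique hyS hq hxy hqv.symm
      obtain rfl := hD.inj hvS hy (hD.opp hq hv)
      have := val_nonneg (t := see (nbAt T S M) y d)
        (by rw [Ne, hD.see_eq_nil_iff hA hq, hv]; simp)
      omega
    · have hwS := hS.side_mem hvS hx.1 hw hs'
      obtain ⟨e', he'⟩ := hD.surj hvS hwS hw
      have he2 : e' ≠ d + 2 := by
        rintro rfl
        rw [hD.opp hq hv] at he'
        cases he'
        exact hwq rfl
      have h1 := ih e' w he2 he' x hx hs' e y hy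
      rw [hD.seeVal_back hA hvS he'] at h1
      refine h1.trans ?_
      rw [hD.see_some hA hq hv]
      obtain ⟨u0, u1, u3⟩ := upVal_turns (seeVal (nbAt T S M) v) d
      obtain ⟨x0, x1, x3⟩ := arms_le (a := see (nbAt T S M) v d) (b := see (nbAt T S M) v (d + 1))
        (c := see (nbAt T S M) v (d + 3)) (h := seeVal (nbAt T S M) v (d + 2)) le_rfl
      rcases zmod4_cases' d e' with rfl | rfl | rfl | rfl
      · rw [u0]; exact x0
      · rw [u1]; exact x1
      · exact absurd rfl he2
      · rw [u3]; exact x3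
  have lower : ∃ x e y, IsLeaf T S x ∧ nbAt T S M x e = some y ∧
      max (see (nbAt T S M) r d).dia
        ((see (nbAt T S M) r d).val + seeVal (nbAt T S M) p (d + 2)) ≤
        seeVal (nbAt T S M) x e := by
    refine hD.induct hA (P := fun q d v => ∃ x e y, IsLeaf T S x ∧ nbAt T S M x e = some y ∧
      max (see (nbAt T S M) q d).dia
        ((see (nbAt T S M) q d).val + seeVal (nbAt T S M) v (d + 2)) ≤
        seeVal (nbAt T S M) x e) ?_ hrS hp
    intro q d v hq hv ih
    obtain ⟨hvS, hqv⟩ := hD.mem hq hv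
    rw [hD.see_some hA hq hv]
    obtain ⟨n0, n1, n3⟩ := zmod4_turn_ne d
    have hpos : 0 ≤ seeVal (nbAt T S M) v (d + 2) :=
      val_nonneg fun h => by
        rw [hD.see_eq_nil_iff hA hvS, hD.opp hq hv] at h
        cases h
    by_cases hall : ∀ e, e ≠ d + 2 → nbAt T S M v e = none
    · refine ⟨v, d + 2, q, hD.isLeaf hq hv hall, hD.opp hq hv, ?_⟩
      rw [see_none (hall _ n0), see_none (hall _ n1), see_none (hall _ n3)]
      simp only [dia, val_node, val_nil]
      omega
    · by_contra hcon
      push Not at hcon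
      -- If every leaf stayed below the bound, then by induction the quantity of each real child
      -- would be smaller by at least one, contrary to `le_of_arms`.
      have key : ∀ e, e ≠ d + 2 → see (nbAt T S M) v e ≠ nil → max (see (nbAt T S M) v e).dia
          ((see (nbAt T S M) v e).val + upVal (seeVal (nbAt T S M) v) e) ≤
          max ((see (nbAt T S M) v d).node (see (nbAt T S M) v (d + 1))
            (see (nbAt T S M) v (d + 3))).dia (((see (nbAt T S M) v d).node
            (see (nbAt T S M) v (d + 1)) (see (nbAt T S M) v (d + 3))).val +
              seeVal (nbAt T S M) v (d + 2)) - 1 := by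
        intro e he hne
        rw [Ne, hD.see_eq_nil_iff hA hvS] at hne
        obtain ⟨x, hx⟩ := Option.ne_none_iff_exists'.1 hne
        obtain ⟨x', e', y, hl, hy, hle⟩ := ih e x he hx
        rw [hD.seeVal_back hA hvS hx] at hle
        exact Int.le_sub_one_of_lt (lt_of_le_of_lt hle (hcon x' e' y hl hy))
      obtain ⟨u0, u1, u3⟩ := upVal_turns (seeVal (nbAt T S M) v) d
      have k0 := key _ n0
      have k1 := key _ n1
      have k3 := key _ n3
      rw [u0] at k0
      rw [u1] at k1
      rw [u3] at k3
      refine absurd (le_of_arms hpos ?_ k0 k1 k3) (by omega)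
      rintro ⟨z0, z1, z3⟩
      rw [hD.see_eq_nil_iff hA hvS] at z0 z1 z3
      refine hall fun e he => ?_
      rcases zmod4_cases' d e with rfl | rfl | rfl | rfl
      · exact z0
      · exact z1
      · exact absurd rfl he
      · exact z3
  rw [hup, add_zero] at upper lower
  have hbound : ∀ k ∈ {k | ∃ x y, IsLeaf T S x ∧ IsLeaf T S y ∧
      ∃ q : T.Walk x y, q.IsPath ∧ bendCount M q.support = k},
      (k : ℤ) ≤ max (see (nbAt T S M) r d).dia (see (nbAt T S M) r d).val := by
    rintro k ⟨x, y, hx, hy, w, hw, rfl⟩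
    cases w with
    | nil =>
      have := val_nonneg (t := see (nbAt T S M) r d)
        (by rw [Ne, hD.see_eq_nil_iff hA hrS, hp]; simp)
      have h0 : bendCount M (SimpleGraph.Walk.nil : T.Walk x x).support = 0 := rfl
      rw [h0]
      push_cast
      omega
    | @cons _ z _ h w =>
      have hzS : z ∈ S := hS x hx.1 y hy.1 _ hw z (by simp)
      obtain ⟨e, he⟩ := hD.surj hx.1 hzS h
      obtain ⟨k, hk, hg⟩ := hM.isGreatest_leafBendSet hA hS hx.1 he
      have h1 := hg.2 ⟨y, hy, _, hw, by simp, rfl⟩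
      have h2 : seeVal (nbAt T S M) x e ≤
          max (see (nbAt T S M) r d).dia (see (nbAt T S M) r d).val := by
        by_cases hxr : x = r
        · subst hxr
          obtain rfl := hx.nbr_unique hzS hpS h hadj
          obtain rfl := hD.inj hrS he hp
          exact le_max_right _ _
        · refine upper x hx ?_ e z he
          obtain ⟨p', hp', hs⟩ := exists_side hT hxr
          rwa [hr.nbr_unique hpS (hS.side_mem hrS hx.1 hp' hs) hadj hp']
      omega
  obtain ⟨x, e, y, hx, hy, hle⟩ := lower
  obtain ⟨k, hk, ⟨f, hf, w, hw, -, hwk⟩, -⟩ := hM.isGreatest_leafBendSet hA hS hx.1 hy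
  have hmem : k ∈ {k | ∃ x y, IsLeaf T S x ∧ IsLeaf T S y ∧
      ∃ q : T.Walk x y, q.IsPath ∧ bendCount M q.support = k} := ⟨x, f, hx, hf, w, hw, hwk⟩
  have hgr : IsGreatest {k | ∃ x y, IsLeaf T S x ∧ IsLeaf T S y ∧
      ∃ q : T.Walk x y, q.IsPath ∧ bendCount M q.support = k} k := by
    refine ⟨hmem, fun j hj => ?_⟩
    have := hbound j hj
    omega
  have h1 := hbound k hmem
  rw [modelBends, hgr.csSup_eq]
  omega

end bridge
end StraightModel

namespace StraightModel

open BTree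

/-! ### Comparison of two models of the same tree. -/

section isomorphism

variable {V : Type*} {T : SimpleGraph V} {S : Set V} {nb nb' : V → ZMod 4 → Option V}

/-- Occupied slots are matched by their labels, and this bijection extends to the free slots because
`α` is finite. -/
lemma exists_perm_of_range {α β : Type*} [Finite α] {f f' : α → Option β}
    (hf : ∀ {d e x}, f d = some x → f e = some x → d = e)
    (hf' : ∀ {d e x}, f' d = some x → f' e = some x → d = e)
    (h : ∀ x, (∃ d, f d = some x) ↔ ∃ d, f' d = some x) :
    ∃ σ : Equiv.Perm α, ∀ e, f' (σ e) = f e := by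
  classical
  have := Fintype.ofFinite α
  have h1 : ∀ e : {e // f e ≠ none}, ∃ e' : {e // f' e ≠ none}, f' e' = f e := by
    rintro ⟨e, he⟩
    obtain ⟨x, hx⟩ := Option.ne_none_iff_exists'.1 he
    obtain ⟨e', he'⟩ := (h x).1 ⟨e, hx⟩
    exact ⟨⟨e', by simp [he']⟩, by simp [he', hx]⟩
  choose g hg using h1
  have hinj : Function.Injective g := by
    intro a b hab
    obtain ⟨x, hx⟩ := Option.ne_none_iff_exists'.1 a.2
    have h2 : f b = some x := by rw [← hx, ← hg, ← hg, hab]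
    exact Subtype.ext (hf hx h2)
  have hsurj : Function.Surjective g := by
    rintro ⟨e', he'⟩
    obtain ⟨x, hx⟩ := Option.ne_none_iff_exists'.1 he'
    obtain ⟨e, he⟩ := (h x).2 ⟨e', hx⟩
    refine ⟨⟨e, by simp [he]⟩, Subtype.ext (hf' (x := x) ?_ hx)⟩
    rw [hg, he]
  refine ⟨(Equiv.ofBijective g ⟨hinj, hsurj⟩).extendSubtype, fun e => ?_⟩
  by_cases he : f e = none
  · rw [he]
    by_contra hne
    exact (Equiv.ofBijective g ⟨hinj, hsurj⟩).extendSubtype_not_mem e (not_not.2 he) hne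
  · exact (congrArg f' (Equiv.extendSubtype_apply_of_mem _ e he)).trans (hg ⟨e, he⟩)

lemma perm_slots {α : Type*} {g g' : ZMod 4 → α} {σ : Equiv.Perm (ZMod 4)} {d d' : ZMod 4}
    (hd : σ (d + 2) = d' + 2) (h : ∀ e, g' (σ e) = g e) :
    [g' d', g' (d' + 1), g' (d' + 3)].Perm [g d, g (d + 1), g (d + 3)] := by
  have h1 : ∀ d : ZMod 4, [d, d + 1, d + 3].Nodup := by decide
  have h2 : ∀ d e : ZMod 4, e ∈ [d, d + 1, d + 3] ↔ e ≠ d + 2 := by decide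
  have h3 : [d', d' + 1, d' + 3].Perm ([d, d + 1, d + 3].map σ) := by
    refine (List.perm_ext_iff_of_nodup (h1 d') ((h1 d).map σ.injective)).2 fun e => ?_
    rw [h2, List.mem_map]
    constructor
    · intro he
      refine ⟨σ.symm e, (h2 _ _).2 fun hh => he ?_, σ.apply_symm_apply e⟩
      rw [← hd, ← hh, σ.apply_symm_apply]
    · rintro ⟨a, ha, rfl⟩ hh
      rw [← hd] at hh
      exact (h2 _ _).1 ha (σ.injective hh)
  have h4 := h3.map g'
  simpa [h] using h4

lemma DirSys.exists_perm (hD : DirSys T S nb) (hD' : DirSys T S nb') {v : V} (hv : v ∈ S) :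
    ∃ σ : Equiv.Perm (ZMod 4), ∀ e, nb' v (σ e) = nb v e := by
  refine exists_perm_of_range (hD.inj hv) (hD'.inj hv) fun x => ⟨?_, ?_⟩
  · rintro ⟨d, hd⟩
    exact hD'.surj hv (hD.mem hv hd).1 (hD.mem hv hd).2
  · rintro ⟨d, hd⟩
    exact hD.surj hv (hD'.mem hv hd).1 (hD'.mem hv hd).2

lemma DirSys.iso_see [Finite V] (hT : T.IsAcyclic) (hD : DirSys T S nb) (hD' : DirSys T S nb')
    {q v : V} {d d' : ZMod 4} (hq : q ∈ S) (hv : nb q d = some v) (hv' : nb' q d' = some v) :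
    Iso (see nb q d) (see nb' q d') := by
  revert d'
  refine hD.induct hT (P := fun q d v => ∀ {d'}, nb' q d' = some v →
    Iso (see nb q d) (see nb' q d')) ?_ hq hv
  intro q d v hq hv ih d' hv'
  have hvS := (hD.mem hq hv).1
  obtain ⟨σ, hσ⟩ := hD.exists_perm hD' hvS
  have hd : σ (d + 2) = d' + 2 :=
    hD'.inj hvS (by rw [hσ, hD.opp hq hv]) (hD'.opp hq hv')
  have hiso : ∀ e, e ≠ d + 2 → Iso (see nb v e) (see nb' v (σ e)) := by
    intro e he
    rcases hx : nb v e with _ | x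
    · rw [see_none hx, see_none (by rw [hσ, hx])]
      exact .nil
    · exact ih e x he hx (by rw [hσ, hx])
  rw [hD.see_some hT hq hv, hD'.see_some hT hq hv']
  obtain ⟨n0, n1, n3⟩ := zmod4_turn_ne d
  exact .node (hiso _ n0) (hiso _ n1) (hiso _ n3)
    (perm_slots (g := fun e => see nb' v (σ e)) hd fun e => rfl)

/-- The optimality of balanced models. -/
theorem IsSModel.modelBends_le [Finite V] (hT : T.IsTree) (hS : PathClosed T S)
    {M M' : V → GridPoint} (hM : IsSModel T S M) (hM' : IsSModel T S M')
    (hb : ∀ v ∈ S, BalAt (nbAt T S M) v) : modelBends T S M ≤ modelBends T S M' := by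
  by_cases hl : ∃ r, IsLeaf T S r
  · obtain ⟨r, hr⟩ := hl
    obtain ⟨p, hpS, hadj⟩ := hr.2.exists
    obtain ⟨d, hd⟩ := hM.dirSys.surj hr.1 hpS hadj
    obtain ⟨d', hd'⟩ := hM'.dirSys.surj hr.1 hpS hadj
    have h1 := hM.modelBends_eq hT hS hr hd
    have h2 := hM'.modelBends_eq hT hS hr hd'
    have h3 := hM.dirSys.subBal_of_balAt hT.isAcyclic hb hr.1 hd
    -- Seen from `p`, the leaf `r` has value `0`; this is the `h` with which the optimality of
    -- rooted trees is applied.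
    have h4 : seeVal (nbAt T S M) p (d + 2) = 0 := by
      rw [hM.dirSys.seeVal_back hT.isAcyclic hr.1 hd, upVal]
      have : ∀ e, e ≠ d → seeVal (nbAt T S M) r e = -1 := by
        intro e he
        have h0 : nbAt T S M r e = none := by
          rcases hx : nbAt T S M r e with _ | x
          · rfl
          · obtain ⟨hxS, hrx⟩ := hM.dirSys.mem hr.1 hx
            obtain rfl := hr.nbr_unique hxS hpS hrx hadj
            exact absurd (hM.dirSys.inj hr.1 hx hd) he
        rw [seeVal, see_none h0, val_nil]
      obtain ⟨n2, n1, n3⟩ := zmod4_add_ne d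
      rw [this _ n2, this _ n1, this _ n3]
      rfl
    rw [h4] at h3
    have h5 := (hM.dirSys.iso_see hT.isAcyclic hM'.dirSys hr.1 hd hd').optimal h3 le_rfl
    rw [add_zero, add_zero] at h5
    omega
  -- Without leaves the supremum is taken over the empty set, and it is `0`.
  · have : modelBends T S M = 0 := by
      have h0 : {k | ∃ x y, IsLeaf T S x ∧ IsLeaf T S y ∧
          ∃ q : T.Walk x y, q.IsPath ∧ bendCount M q.support = k} = ∅ :=
        Set.eq_empty_of_forall_notMem fun k ⟨x, _, hx, _⟩ => hl ⟨x, hx⟩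
      rw [modelBends, h0, csSup_empty]
      rfl
    omega

end isomorphism

/-! ### From the calls of `Balance` on models to calls on rooted trees. -/

section calls

variable {V : Type*} {T : SimpleGraph V} {S : Set V} {nb nb' : V → ZMod 4 → Option V}
  {M M' : V → GridPoint}

lemma Side.adj {v u z y : V} (h : Side T v u z) (hzy : T.Adj z y) (hy : y ≠ v) : Side T v u y := by
  classical
  obtain ⟨w, -, hv⟩ := h
  refine ⟨(w.concat hzy).bypass, SimpleGraph.Walk.bypass_isPath _, fun hh => ?_⟩
  have := SimpleGraph.Walk.support_bypass_subset_support _ hh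
  rw [SimpleGraph.Walk.support_concat] at this
  simp only [List.mem_append, List.mem_singleton] at this
  exact this.elim hv fun h => hy h.symm

lemma IsSModel.loc_of_direction (hM : IsSModel T S M) (hM' : IsSModel T S M') {z : V} {k : ℕ}
    (hz : z ∈ S) (h : ∀ y ∈ S, T.Adj z y →
      direction (M' z) (M' y) = quarterTurn^[k] (direction (M z) (M y))) :
    Loc (nbAt T S M) (nbAt T S M') z := by
  refine ⟨k, fun e => ?_⟩
  rcases hx : nbAt T S M z e with _ | x
  · rcases hy : nbAt T S M' z (e + k) with _ | y
    · rfl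
    · obtain ⟨hyS, hzy, hd⟩ := nbAt_spec hy
      obtain ⟨d, hd'⟩ := hM.exists_direction hz hyS hzy
      rw [h y hyS hzy, hd', quarterTurn_iterate_uvec] at hd
      obtain rfl := add_right_cancel (uvec_injective hd)
      rw [hM.nbAt_eq hz hyS hzy hd'] at hx
      cases hx
  · obtain ⟨hxS, hzx, hd⟩ := nbAt_spec hx
    refine hM'.nbAt_eq hz hxS hzx ?_
    rw [h x hxS hzx, hd, quarterTurn_iterate_uvec]

/-- What a balance step at `v` means for the directions. -/
structure NbStep (T : SimpleGraph V) (S : Set V) (v : V) (nb nb' : V → ZMod 4 → Option V) :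
    Prop where
  off : ∀ z ∈ S, z ≠ v → Loc nb nb' z
  same : BalAt nb v → nb' = nb
  bal : BalAt nb' v

/-- All edges at `z ≠ v` belong to a single branch at `v`, which is rotated as a whole. -/
lemma Rearranged.loc (hT : T.IsTree) (hS : PathClosed T S) (hM : IsSModel T S M)
    {v : V} (hv : v ∈ S) (h : Rearranged T S v M M') {z : V} (hz : z ∈ S) (hzv : z ≠ v) :
    Loc (nbAt T S M) (nbAt T S M') z := by
  obtain ⟨u, hu, hs⟩ := exists_side hT hzv
  obtain ⟨k, hk⟩ := h.2 u (hS.side_mem hv hz hu hs) hu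
  have hzb := (mem_branch_iff hT.isAcyclic hu).2 (Or.inr hs)
  refine hM.loc_of_direction h.1 hz fun y hy hzy => hk z ⟨hz, hzb⟩ y ⟨hy, ?_⟩ hzy
  rw [mem_branch_iff hT.isAcyclic hu]
  by_cases hyv : y = v
  · exact Or.inl hyv
  · exact Or.inr (hs.adj hzy hyv)

lemma BalanceStep.nbStep [Finite V] (hT : T.IsTree) (hS : PathClosed T S) (hM : IsSModel T S M)
    {v : V} (hv : v ∈ S) (h : BalanceStep T S v M M') :
    IsSModel T S M' ∧ NbStep T S v (nbAt T S M) (nbAt T S M') := by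
  rcases h with ⟨hb, rfl⟩ | ⟨hb, hr, hb'⟩
  · exact ⟨hM, fun z _ _ => Loc.refl _ _, fun _ => rfl, (hM.balanced_iff hT.isAcyclic hS hv).1 hb⟩
  · exact ⟨hr.1, fun z hz hzv => hr.loc hT hS hM hv hz hzv,
      fun hh => absurd ((hM.balanced_iff hT.isAcyclic hS hv).2 hh) hb,
      (hr.1.balanced_iff hT.isAcyclic hS hv).1 hb'⟩

/-- The state of the directions after a sequence of calls `Balance(p, v)`, for `v` in a list. -/
structure CallsSpec (T : SimpleGraph V) (S : Set V) (p : V) (l : List V)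
    (nb nb' : V → ZMod 4 → Option V) : Prop where
  off : ∀ z ∈ S, z ≠ p → (∀ v ∈ l, ¬ Side T p v z) → Loc nb nb' z
  calls : ∃ k, (∀ e, nb' p (e + k) = nb p e) ∧ ∀ es : List (ZMod 4),
    l.map some = es.map (nb p) → Calls es (see nb p) fun e => see nb' p (e + k)

lemma NbStep.see_eq [Finite V] (hT : T.IsAcyclic) (hD : DirSys T S nb) (hD' : DirSys T S nb')
    {v u : V} (h : NbStep T S v nb nb') (hv : v ∈ S) {e e' : ZMod 4} (hu : nb v e = some u)
    (hu' : nb' v e' = some u) : see nb' v e' = see nb v e :=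
  hD.see_congr hT hD' hv hu hv hu' fun z hz hs =>
    h.off z hz fun hh => not_side_self (hh ▸ hs)

/-- A call `Balance(p, v)` with the subsequent balance step acts on the tree seen in direction
`v` as described by `Call`. -/
lemma CallsSpec.call [Finite V] (hT : T.IsAcyclic) {nb₀ nb₁ nb₂ : V → ZMod 4 → Option V}
    (h₀ : DirSys T S nb₀) (h₁ : DirSys T S nb₁) (h₂ : DirSys T S nb₂) {p v : V} {l : List V}
    {d d' : ZMod 4} (hp : p ∈ S) (hv : nb₀ p d = some v) (hv' : nb₂ p d' = some v)
    (hl : ListsNbrs T S v p l) (hc : CallsSpec T S v l nb₀ nb₁) (hs : NbStep T S v nb₁ nb₂) :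
    Call (upVal (seeVal nb₀ p) d) (see nb₀ p d) (see nb₂ p d') := by
  obtain ⟨hvS, hadj⟩ := h₀.mem hp hv
  obtain ⟨k, hk, hcalls⟩ := hc.calls
  have hslots : ∀ l' : List V, (∀ u ∈ l', u ∈ l) → ∃ es : List (ZMod 4), l'.map some = es.map (nb₀ v) := by
    intro l' hl'
    induction l' with
    | nil => exact ⟨[], rfl⟩
    | cons u l' ih =>
      obtain ⟨es, hes⟩ := ih fun w hw => hl' w (List.mem_cons_of_mem _ hw)
      obtain ⟨huS, hvu, -⟩ := (hl.2 u).1 (hl' u List.mem_cons_self)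
      obtain ⟨e, he⟩ := h₀.surj hvS huS hvu
      exact ⟨e :: es, by simp [he, hes]⟩
  obtain ⟨es, hes⟩ := hslots l fun _ => id
  have hnd : es.Nodup := by
    have := hl.1.map (Option.some_injective V)
    rw [hes] at this
    exact this.of_map
  have hpd := h₀.opp hp hv
  have hmem : ∀ i, i ∈ es ↔ i ≠ d + 2 ∧ see nb₀ v i ≠ BTree.nil := by
    intro i
    rw [Ne, Ne, h₀.see_eq_nil_iff hT hvS]
    constructor
    · intro hi
      have : nb₀ v i ∈ l.map some := by rw [hes]; exact List.mem_map_of_mem hi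
      obtain ⟨u, hu, hui⟩ := List.mem_map.1 this
      refine ⟨fun hh => ((hl.2 u).1 hu).2.2 ?_, by simp [← hui]⟩
      rw [hh, hpd] at hui
      exact Option.some.inj hui
    · rintro ⟨h1, h2⟩
      obtain ⟨x, hx⟩ := Option.ne_none_iff_exists'.1 h2
      obtain ⟨hxS, hvx⟩ := h₀.mem hvS hx
      have hxl : x ∈ l := (hl.2 x).2 ⟨hxS, hvx, h₀.ne_back hp hv hx h1⟩
      have : some x ∈ es.map (nb₀ v) := by rw [← hes]; exact List.mem_map_of_mem hxl
      obtain ⟨j, hj, hjx⟩ := List.mem_map.1 this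
      rwa [h₀.inj hvS hx hjx]
  have hcs := (hcalls es hes).shift d
  have hp1 : nb₁ v (2 + d + k) = some p := by rw [hk, add_comm 2 d, hpd]
  have hp2 := h₂.opp hp hv'
  -- The calls below `v` change nothing beyond `p`, except for local rotations.
  have hG2 : see nb₁ v (2 + d + k) = see nb₀ v (2 + d) := by
    refine h₀.see_congr hT h₁ hvS (by rw [add_comm 2 d, hpd]) hvS hp1 fun z hz hzs => ?_
    refine hc.off z hz (fun hh => not_side_self (hh ▸ hzs)) fun u hu hs => ?_
    obtain ⟨-, hvu, hup⟩ := (hl.2 u).1 hu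
    exact hup (Side.unique hT hvu hadj.symm hs hzs)
  have hrot : ∀ (nb : V → ZMod 4 → Option V) (j : ZMod 4), BalAt nb v ↔
      LocBal (see nb v (2 + j)).val (see nb v (0 + j)).val (see nb v (1 + j)).val
        (see nb v (3 + j)).val := by
    intro nb j
    rw [balAt_iff j, add_comm 2, add_comm 1, add_comm 3, zero_add]; rfl
  have key : Call (see nb₀ v (2 + d)).val
      (BTree.node (see nb₀ v (0 + d)) (see nb₀ v (1 + d)) (see nb₀ v (3 + d)))
      (BTree.node (see nb₂ v (0 + d')) (see nb₂ v (1 + d')) (see nb₂ v (3 + d'))) := by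
    refine call_node (G := fun i => see nb₀ v (i + d)) (F' := fun i => see nb₂ v (i + d')) hcs
      (hnd.map (sub_left_injective)) (fun i => ?_) ?_
    · rw [List.mem_map]
      constructor
      · rintro ⟨j, hj, rfl⟩
        obtain ⟨j1, j2⟩ := (hmem j).1 hj
        exact ⟨fun hh => j1 (by rw [← hh]; ring), by simpa using j2⟩
      · rintro ⟨i1, i2⟩
        refine ⟨i + d, (hmem _).2 ⟨fun hh => i1 ?_, i2⟩, by ring⟩
        rw [add_comm d 2] at hh
        exact add_right_cancel hh
    · have r1 := hrot nb₁ (d + k)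
      have r2 := hrot nb₂ d'
      simp only [← add_assoc] at r1
      rw [hG2] at r1
      by_cases hb : BalAt nb₁ v
      · refine Or.inl ⟨r1.1 hb, ?_⟩
        obtain rfl := hs.same hb
        have : 2 + d + k = d' + 2 := h₁.inj hvS hp1 hp2
        have : d' = d + k := by
          rw [add_assoc, add_comm 2] at this
          exact (add_right_cancel this).symm
        subst this
        funext i
        rw [add_assoc]
      -- The branches at `v` are moved rigidly, so the step permutes the trees seen from `v`. After
      -- normalising the direction of `p`, it permutes the three trees ahead and at the sides.
      · obtain ⟨σ, hσ⟩ := h₁.exists_perm h₂ hvS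
        have hd : σ (d + k + 2) = d' + 2 := by
          refine h₂.inj hvS ?_ hp2
          rw [hσ, ← hp1]
          congr 1; ring
        have hg : ∀ e, see nb₂ v (σ e) = see nb₁ v e := by
          intro e
          rcases hx : nb₁ v e with _ | x
          · rw [see_none hx, see_none (by rw [hσ, hx])]
          · exact hs.see_eq hT h₁ h₂ hvS hx (by rw [hσ, hx])
        refine Or.inr ⟨fun hh => hb (r1.2 hh), ?_, ?_⟩
        · have := perm_slots (g := see nb₁ v) (g' := see nb₂ v) hd hg
          simpa [add_comm, add_left_comm, add_assoc] using this
        · have h2 := r2.1 hs.bal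
          rwa [hs.see_eq hT h₁ h₂ hvS hp1 (by rw [add_comm 2, hp2]), hG2] at h2
  rw [← h₀.seeVal_back hT hp hv, h₀.see_some hT hp hv, h₂.see_some hT hp hv']
  simpa [add_comm, seeVal] using key

/-- A call changes vertices outside its own branch by local rotations only, so the siblings whose
calls are still to come look the same from `p`. This is what `Calls.cons` assumes. -/
theorem BalanceCalls.spec [Finite V] (hT : T.IsTree) (hS : PathClosed T S) {p : V} {l : List V}
    (h : BalanceCalls T S p l M M') : IsSModel T S M → p ∈ S → l.Nodup →
      (∀ v ∈ l, v ∈ S ∧ T.Adj p v) →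
      IsSModel T S M' ∧ CallsSpec T S p l (nbAt T S M) (nbAt T S M') := by
  have hA := hT.isAcyclic
  induction h with
  | nil p M =>
    intro hM _ _ _
    refine ⟨hM, fun z _ _ _ => Loc.refl _ _, 0, fun e => by rw [add_zero], fun es hes => ?_⟩
    obtain rfl : es = [] := by simpa using hes.symm
    simpa using Calls.nil _
  | @cons p v rest children M M₁ M₂ M₃ hL hC hB hR ihC ihR =>
    intro hM hp hnd hadj
    obtain ⟨hvS, hpv⟩ := hadj v List.mem_cons_self
    obtain ⟨hvr, hnd'⟩ := List.nodup_cons.1 hnd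
    obtain ⟨hM₁, hc⟩ := ihC hM hvS hL.1 fun u hu => ⟨((hL.2 u).1 hu).1, ((hL.2 u).1 hu).2.1⟩
    obtain ⟨hM₂, hs⟩ := hB.nbStep hT hS hM₁ hvS
    obtain ⟨hM₃, hr⟩ := ihR hM₂ hp hnd' fun u hu => hadj u (List.mem_cons_of_mem _ hu)
    have hloc : ∀ z ∈ S, ¬ Side T p v z → Loc (nbAt T S M) (nbAt T S M₂) z := by
      intro z hz hzs
      have hzv : z ≠ v := fun hh => hzs (by rw [hh]; exact side_self hpv)
      refine (hc.off z hz hzv fun u hu hsu => ?_).trans (hs.off z hz hzv)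
      obtain ⟨-, hvu, hup⟩ := (hL.2 u).1 hu
      exact hzs (Side.step hA hpv hvu hup hsu)
    refine ⟨hM₃, fun z hz hzp hl => ?_, ?_⟩
    · exact (hloc z hz (hl v List.mem_cons_self)).trans
        (hr.off z hz hzp fun u hu => hl u (List.mem_cons_of_mem _ hu))
    · obtain ⟨k, hk⟩ := hloc p hp not_side_self
      obtain ⟨k', hk', hcalls⟩ := hr.calls
      refine ⟨k + k', fun e => by rw [← add_assoc, hk', hk], fun es hes => ?_⟩
      obtain _ | ⟨e, es⟩ := es
      · cases hes
      simp only [List.map_cons, List.cons.injEq] at hes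
      obtain ⟨he, hes⟩ := hes
      have hcall := hc.call hA hM.dirSys hM₁.dirSys hM₂.dirSys hp he.symm
        (show nbAt T S M₂ p (e + k) = some v by rw [hk, he]) hL hs
      refine Calls.cons hcall ?_
      -- The first call may have rotated the directions at `p` by `k`; the shift undoes this.
      have h1 := (hcalls (es.map (· + k)) (by
        rw [List.map_map, hes]; exact List.map_congr_left fun i _ => (hk i).symm)).shift k
      rw [List.map_map] at h1
      convert h1 using 1
      · simp [Function.comp_def]
      · funext i
        by_cases hi : i = e
        · subst hi; simp
        · rw [Function.update_of_ne hi]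
          rcases hx : nbAt T S M p i with _ | x
          · rw [see_none hx, see_none (by rw [hk, hx])]
          · refine (hM.dirSys.see_congr hA hM₂.dirSys hp hx hp (by rw [hk, hx]) ?_).symm
            intro z hz hzs
            refine hloc z hz fun hh => hi (hM.dirSys.inj hp hx ?_)
            rw [← he, Side.unique hA (hM.dirSys.mem hp hx).2 hpv hzs hh]
      · funext i
        rw [add_assoc]

end calls
end StraightModel

namespace StraightModel

open BTree

/-! ### All vertices are balanced after every round of the algorithm. -/

section invariant

variable {V : Type*} {T : SimpleGraph V} {S : Set V} {nb nb' : V → ZMod 4 → Option V}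
  {M M' : V → GridPoint}

lemma pathClosed_singleton (v : V) : PathClosed T {v} := by
  intro x hx y hy w hw z hz
  rw [Set.mem_singleton_iff] at hx hy ⊢
  subst hx hy
  replace hw := (SimpleGraph.Walk.isPath_iff_nil.1 hw).eq_nil
  simpa [hw] using hz

lemma PathClosed.insert_adj (hT : T.IsTree) (hS : PathClosed T S) {r p : V} (hp : p ∈ S)
    (h : T.Adj r p) : PathClosed T (insert r S) := by
  by_cases hr : r ∈ S
  · rwa [Set.insert_eq_of_mem hr]
  have key : ∀ y ∈ S, ∀ w : T.Walk r y, w.IsPath → ∀ z ∈ w.support, z ∈ insert r S := by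
    intro y hy w hw z hz
    obtain ⟨w', hw', -⟩ := hT.existsUnique_path p y
    have h1 := hS p hp y hy w' hw'
    have h2 := walk_eq hT.isAcyclic hw (hw'.cons (h := h) fun hh => hr (h1 r hh))
    rw [h2, SimpleGraph.Walk.support_cons, List.mem_cons] at hz
    exact hz.imp id (h1 z)
  rintro x (rfl | hx) y (rfl | hy) w hw z hz
  · replace hw := (SimpleGraph.Walk.isPath_iff_nil.1 hw).eq_nil
    exact Or.inl (by simpa [hw] using hz)
  · exact key y hy w hw z hz
  · exact key x hx w.reverse hw.reverse z (by simpa using hz)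
  · exact Or.inr (hS x hx y hy w hw z hz)

lemma addedVertices_nil (v₀ : V) : addedVertices v₀ ([] : List (V × V)) = {v₀} := by
  ext x; simp [addedVertices]

lemma addedVertices_cons (v₀ v p : V) (l : List (V × V)) :
    addedVertices v₀ ((v, p) :: l) = insert v (addedVertices v₀ l) := by
  ext x; simp [addedVertices, or_left_comm]

lemma IsAdditionSeq.pathClosed (hT : T.IsTree) {v₀ : V} {l : List (V × V)}
    (h : IsAdditionSeq T v₀ l) : PathClosed T (addedVertices v₀ l) := by
  induction h with
  | nil => rw [addedVertices_nil]; exact pathClosed_singleton v₀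
  | cons _ _ h ih =>
    obtain ⟨hp, hadj⟩ := (h _).2 rfl
    rw [addedVertices_cons]
    exact ih.insert_adj hT hp hadj

lemma upVal_eq_zero {v : V} {d : ZMod 4} (h : ∀ e, e ≠ d → nb v e = none) :
    upVal (seeVal nb v) d = 0 := by
  have : ∀ e, e ≠ d → seeVal nb v e = -1 := fun e he => by rw [seeVal, see_none (h e he), val_nil]
  obtain ⟨n2, n1, n3⟩ := zmod4_add_ne d
  rw [upVal, this _ n2, this _ n1, this _ n3]
  rfl

lemma DirSys.subBal_around [Finite V] (hT : T.IsAcyclic) (hD : DirSys T S nb)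
    (hb : ∀ v ∈ S, BalAt nb v) {p : V} (hp : p ∈ S) (d : ZMod 4) :
    SubBal (node (see nb p d) (see nb p (d + 1)) (see nb p (d + 3))) (seeVal nb p (d + 2)) := by
  have key : ∀ e, SubBal (see nb p e) (upVal (seeVal nb p) e) := by
    intro e
    rcases hx : nb p e with _ | x
    · rw [see_none hx]; trivial
    · rw [← hD.seeVal_back hT hp hx]
      exact hD.subBal_of_balAt hT hb hp hx
  obtain ⟨u0, u1, u3⟩ := upVal_turns (seeVal nb p) d
  have k0 := key d
  have k1 := key (d + 1)
  have k3 := key (d + 3)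
  rw [u0] at k0
  rw [u1] at k1
  rw [u3, max_comm (seeVal nb p d + 1)] at k3
  exact ⟨(balAt_iff d).1 (hb p hp), k0, k1, k3⟩

lemma DirSys.eq_of_extends {r : V} (hD : DirSys T S nb) (hD' : DirSys T (insert r S) nb')
    (hext : ∀ z ∈ S, ∀ e, ∀ y, nb z e = some y → nb' z e = some y) {z : V} (hz : z ∈ S)
    (e : ZMod 4) (he : nb' z e ≠ some r) : nb' z e = nb z e := by
  rcases hx : nb z e with _ | x
  · rcases hy : nb' z e with _ | y
    · rfl
    · obtain ⟨hyS, hzy⟩ := hD'.mem (Set.mem_insert_of_mem r hz) hy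
      have hyr : y ≠ r := fun h => he (h ▸ hy)
      have hyS := hyS.resolve_left hyr
      obtain ⟨e', he'⟩ := hD.surj hz hyS hzy
      obtain rfl := hD'.inj (Set.mem_insert_of_mem r hz) hy (hext z hz e' y he')
      rw [hx] at he'
      cases he'
  · exact hext z hz e x hx

/-- After a leaf `r` has been attached to a balanced model, the drawing seen from `r` is balanced
as if `r` were not there. -/
lemma DirSys.subBal_of_attached [Finite V] (hT : T.IsAcyclic) {r p : V} (hD : DirSys T S nb)
    (hD' : DirSys T (insert r S) nb') (hb : ∀ v ∈ S, BalAt nb v) (hr : r ∉ S) (hp : p ∈ S)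
    (hadj : ∀ q, q ∈ S ∧ T.Adj r q ↔ q = p)
    (hext : ∀ z ∈ S, ∀ e, ∀ y, nb z e = some y → nb' z e = some y) {d : ZMod 4}
    (hd : nb' r d = some p) : SubBal (see nb' r d) (-1) := by
  have hrS : r ∈ insert r S := Set.mem_insert r S
  have hpS : p ∈ insert r S := Set.mem_insert_of_mem r hp
  have heq : ∀ {z}, z ∈ S → ∀ e, nb' z e ≠ some r → nb' z e = nb z e :=
    fun hz => hD.eq_of_extends hD' hext hz
  have hback := hD'.opp hrS hd
  have hslot : ∀ e, e ≠ d + 2 → nb' p e = nb p e := fun e he =>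
    heq hp e fun h => he (hD'.inj hpS h hback)
  have hnone : nb p (d + 2) = none := by
    rcases hx : nb p (d + 2) with _ | x
    · rfl
    · have := hext p hp _ _ hx
      rw [hback] at this
      cases this
      exact absurd (hD.mem hp hx).1 hr
  have hsee : ∀ e, e ≠ d + 2 → see nb' p e = see nb p e := by
    intro e he
    have h1 := hslot e he
    rcases hx : nb p e with _ | x
    · rw [see_none hx, see_none (h1.trans hx)]
    · refine hD.see_congr hT hD' hp hx hpS (h1.trans hx) fun z hz hs => ⟨0, fun e' => ?_⟩
      rw [add_zero]
      refine heq hz e' fun h => ?_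
      have hzp := (hadj z).1 ⟨hz, (hD'.mem (Set.mem_insert_of_mem r hz) h).2.symm⟩
      exact not_side_self (hzp ▸ hs)
  obtain ⟨n0, n1, n3⟩ := zmod4_turn_ne d
  rw [hD'.see_some hT hrS hd, hsee _ n0, hsee _ n1, hsee _ n3]
  have := hD.subBal_around hT hb hp d
  rwa [show seeVal nb p (d + 2) = -1 by rw [seeVal, see_none hnone, val_nil]] at this

lemma isSModel_singleton (v : V) (M : V → GridPoint) : IsSModel T {v} M where
  injOn := Set.injOn_singleton M v
  straight := by rintro x rfl y rfl h; exact absurd h (SimpleGraph.irrefl T)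
  vertex_edge := by rintro x rfl y rfl z rfl h; exact absurd h (SimpleGraph.irrefl T)
  edge_edge := by rintro x rfl y rfl z rfl w rfl h; exact absurd h (SimpleGraph.irrefl T)

lemma balAt_singleton (v : V) (M : V → GridPoint) : BalAt (nbAt T {v} M) v := by
  have : ∀ d, seeVal (nbAt T {v} M) v d = -1 := by
    intro d
    rcases hx : nbAt T {v} M v d with _ | x
    · rw [seeVal, see_none hx, val_nil]
    · obtain ⟨rfl, h, -⟩ := nbAt_spec hx
      exact absurd h (SimpleGraph.irrefl T)
  rw [BalAt, this, this, this, this]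
  exact Or.inl ⟨le_rfl, le_rfl, le_rfl, le_rfl⟩

/-- `Balance(r, p)` restores the balance of the whole model, after a leaf `r` has been attached. -/
lemma Balance.balAt [Finite V] (hT : T.IsTree) (hS : PathClosed T S) (hM : IsSModel T S M)
    {r p : V} {d : ZMod 4} (hr : r ∈ S) (hd : nbAt T S M r d = some p)
    (honly : ∀ q ∈ S, T.Adj r q → q = p) (hs : SubBal (see (nbAt T S M) r d) (-1))
    (h : Balance T S r p M M') : IsSModel T S M' ∧ ∀ z ∈ S, BalAt (nbAt T S M') z := by
  have hA := hT.isAcyclic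
  obtain ⟨hpS, hadj⟩ := hM.dirSys.mem hr hd
  obtain ⟨hM', hspec⟩ := BalanceCalls.spec hT hS h hM hr (List.nodup_singleton p)
    fun v hv => by rw [List.mem_singleton.1 hv]; exact ⟨hpS, hadj⟩
  refine ⟨hM', ?_⟩
  obtain ⟨k, hk, hcalls⟩ := hspec.calls
  have hnone : ∀ e, e ≠ d → nbAt T S M r e = none := by
    intro e he
    rcases hx : nbAt T S M r e with _ | x
    · rfl
    · obtain ⟨hxS, hrx⟩ := hM.dirSys.mem hr hx
      obtain rfl := honly x hxS hrx
      exact absurd (hM.dirSys.inj hr hx hd) he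
  have hnone' : ∀ e, e ≠ d + k → nbAt T S M' r e = none := by
    intro e he
    have := hk (e - k)
    rw [sub_add_cancel] at this
    rw [this, hnone _ fun hh => he (by rw [← hh, sub_add_cancel])]
  have hcall := hcalls [d] (by simp [hd])
  generalize hF : (fun e => see (nbAt T S M') r (e + k)) = F at hcall
  obtain _ | ⟨hc, hcn⟩ := hcall
  cases hcn
  have ht := congrFun hF d
  simp only [Function.update_self] at ht
  have hu : upVal (fun i => (see (nbAt T S M) r i).val) d = 0 := upVal_eq_zero hnone
  rw [hu, ← ht] at hc
  -- The free direction at `p` had the value `-1`, and with the new leaf it has the value `0`: the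
  -- invariant is used with `h = -1` and `u = 0`.
  have hbal := (hc (-1) hs le_rfl (Or.inr rfl)).2.1
  have hv : ∀ e, e ≠ d + k → seeVal (nbAt T S M') r e = -1 := fun e he => by
    rw [seeVal, see_none (hnone' e he), val_nil]
  refine hM'.dirSys.balAt_of_center hT hS hr ?_ fun e => ?_
  · obtain ⟨n2, n1, n3⟩ := zmod4_add_ne (d + k)
    rw [balAt_iff (d + k), hv _ n2, hv _ n1, hv _ n3]
    exact Or.inl ⟨le_rfl, le_rfl, neg_one_le_val _, neg_one_le_val _⟩
  · by_cases he : e = d + k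
    · rw [he, upVal_eq_zero hnone']
      exact hbal
    · rw [see_none (hnone' e he)]
      trivial

lemma Attached.nbAt_eq {r : V} (h : Attached T S r M M') :
    ∀ z ∈ S, ∀ e, ∀ y, nbAt T S M z e = some y → nbAt T (insert r S) M' z e = some y := by
  intro z hz e y hy
  obtain ⟨hyS, hzy, hd⟩ := nbAt_spec hy
  exact h.1.nbAt_eq (Set.mem_insert_of_mem r hz) (Set.mem_insert_of_mem r hyS) hzy
    (by rw [h.2 z hz y hyS hzy, hd])

/-- The models produced by the algorithm are balanced at all vertices. -/
theorem Produces.balAt [Finite V] (hT : T.IsTree) {v₀ : V} {l : List (V × V)}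
    (hl : IsAdditionSeq T v₀ l) (h : Produces T v₀ l M) :
    IsSModel T (addedVertices v₀ l) M ∧
      ∀ z ∈ addedVertices v₀ l, BalAt (nbAt T (addedVertices v₀ l) M) z := by
  induction h with
  | start M =>
    rw [addedVertices_nil]
    refine ⟨isSModel_singleton v₀ M, ?_⟩
    rintro z rfl
    exact balAt_singleton z M
  | @add v p l M M₁ M₂ _ ha hB ih =>
    obtain _ | ⟨hl', hv, hp⟩ := hl
    obtain ⟨hM, hb⟩ := ih hl'
    rw [addedVertices_cons]
    obtain ⟨hpS, hadj⟩ := (hp p).2 rfl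
    have hS := hl'.pathClosed hT
    obtain ⟨d, hd⟩ := ha.1.dirSys.surj (Set.mem_insert v _) (Set.mem_insert_of_mem v hpS) hadj
    refine hB.balAt hT (hS.insert_adj hT hpS hadj) ha.1 (Set.mem_insert v _) hd ?_ ?_
    · rintro q (rfl | hq) hvq
      · exact absurd hvq (SimpleGraph.irrefl T)
      · exact (hp q).1 ⟨hq, hvq⟩
    · exact hM.dirSys.subBal_of_attached hT.isAcyclic ha.1.dirSys hb hv hpS hp (ha.nbAt_eq) hd

lemma pathClosed_univ : PathClosed T Set.univ := fun _ _ _ _ _ _ _ _ => Set.mem_univ _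

theorem Produces.optimal [Finite V] (hT : T.IsTree) {v₀ : V} {l : List (V × V)}
    (hl : IncrementallyBuilt T v₀ l) (h : Produces T v₀ l M) :
    IsSModel T Set.univ M ∧ modelBends T Set.univ M = treeBends T := by
  obtain ⟨hM, hb⟩ := h.balAt hT hl.1
  rw [hl.2] at hM hb
  refine ⟨hM, le_antisymm ?_ (Nat.sInf_le ⟨M, hM, rfl⟩)⟩
  refine le_csInf ⟨_, M, hM, rfl⟩ ?_
  rintro _ ⟨M', hM', rfl⟩
  exact hM.modelBends_le hT pathClosed_univ hM' hb

end invariant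
end StraightModel

namespace StraightModel

open BTree

/-! ### Existence of addition sequences and of executions. -/

section existence

variable {V : Type*} {T : SimpleGraph V} {S : Set V} {M M' : V → GridPoint}

lemma PathClosed.nbr_unique (hS : PathClosed T S) {r p q : V} (hr : r ∉ S)
    (hp : p ∈ S) (hq : q ∈ S) (hrp : T.Adj r p) (hrq : T.Adj r q) : p = q := by
  by_contra hne
  have hw : (SimpleGraph.Walk.cons hrp.symm (.cons hrq .nil)).IsPath := by
    simp [SimpleGraph.Walk.cons_isPath_iff, hrp.ne', hrq.ne, hne]
  exact hr (hS p hp q hq _ hw r (by simp))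

lemma PathClosed.exists_adj (hT : T.IsTree) (hne : S.Nonempty) (hS : S ≠ Set.univ) :
    ∃ r p, r ∉ S ∧ p ∈ S ∧ T.Adj r p := by
  obtain ⟨x, hx⟩ := hne
  obtain ⟨y, hy⟩ := (Set.ne_univ_iff_exists_notMem S).1 hS
  obtain ⟨w, -, -⟩ := hT.existsUnique_path x y
  obtain ⟨d, -, h1, h2⟩ := w.exists_boundary_dart S hx hy
  exact ⟨d.snd, d.fst, h2, h1, d.adj.symm⟩

/-- Every addition sequence can be continued until all vertices have been added. -/
lemma IsAdditionSeq.exists_complete [Finite V] (hT : T.IsTree) {v₀ : V} (n : ℕ) :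
    ∀ l : List (V × V), IsAdditionSeq T v₀ l → (addedVertices v₀ l)ᶜ.ncard = n →
      ∃ l', IncrementallyBuilt T v₀ l' := by
  induction n with
  | zero =>
    intro l hl h
    rw [Set.ncard_eq_zero, Set.compl_empty_iff] at h
    exact ⟨l, hl, h⟩
  | succ n ih =>
    intro l hl h
    have hne : addedVertices v₀ l ≠ Set.univ := by
      intro hh
      rw [hh, Set.compl_univ, Set.ncard_empty] at h
      omega
    obtain ⟨r, p, hr, hp, hadj⟩ := PathClosed.exists_adj hT ⟨v₀, Or.inl rfl⟩ hne
    refine ih ((r, p) :: l) (.cons hl hr fun q => ?_) ?_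
    · constructor
      · rintro ⟨hq, hrq⟩
        exact (hl.pathClosed hT).nbr_unique hr hq hp hrq hadj
      · rintro rfl
        exact ⟨hp, hadj⟩
    · have : (addedVertices v₀ ((r, p) :: l))ᶜ = (addedVertices v₀ l)ᶜ \ {r} := by
        rw [addedVertices_cons]
        ext x
        simp [not_or, and_comm]
      rw [this, Set.ncard_sdiff_singleton_of_mem hr, h]
      rfl

theorem exists_incrementallyBuilt [Finite V] (hT : T.IsTree) :
    ∃ v₀ l, IncrementallyBuilt T v₀ l := by
  obtain ⟨v₀⟩ := hT.connected.nonempty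
  exact ⟨v₀, IsAdditionSeq.exists_complete hT _ [] .nil rfl⟩

/-- Every consistent assignment of directions to the edges is realised by a straight model. -/
theorem IsAdditionSeq.exists_model {v₀ : V} {l : List (V × V)} (hl : IsAdditionSeq T v₀ l)
    {D : V → V → ZMod 4}
    (hback : ∀ x ∈ addedVertices v₀ l, ∀ y ∈ addedVertices v₀ l, T.Adj x y → D y x = D x y + 2)
    (hinj : ∀ x ∈ addedVertices v₀ l, ∀ y ∈ addedVertices v₀ l, ∀ z ∈ addedVertices v₀ l,
      T.Adj x y → T.Adj x z → D x y = D x z → y = z) :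
    ∃ M, IsSModel T (addedVertices v₀ l) M ∧ ∀ x ∈ addedVertices v₀ l, ∀ y ∈ addedVertices v₀ l,
      T.Adj x y → direction (M x) (M y) = uvec (D x y) := by
  induction hl with
  | nil =>
    rw [addedVertices_nil]
    refine ⟨fun _ => 0, isSModel_singleton v₀ _, ?_⟩
    rintro x rfl y rfl h
    exact absurd h (SimpleGraph.irrefl T)
  | @cons r p l hl hr hp ih =>
    rw [addedVertices_cons] at hback hinj ⊢
    set S := addedVertices v₀ l
    have hsub : ∀ {z}, z ∈ S → z ∈ insert r S := fun h => Set.mem_insert_of_mem r h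
    obtain ⟨M, hM, hdir⟩ := ih (fun x hx y hy => hback x (hsub hx) y (hsub hy))
      fun x hx y hy z hz => hinj x (hsub hx) y (hsub hy) z (hsub hz)
    obtain ⟨hpS, hadj⟩ := (hp p).2 rfl
    obtain ⟨M', hM', hold, hnew⟩ := hM.exists_insert (D p r) hr hpS
      (fun z hz => ⟨fun h => (hp z).1 ⟨hz, h⟩, fun h => h ▸ hadj⟩) fun z hz hpz h => by
        rw [hdir p hpS z hz hpz] at h
        have := hinj p (hsub hpS) z (hsub hz) r (Set.mem_insert r S) hpz hadj.symm
          (uvec_injective h)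
        exact hr (this ▸ hz)
    refine ⟨M', hM', ?_⟩
    rintro x (rfl | hx) y (rfl | hy) hxy
    · exact absurd hxy (SimpleGraph.irrefl T)
    · obtain rfl := (hp y).1 ⟨hy, hxy⟩
      rw [direction_back hnew, hback y (hsub hy) x (Set.mem_insert x S) hxy.symm]
    · obtain rfl := (hp x).1 ⟨hx, hxy.symm⟩
      exact hnew
    · rw [hold x hx y hy, hdir x hx y hy hxy]

/-- `τ` sorts the values in increasing order; exchanging `0` and `3` then puts the two largest at
the opposite slots `0` and `2`. -/
lemma exists_perm_locBal (f : ZMod 4 → ℤ) : ∃ σ : Equiv.Perm (ZMod 4), ∀ g : ZMod 4 → ℤ,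
    (∀ e, g (σ e) = f e) → LocBal (g 2) (g 0) (g 1) (g 3) := by
  have h := Tuple.monotone_sort (n := 4) f
  set τ : Equiv.Perm (ZMod 4) := Tuple.sort (n := 4) f
  refine ⟨((Equiv.swap 0 3).trans τ).symm, fun g hg => Or.inl ?_⟩
  have hg' : ∀ e, g e = f (τ (Equiv.swap 0 3 e)) := by
    intro e
    have := hg (((Equiv.swap 0 3).trans τ) e)
    rw [Equiv.symm_apply_apply] at this
    exact this
  have h01 : f (τ 0) ≤ f (τ 1) := h (show (0 : Fin 4) ≤ 1 by decide)
  have h12 : f (τ 1) ≤ f (τ 2) := h (show (1 : Fin 4) ≤ 2 by decide)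
  have h23 : f (τ 2) ≤ f (τ 3) := h (show (2 : Fin 4) ≤ 3 by decide)
  rw [hg' 0, hg' 1, hg' 2, hg' 3, show Equiv.swap (0 : ZMod 4) 3 0 = 3 by decide,
    show Equiv.swap (0 : ZMod 4) 3 1 = 1 by decide, show Equiv.swap (0 : ZMod 4) 3 2 = 2 by decide,
    show Equiv.swap (0 : ZMod 4) 3 3 = 0 by decide]
  omega

variable [Finite V]

/-- A balance step can always be carried out. -/
theorem IsAdditionSeq.exists_balanceStep (hT : T.IsTree) {v₀ : V} {l : List (V × V)}
    (hl : IsAdditionSeq T v₀ l) (hM : IsSModel T (addedVertices v₀ l) M) {v : V}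
    (hv : v ∈ addedVertices v₀ l) :
    ∃ M', BalanceStep T (addedVertices v₀ l) v M M' ∧ IsSModel T (addedVertices v₀ l) M' := by
  classical
  have hA := hT.isAcyclic
  have hS := hl.pathClosed hT
  by_cases hb : Balanced T (addedVertices v₀ l) M v
  · exact ⟨M, Or.inl ⟨hb, rfl⟩, hM⟩
  set S := addedVertices v₀ l with hSdef
  have hD := hM.dirSys
  obtain ⟨σ, hσ⟩ := exists_perm_locBal (seeVal (nbAt T S M) v)
  have hdir : ∀ x y, ∃ d, x ∈ S → y ∈ S → T.Adj x y → direction (M x) (M y) = uvec d := by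
    intro x y
    by_cases h : x ∈ S ∧ y ∈ S ∧ T.Adj x y
    · obtain ⟨d, hd⟩ := hM.exists_direction h.1 h.2.1 h.2.2
      exact ⟨d, fun _ _ _ => hd⟩
    · exact ⟨0, fun h1 h2 h3 => absurd ⟨h1, h2, h3⟩ h⟩
  choose D hD' using hdir
  have hbr : ∀ z, ∃ e, z ∈ S → z ≠ v → ∃ u, nbAt T S M v e = some u ∧ Side T v u z := by
    intro z
    by_cases h : z ∈ S ∧ z ≠ v
    · obtain ⟨u, hu, hs⟩ := exists_side hT h.2
      obtain ⟨e, he⟩ := hD.surj hv (hS.side_mem hv h.1 hu hs) hu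
      exact ⟨e, fun _ _ => ⟨u, he, hs⟩⟩
    · exact ⟨0, fun h1 h2 => absurd ⟨h1, h2⟩ h⟩
  choose br hbr using hbr
  have hbr_eq : ∀ {e u z}, nbAt T S M v e = some u → z ∈ S → z ≠ v → Side T v u z → br z = e := by
    intro e u z he hz hzv hs
    obtain ⟨u', hu', hs'⟩ := hbr z hz hzv
    obtain rfl := Side.unique hA (hD.mem hv he).2 (hD.mem hv hu').2 hs hs'
    exact hD.inj hv hu' he
  -- The branch in direction `e` is rotated by `σ e - e`, so that its edge to `v` gets the direction
  -- `σ e`.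
  set κ : V → ZMod 4 := fun z => σ (br z) - br z with hκ
  -- An edge belongs to the branch of an endpoint different from `v`.
  set rep : V → V → V := fun x y => if x = v then y else x with hrep
  have hrep_side : ∀ {e u x y}, nbAt T S M v e = some u → x ∈ S → y ∈ S → T.Adj x y →
      (x = v ∨ Side T v u x) → (y = v ∨ Side T v u y) → br (rep x y) = e := by
    intro e u x y he hx hy hxy h1 h2
    simp only [hrep]
    split_ifs with hxv
    · have hyv : y ≠ v := fun hh => hxy.ne (hxv.trans hh.symm)
      exact hbr_eq he hy hyv (h2.resolve_left hyv)
    · exact hbr_eq he hx hxv (h1.resolve_left hxv)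
  have hedge : ∀ {x y}, x ∈ S → y ∈ S → T.Adj x y → ∃ e u, nbAt T S M v e = some u ∧
      (x = v ∨ Side T v u x) ∧ (y = v ∨ Side T v u y) := by
    intro x y hx hy hxy
    by_cases hxv : x = v
    · have hyv : y ≠ v := fun hh => hxy.ne (hxv.trans hh.symm)
      obtain ⟨u, hu, hs⟩ := hbr y hy hyv
      exact ⟨br y, u, hu, Or.inl hxv, Or.inr hs⟩
    · obtain ⟨u, hu, hs⟩ := hbr x hx hxv
      refine ⟨br x, u, hu, Or.inr hs, ?_⟩
      by_cases hyv : y = v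
      · exact Or.inl hyv
      · exact Or.inr (hs.adj hxy hyv)
  have hDv : ∀ {y}, y ∈ S → T.Adj v y → D v y = br y ∧ nbAt T S M v (br y) = some y := by
    intro y hy hvy
    have h1 := hM.nbAt_eq hv hy hvy (hD' v y hv hy hvy)
    have h2 := hbr_eq h1 hy hvy.ne' (side_self hvy)
    exact ⟨h2.symm, by rw [h2]; exact h1⟩
  obtain ⟨M', hM', hdir'⟩ := hl.exists_model (D := fun x y => D x y + κ (rep x y))
    (fun x hx y hy hxy => by
      obtain ⟨e, u, he, h1, h2⟩ := hedge hx hy hxy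
      simp only [hκ, hrep_side he hx hy hxy h1 h2, hrep_side he hy hx hxy.symm h2 h1]
      have := direction_back (hD' x y hx hy hxy)
      rw [hD' y x hy hx hxy.symm] at this
      rw [uvec_injective this]
      ring)
    (fun x hx y hy z hz hxy hxz h => by
      by_cases hxv : x = v
      · subst hxv
        simp only [hrep, hκ, if_true, (hDv hy hxy).1, (hDv hz hxz).1, add_sub_cancel] at h
        have h3 := (hDv hy hxy).2
        rw [σ.injective h, (hDv hz hxz).2] at h3
        exact (Option.some.inj h3).symm
      · simp only [hrep, if_neg hxv] at h
        have h1 := hD' x y hx hy hxy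
        rw [add_right_cancel h] at h1
        exact hM.direction_inj hx hy hz hxy hxz h1 (hD' x z hx hz hxz))
  have hR : Rearranged T S v M M' := by
    refine ⟨hM', fun u hu hvu => ⟨(κ u).val, ?_⟩⟩
    rintro x ⟨hx, hxb⟩ y ⟨hy, hyb⟩ hxy
    rw [mem_branch_iff hA hvu] at hxb hyb
    rw [hdir' x hx y hy hxy, hD' x y hx hy hxy, quarterTurn_iterate_uvec, ZMod.natCast_zmod_val]
    have := hrep_side (hDv hu hvu).2 hx hy hxy hxb hyb
    simp only [hκ, this]
  refine ⟨M', Or.inr ⟨hb, hR, (hM'.balanced_iff hA hS hv).2 ?_⟩, hM'⟩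
  refine hσ (seeVal (nbAt T S M') v) fun e => ?_
  have hkey : ∀ e u, nbAt T S M v e = some u → nbAt T S M' v (σ e) = some u := by
    intro e u he
    obtain ⟨huS, hvu⟩ := hD.mem hv he
    refine hM'.nbAt_eq hv huS hvu ?_
    rw [hdir' v hv u huS hvu]
    have h2 := hbr_eq he huS hvu.ne' (side_self hvu)
    simp only [hrep, hκ, if_true, (hDv huS hvu).1, h2, add_sub_cancel]
  rcases hx : nbAt T S M v e with _ | u
  · have : nbAt T S M' v (σ e) = none := by
      rcases hy : nbAt T S M' v (σ e) with _ | y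
      · rfl
      · obtain ⟨hyS, hvy⟩ := hM'.dirSys.mem hv hy
        obtain ⟨e', he'⟩ := hD.surj hv hyS hvy
        have := σ.injective (hM'.dirSys.inj hv hy (hkey e' y he'))
        rw [← this, hx] at he'
        cases he'
    rw [seeVal, seeVal, see_none this, see_none hx]
  · rw [seeVal, hD.see_congr hA hM'.dirSys hv hx hv (hkey e u hx) fun z hz hs =>
      hR.loc hT hS hM hv hz fun hh => not_side_self (hh ▸ hs)]
    rfl

/-- The calls of `Balance` terminate; each preserves what the balance steps preserve. -/
lemma exists_balanceCalls (hT : T.IsTree) {P : (V → GridPoint) → Prop}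
    (hM₀ : IsSModel T S M)
    (hP : ∀ v ∈ S, ∀ M, P M → ∃ M', BalanceStep T S v M M' ∧ P M') {p v : V} (hp : p ∈ S)
    (hv : v ∈ S) (hpv : T.Adj p v) {M₀ : V → GridPoint} (h : P M₀) :
    ∃ M', Balance T S p v M₀ M' ∧ P M' := by
  have hD := hM₀.dirSys
  obtain ⟨d, hd⟩ := hD.surj hp hv hpv
  have key : ∀ (v : V) (l : List V), (∀ u ∈ l, ∀ M, P M → ∃ l' M₁ M₂, ListsNbrs T S u v l' ∧
      BalanceCalls T S u l' M M₁ ∧ BalanceStep T S u M₁ M₂ ∧ P M₂) → ∀ M, P M →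
      ∃ M', BalanceCalls T S v l M M' ∧ P M' := by
    intro v l
    induction l with
    | nil => exact fun _ M hM => ⟨M, .nil v M, hM⟩
    | cons u l ih =>
      intro h M hM
      obtain ⟨l', M₁, M₂, h1, h2, h3, h4⟩ := h u List.mem_cons_self M hM
      obtain ⟨M', h5, h6⟩ := ih (fun w hw => h w (List.mem_cons_of_mem _ hw)) M₂ h4
      exact ⟨M', .cons h1 h2 h3 h5, h6⟩
  refine key p [v] (fun u hu => ?_) M₀ h
  rw [List.mem_singleton.1 hu]
  refine hD.induct hT.isAcyclic (P := fun q d v => ∀ M, P M → ∃ l' M₁ M₂, ListsNbrs T S v q l' ∧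
      BalanceCalls T S v l' M M₁ ∧ BalanceStep T S v M₁ M₂ ∧ P M₂) ?_ hp hd
  intro q d v hq hv ih M hM
  obtain ⟨hvS, hqv⟩ := hD.mem hq hv
  have hmem : ∀ u, u ∈ (Set.toFinite {u | u ∈ S ∧ T.Adj v u ∧ u ≠ q}).toFinset.toList ↔
      u ∈ S ∧ T.Adj v u ∧ u ≠ q := by
    intro u
    rw [Finset.mem_toList, Set.Finite.mem_toFinset]
    rfl
  obtain ⟨M₁, h1, h2⟩ := key v _ (fun u hu => by
    obtain ⟨huS, hvu, huq⟩ := (hmem u).1 hu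
    obtain ⟨e, he⟩ := hD.surj hvS huS hvu
    refine ih e u (fun hh => huq ?_) he
    rw [hh, hD.opp hq hv] at he
    exact (Option.some.inj he).symm) M hM
  obtain ⟨M₂, h3, h4⟩ := hP v hvS M₁ h2
  exact ⟨_, M₁, M₂, ⟨Finset.nodup_toList _, hmem⟩, h1, h3, h4⟩

/-- If all four directions were occupied, then `p` would have a fifth neighbour `r`. -/
lemma IsSModel.exists_free (hM : IsSModel T S M) {r p : V} (hr : r ∉ S) (hp : p ∈ S)
    (hadj : T.Adj p r) (hdeg : (T.neighborSet p).ncard ≤ 4) : ∃ d, nbAt T S M p d = none := by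
  classical
  have := Fintype.ofFinite V
  by_contra hcon
  push Not at hcon
  have h : ∀ d, ∃ x, nbAt T S M p d = some x := fun d => Option.ne_none_iff_exists'.1 (hcon d)
  choose x hx using h
  have hinj : Function.Injective x := fun d e hde =>
    hM.dirSys.inj hp (hx d) (by rw [hx e, hde])
  have hsub : insert r (Set.range x) ⊆ T.neighborSet p := by
    rintro y (rfl | ⟨d, rfl⟩)
    · exact hadj
    · exact (hM.dirSys.mem hp (hx d)).2
  have hcard := Set.ncard_le_ncard hsub (Set.toFinite _)
  rw [Set.ncard_insert_of_notMem _ (Set.toFinite _), Set.ncard_range_of_injective hinj] at hcard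
  · have : Nat.card (ZMod 4) = 4 := by simp
    omega
  · rintro ⟨d, rfl⟩
    exact hr (hM.dirSys.mem hp (hx d)).1

/-- The algorithm has an execution, for every addition sequence. -/
theorem IsAdditionSeq.exists_produces (hT : T.IsTree) (hdeg : ∀ v, (T.neighborSet v).ncard ≤ 4)
    {v₀ : V} {l : List (V × V)} (hl : IsAdditionSeq T v₀ l) :
    ∃ M, Produces T v₀ l M := by
  induction l with
  | nil => exact ⟨fun _ => 0, .start _⟩
  | cons a l ih =>
    have hl₀ := hl
    obtain _ | @⟨v, p, _, hl, hv, hp⟩ := hl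
    obtain ⟨M, hM⟩ := ih hl
    obtain ⟨hMS, -⟩ := hM.balAt hT hl
    obtain ⟨hpS, hadj⟩ := (hp p).2 rfl
    obtain ⟨d, hd⟩ := hMS.exists_free hv hpS hadj.symm (hdeg p)
    obtain ⟨M₁, hM₁, hold, -⟩ := hMS.exists_insert d hv hpS
      (fun z hz => ⟨fun h => (hp z).1 ⟨hz, h⟩, fun h => h ▸ hadj⟩) fun z hz hpz h => by
        rw [hMS.nbAt_eq hpS hz hpz h] at hd
        cases hd
    obtain ⟨M₂, h2, -⟩ := exists_balanceCalls (P := IsSModel T (insert v (addedVertices v₀ l)))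
      hT hM₁ (fun w hw M hM => by
        rw [← addedVertices_cons v₀ v p] at hw hM ⊢
        exact hl₀.exists_balanceStep hT hM hw)
      (Set.mem_insert v _) (Set.mem_insert_of_mem v hpS) hadj hM₁
    exact ⟨M₂, .add hM ⟨hM₁, fun x hx y hy _ => hold x hx y hy⟩ h2⟩

end existence
end StraightModel

namespace StraightModel

open BTree

/-! ### Every balanced model is the result of an execution. -/

section removal

variable {V : Type*} {T : SimpleGraph V} {S : Set V} {nb nb' : V → ZMod 4 → Option V}
  {M M' : V → GridPoint}

lemma PathClosed.side_of_leaf (hT : T.IsTree) (hS : PathClosed T S) {r p x : V} (hr : r ∈ S)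
    (honly : ∀ q ∈ S, T.Adj r q → q = p) (hx : x ∈ S) (hxr : x ≠ r) : Side T r p x := by
  obtain ⟨w, hw, hs⟩ := exists_side hT hxr
  rwa [honly w (hS.side_mem hr hx hw hs) hw] at hs

/-- Both ends of the path are joined to `p` without passing `r`; hence so is the unique path between
them. -/
lemma PathClosed.of_insert_leaf (hT : T.IsTree) {r p : V} (hr : r ∉ S)
    (hS : PathClosed T (insert r S)) (honly : ∀ q ∈ S, T.Adj r q → q = p) : PathClosed T S := by
  classical
  intro x hx y hy w hw z hz
  refine (hS x (Set.mem_insert_of_mem r hx) y (Set.mem_insert_of_mem r hy) w hw z hz).resolve_left ?_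
  rintro rfl
  have hside : ∀ x ∈ S, Side T z p x := fun x hx =>
    hS.side_of_leaf hT (Set.mem_insert z S) (fun q hq h =>
      honly q (hq.resolve_left fun hh => h.ne hh.symm) h) (Set.mem_insert_of_mem z hx)
      fun hh => hr (hh ▸ hx)
  obtain ⟨a, -, ha⟩ := hside x hx
  obtain ⟨b, -, hb⟩ := hside y hy
  have h1 := walk_eq hT.isAcyclic hw (a.reverse.append b).bypass_isPath
  rw [h1] at hz
  have := SimpleGraph.Walk.support_bypass_subset_support _ hz
  rw [SimpleGraph.Walk.mem_support_append_iff, SimpleGraph.Walk.support_reverse,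
    List.mem_reverse] at this
  exact this.elim ha hb

lemma IsSModel.mono {S' : Set V} (hM : IsSModel T S M) (h : S' ⊆ S) : IsSModel T S' M where
  injOn := hM.injOn.mono h
  straight x hx y hy := hM.straight x (h hx) y (h hy)
  vertex_edge x hx y hy z hz := hM.vertex_edge x (h hx) y (h hy) z (h hz)
  edge_edge x hx y hy z hz w hw := hM.edge_edge x (h hx) y (h hy) z (h hz) w (h hw)

variable [Finite V]

lemma DirSys.see_congr_off (hT : T.IsAcyclic) {r : V} (hD : DirSys T S nb)
    (hD' : DirSys T (insert r S) nb')
    (hext : ∀ z ∈ S, ∀ e, ∀ y, nb z e = some y → nb' z e = some y) (hr : r ∉ S) {q : V}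
    (hq : q ∈ S) {d : ZMod 4} (h : ∀ x, nb' q d = some x → ¬ Side T q x r) : see nb q d = see nb' q d := by
  have hqr := Set.mem_insert_of_mem r hq
  have heq : nb' q d = nb q d := hD.eq_of_extends hD' hext hq d fun hh =>
    h r hh (side_self (hD'.mem hqr hh).2)
  rcases hx : nb' q d with _ | x
  · rw [see_none hx, see_none (heq ▸ hx)]
  · refine (hD.see_congr hT hD' hq (heq ▸ hx) hqr hx fun z hz hs => ⟨0, fun e => ?_⟩).symm
    rw [add_zero]
    refine hD.eq_of_extends hD' hext hz e fun hh => h x hx ?_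
    exact hs.adj (hD'.mem (Set.mem_insert_of_mem r hz) hh).2 fun hrq => hr (hrq ▸ hq)

/-- A vertex from which all subtrees look light. -/
lemma DirSys.exists_light (hT : T.IsAcyclic) (hD : DirSys T S nb) (hne : S.Nonempty) :
    ∃ c ∈ S, ∀ d, seeVal nb c d ≤ upVal (seeVal nb c) d := by
  obtain ⟨v₀, hv₀⟩ := hne
  by_cases h₀ : ∀ d, seeVal nb v₀ d ≤ upVal (seeVal nb v₀) d
  · exact ⟨v₀, hv₀, h₀⟩
  have hsome : ∀ {v d}, upVal (seeVal nb v) d < seeVal nb v d → ∃ x, nb v d = some x := by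
    intro v d h
    rcases hx : nb v d with _ | x
    · rw [seeVal, see_none hx, val_nil] at h
      have := neg_one_le_val (see nb v (d + 2))
      have h2 : seeVal nb v (d + 2) ≤ upVal (seeVal nb v) d := le_max_left _ _
      rw [seeVal] at h2
      omega
    · exact ⟨x, rfl⟩
  push Not at h₀
  obtain ⟨d₀, hd₀⟩ := h₀
  obtain ⟨x₀, hx₀⟩ := hsome hd₀
  revert hd₀
  -- Walk in heavy directions. The walk never turns back, since an edge cannot be heavy from both of
  -- its ends; so it ends, at a vertex without heavy directions.
  refine hD.induct hT (P := fun q d v => upVal (seeVal nb q) d < seeVal nb q d →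
    ∃ c ∈ S, ∀ d, seeVal nb c d ≤ upVal (seeVal nb c) d) ?_ hv₀ hx₀
  intro q d v hq hv ih hheavy
  have hvS := (hD.mem hq hv).1
  by_cases h : ∀ d, seeVal nb v d ≤ upVal (seeVal nb v) d
  · exact ⟨v, hvS, h⟩
  push Not at h
  obtain ⟨e, he⟩ := h
  obtain ⟨x, hx⟩ := hsome he
  refine ih e x ?_ hx he
  rintro rfl
  have h1 := hD.seeVal_back hT hvS (hD.opp hq hv)
  have h2 := hD.seeVal_back hT hq hv
  rw [zmod4_add_two_two] at h1
  omega

/-- In a sorted subtree there is a leaf whose removal leaves it sorted and decreases its value by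
at most one. -/
lemma DirSys.exists_removable (hT : T.IsAcyclic) (hD : DirSys T S nb) {q v : V} {d : ZMod 4}
    (hq : q ∈ S) (hv : nb q d = some v) (hs : Srt (see nb q d)) :
    ∃ r p e, r ∈ S ∧ nb r e = some p ∧ (∀ e', e' ≠ e → nb r e' = none) ∧ Side T q v r ∧
      ∀ S₀ nb₀, r ∉ S₀ → insert r S₀ = S → DirSys T S₀ nb₀ →
        (∀ z ∈ S₀, ∀ e, ∀ y, nb₀ z e = some y → nb z e = some y) →
        Srt (see nb₀ q d) ∧ seeVal nb q d - 1 ≤ seeVal nb₀ q d ∧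
          seeVal nb₀ q d ≤ seeVal nb q d := by
  revert hs
  refine hD.induct hT (P := fun q d v => Srt (see nb q d) →
    ∃ r p e, r ∈ S ∧ nb r e = some p ∧ (∀ e', e' ≠ e → nb r e' = none) ∧ Side T q v r ∧
      ∀ S₀ nb₀, r ∉ S₀ → insert r S₀ = S → DirSys T S₀ nb₀ →
        (∀ z ∈ S₀, ∀ e, ∀ y, nb₀ z e = some y → nb z e = some y) →
        Srt (see nb₀ q d) ∧ seeVal nb q d - 1 ≤ seeVal nb₀ q d ∧
          seeVal nb₀ q d ≤ seeVal nb q d) ?_ hq hv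
  intro q d v hq hv ih hs
  obtain ⟨hvS, hqv⟩ := hD.mem hq hv
  have hsee := hD.see_some hT hq hv
  rw [hsee] at hs
  obtain ⟨hb, hc, sa, sb, sc⟩ := hs
  obtain ⟨n0, n1, n3⟩ := zmod4_turn_ne d
  have hval : seeVal nb q d = max (seeVal nb v d)
      (max (seeVal nb v (d + 1) + 1) (seeVal nb v (d + 3) + 1)) := by
    rw [seeVal, hsee, val_node]; rfl
  have hnn : ∀ e, nb v e = none → seeVal nb v e = -1 := fun e he => by
    rw [seeVal, see_none he, val_nil]
  by_cases hleaf : ∀ e, e ≠ d + 2 → nb v e = none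
  · refine ⟨v, q, d + 2, hvS, hD.opp hq hv, hleaf, side_self hqv, fun S₀ nb₀ h1 h2 h3 h4 => ?_⟩
    have hq₀ : q ∈ S₀ := (h2 ▸ hq : q ∈ insert v S₀).resolve_left hqv.ne
    have hnone : nb₀ q d = none := by
      rcases hx : nb₀ q d with _ | x
      · rfl
      · have := h4 q hq₀ d x hx
        rw [hv] at this
        cases this
        exact absurd (h3.mem hq₀ hx).1 h1
    rw [hval, hnn _ (hleaf _ n0), hnn _ (hleaf _ n1), hnn _ (hleaf _ n3), seeVal, see_none hnone]
    exact ⟨trivial, by decide, by decide⟩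
  -- A leaf may be taken from the branch `e` if a loss of at most one in its value leaves the value
  -- ahead at least as large as those at the sides.
  have key : ∀ e x, e ≠ d + 2 → nb v e = some x → Srt (see nb v e) →
      (∀ f : ZMod 4 → ℤ, (∀ e', e' ≠ e → f e' = seeVal nb v e') → seeVal nb v e - 1 ≤ f e →
        f e ≤ seeVal nb v e → -1 ≤ f e → f (d + 1) ≤ f d ∧ f (d + 3) ≤ f d) →
      ∃ r p e, r ∈ S ∧ nb r e = some p ∧ (∀ e', e' ≠ e → nb r e' = none) ∧ Side T q v r ∧
        ∀ S₀ nb₀, r ∉ S₀ → insert r S₀ = S → DirSys T S₀ nb₀ →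
          (∀ z ∈ S₀, ∀ e, ∀ y, nb₀ z e = some y → nb z e = some y) →
          Srt (see nb₀ q d) ∧ seeVal nb q d - 1 ≤ seeVal nb₀ q d ∧
            seeVal nb₀ q d ≤ seeVal nb q d := by
    intro e x he hx hsrt hf
    obtain ⟨r, p, g, hr, hg, hg', hside, hrem⟩ := ih e x he hx hsrt
    have hvx := (hD.mem hvS hx).2
    have hrs := Side.step hT hqv hvx (hD.ne_back hq hv hx he) hside
    refine ⟨r, p, g, hr, hg, hg', hrs, fun S₀ nb₀ h1 h2 h3 h4 => ?_⟩
    have hqr : q ≠ r := fun h => not_side_self (h ▸ hrs)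
    have hvr : v ≠ r := fun h => not_side_self (h ▸ hside)
    have hq₀ : q ∈ S₀ := (h2 ▸ hq : q ∈ insert r S₀).resolve_left hqr
    have hv₀ : v ∈ S₀ := (h2 ▸ hvS : v ∈ insert r S₀).resolve_left hvr
    obtain ⟨i1, i2, i3⟩ := hrem S₀ nb₀ h1 h2 h3 h4
    subst h2
    have hq1 : nb₀ q d = some v := by
      rw [← h3.eq_of_extends hD h4 hq₀ d, hv]
      rw [hv]
      exact fun h => hvr (Option.some.inj h)
    have hoff : ∀ e', e' ≠ e → see nb₀ v e' = see nb v e' := fun e' he' =>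
      h3.see_congr_off hT hD h4 h1 hv₀ fun y hy hys => he' (hD.inj hvS hy
        (by rw [hx, Side.unique hT (hD.mem hvS hy).2 hvx hys hside]))
    have hsrt' : ∀ e', Srt (see nb v e') → Srt (see nb₀ v e') := by
      intro e' h'
      by_cases hh : e' = e
      · exact hh ▸ i1
      · rwa [hoff e' hh]
    have hoff' : ∀ e', e' ≠ e → seeVal nb₀ v e' = seeVal nb v e' := fun e' he' => by
      rw [seeVal, hoff e' he']; rfl
    obtain ⟨f1, f3⟩ := hf (seeVal nb₀ v) hoff' i2 i3 (neg_one_le_val _)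
    have hle : ∀ e', seeVal nb v e' - 1 ≤ seeVal nb₀ v e' ∧ seeVal nb₀ v e' ≤ seeVal nb v e' := by
      intro e'
      by_cases hh : e' = e
      · exact hh ▸ ⟨i2, i3⟩
      · rw [hoff' e' hh]; omega
    have hsee₀ := h3.see_some hT hq₀ hq1
    have hval₀ : seeVal nb₀ q d = max (seeVal nb₀ v d)
        (max (seeVal nb₀ v (d + 1) + 1) (seeVal nb₀ v (d + 3) + 1)) := by
      rw [seeVal, hsee₀, val_node]; rfl
    have l0 := hle d
    have l1 := hle (d + 1)
    have l3 := hle (d + 3)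
    refine ⟨?_, ?_, ?_⟩
    · rw [hsee₀]
      exact ⟨f1, f3, hsrt' _ sa, hsrt' _ sb, hsrt' _ sc⟩
    · rw [hval, hval₀]; omega
    · rw [hval, hval₀]; omega
  obtain ⟨-, m1, m3⟩ := zmod4_add_ne d
  have m13 : d + 1 ≠ d + 3 := (by decide : ∀ d : ZMod 4, d + 1 ≠ d + 3) d
  change seeVal nb v (d + 1) ≤ seeVal nb v d at hb
  change seeVal nb v (d + 3) ≤ seeVal nb v d at hc
  -- The sides come first, as their values may decrease freely. The branch ahead is used only if
  -- both sides are virtual, and its value is never below `-1`.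
  rcases h1 : nb v (d + 1) with _ | x
  · rcases h3 : nb v (d + 3) with _ | x
    · rcases h0 : nb v d with _ | x
      · refine absurd (fun e he => ?_) hleaf
        rcases zmod4_cases' d e with rfl | rfl | rfl | rfl
        · exact h0
        · exact h1
        · exact absurd rfl he
        · exact h3
      · refine key d x n0 h0 sa fun f hf f1 f2 f4 => ?_
        rw [hf _ m1, hf _ m3, hnn _ h1, hnn _ h3]
        exact ⟨f4, f4⟩
    · refine key _ x n3 h3 sc fun f hf f1 f2 f4 => ?_
      rw [hf _ m13, hf _ m3.symm]
      omega
  · refine key _ x n1 h1 sb fun f hf f1 f2 f4 => ?_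
    rw [hf _ m13.symm, hf _ m1.symm]
    omega

/-- A balanced system has a leaf whose removal leaves it balanced. -/
lemma DirSys.exists_balanced_removal (hT : T.IsTree) (hD : DirSys T S nb) (hS : PathClosed T S)
    (hb : ∀ v ∈ S, BalAt nb v) (hnt : S.Nontrivial) :
    ∃ r p e, r ∈ S ∧ nb r e = some p ∧ (∀ e', e' ≠ e → nb r e' = none) ∧
      ∀ S₀ nb₀, r ∉ S₀ → insert r S₀ = S → PathClosed T S₀ → DirSys T S₀ nb₀ →
        (∀ z ∈ S₀, ∀ e, ∀ y, nb₀ z e = some y → nb z e = some y) → ∀ v ∈ S₀, BalAt nb₀ v := by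
  have hA := hT.isAcyclic
  obtain ⟨c, hc, hlight⟩ := hD.exists_light hA hnt.nonempty
  have hsrt : ∀ d, Srt (see nb c d) := by
    intro d
    rcases hx : nb c d with _ | x
    · rw [see_none hx]; trivial
    · have := hD.subBal_of_balAt hA hb hc hx
      rw [hD.seeVal_back hA hc hx] at this
      exact this.srt (hlight d)
  have key : ∀ d x, nb c d = some x → (∀ f : ZMod 4 → ℤ, (∀ e, e ≠ d → f e = seeVal nb c e) →
      f d ≤ seeVal nb c d → -1 ≤ f d → LocBal (f 2) (f 0) (f 1) (f 3)) →
      ∃ r p e, r ∈ S ∧ nb r e = some p ∧ (∀ e', e' ≠ e → nb r e' = none) ∧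
      ∀ S₀ nb₀, r ∉ S₀ → insert r S₀ = S → PathClosed T S₀ → DirSys T S₀ nb₀ →
        (∀ z ∈ S₀, ∀ e, ∀ y, nb₀ z e = some y → nb z e = some y) → ∀ v ∈ S₀, BalAt nb₀ v := by
    intro d x hx hf
    obtain ⟨r, p, e, hr, he, he', hside, hrem⟩ := hD.exists_removable hA hc hx (hsrt d)
    refine ⟨r, p, e, hr, he, he', fun S₀ nb₀ h1 h2 hS₀ h3 h4 => ?_⟩
    have hcr : c ≠ r := fun h => not_side_self (h ▸ hside)
    have hc₀ : c ∈ S₀ := (h2 ▸ hc : c ∈ insert r S₀).resolve_left hcr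
    obtain ⟨i1, i2, i3⟩ := hrem S₀ nb₀ h1 h2 h3 h4
    subst h2
    have hoff : ∀ e', e' ≠ d → see nb₀ c e' = see nb c e' := fun e' he' =>
      h3.see_congr_off hA hD h4 h1 hc₀ fun y hy hys => he' (hD.inj hc hy
        (by rw [hx, Side.unique hA (hD.mem hc hy).2 (hD.mem hc hx).2 hys hside]))
    have hoff' : ∀ e', e' ≠ d → seeVal nb₀ c e' = seeVal nb c e' := fun e' he' => by
      rw [seeVal, hoff e' he']; rfl
    have hle : ∀ e', seeVal nb c e' - 1 ≤ seeVal nb₀ c e' ∧ seeVal nb₀ c e' ≤ seeVal nb c e' := by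
      intro e'
      by_cases hh : e' = d
      · exact hh ▸ ⟨i2, i3⟩
      · rw [hoff' e' hh]; omega
    refine h3.balAt_of_center hT hS₀ hc₀ (hf _ hoff' i3 (neg_one_le_val _)) fun e' => ?_
    have hs' : Srt (see nb₀ c e') := by
      by_cases hh : e' = d
      · exact hh ▸ i1
      · rw [hoff e' hh]; exact hsrt e'
    -- Back values have decreased by at most one, which is the slack in `Srt.subBal`.
    refine hs'.subBal ?_
    have l0 := hle e'
    have l1 := hle (e' + 1)
    have l2 := hle (e' + 2)
    have l3 := hle (e' + 3)
    have := hlight e'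
    change seeVal nb₀ c e' ≤ _
    unfold upVal at this ⊢
    omega
  have hloc := locBal_iff_exists.1 (hb c hc)
  obtain ⟨d, g1, g2, g3, g4⟩ := hloc
  obtain ⟨m2, m1, m3⟩ := zmod4_add_ne d
  have hbal : ∀ f : ZMod 4 → ℤ, f (d + 1) ≤ f d → f (d + 1) ≤ f (d + 2) → f (d + 3) ≤ f d →
      f (d + 3) ≤ f (d + 2) → LocBal (f 2) (f 0) (f 1) (f 3) :=
    fun f h1 h2 h3 h4 => locBal_iff_exists.2 ⟨d, h1, h2, h3, h4⟩
  obtain ⟨-, k1, k3⟩ := zmod4_turn_ne d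
  have k13 : d + 1 ≠ d + 3 := (by decide : ∀ d : ZMod 4, d + 1 ≠ d + 3) d
  have hnn : ∀ e, nb c e = none → seeVal nb c e = -1 := fun e he => by
    rw [seeVal, see_none he, val_nil]
  have hlow : ∀ e, -1 ≤ seeVal nb c e := fun e => neg_one_le_val _
  -- The leaf is taken from the dominated pair of branches. If both of these are virtual, any branch
  -- will do, since `-1` is dominated by everything.
  rcases h1 : nb c (d + 1) with _ | x
  · rcases h3 : nb c (d + 3) with _ | x
    · have e1 := hnn _ h1
      have e3 := hnn _ h3
      rcases h0 : nb c d with _ | x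
      · rcases h2 : nb c (d + 2) with _ | x
        · obtain ⟨y, hy, hyc⟩ := hnt.exists_ne c
          obtain ⟨w, hw, hs⟩ := exists_side hT hyc
          obtain ⟨e, he⟩ := hD.surj hc (hS.side_mem hc hy hw hs) hw
          rcases zmod4_cases' d e with rfl | rfl | rfl | rfl <;> simp_all
        · refine key _ x h2 fun f hf f1 f2 => hbal f ?_ ?_ ?_ ?_ <;>
            simp only [hf _ k1, hf _ k3, hf _ m2.symm] <;> have := hlow d <;> omega
      · refine key _ x h0 fun f hf f1 f2 => hbal f ?_ ?_ ?_ ?_ <;>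
          simp only [hf _ m1, hf _ m3, hf _ m2] <;> have := hlow (d + 2) <;> omega
    · refine key _ x h3 fun f hf f1 f2 => hbal f ?_ ?_ ?_ ?_ <;>
        simp only [hf _ k13, hf _ m3.symm, hf _ k3.symm] <;> omega
  · refine key _ x h1 fun f hf f1 f2 => hbal f ?_ ?_ ?_ ?_ <;>
      simp only [hf _ k13.symm, hf _ m1.symm, hf _ k1.symm] <;> omega

/-- Every balanced model is the result of an execution of the algorithm. -/
theorem exists_produces_of_balAt (hT : T.IsTree) (n : ℕ) : ∀ {S : Set V}, S.ncard = n + 1 →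
    PathClosed T S → IsSModel T S M → (∀ v ∈ S, BalAt (nbAt T S M) v) →
    ∃ v₀ l, IsAdditionSeq T v₀ l ∧ addedVertices v₀ l = S ∧ Produces T v₀ l M := by
  induction n with
  | zero =>
    intro S hn hS hM hb
    obtain ⟨v, rfl⟩ := Set.ncard_eq_one.1 hn
    exact ⟨v, [], .nil, addedVertices_nil v, .start M⟩
  | succ n ih =>
    intro S hn hS hM hb
    have hnt : S.Nontrivial := (Set.one_lt_ncard_iff_nontrivial (s := S)).1 (by omega)
    obtain ⟨r, p, e, hr, he, he', hrem⟩ := hM.dirSys.exists_balanced_removal hT hS hb hnt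
    obtain ⟨hpS, hrp⟩ := hM.dirSys.mem hr he
    have hins : insert r (S \ {r}) = S := by
      rw [Set.insert_sdiff_singleton, Set.insert_eq_of_mem hr]
    have hr₀ : r ∉ S \ {r} := fun h => h.2 rfl
    have hp₀ : p ∈ S \ {r} := ⟨hpS, hrp.ne'⟩
    have honly : ∀ q ∈ S \ {r}, T.Adj r q → q = p := by
      intro q hq hrq
      obtain ⟨g, hg⟩ := hM.dirSys.surj hr hq.1 hrq
      by_cases hge : g = e
      · rw [hge, he] at hg
        exact (Option.some.inj hg).symm
      · rw [he' g hge] at hg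
        cases hg
    have hS₀ : PathClosed T (S \ {r}) :=
      PathClosed.of_insert_leaf hT hr₀ (hins.symm ▸ hS) honly
    have hM₀ := hM.mono (S' := S \ {r}) Set.sdiff_subset
    have hb₀ := hrem (S \ {r}) (nbAt T (S \ {r}) M) hr₀ hins hS₀ hM₀.dirSys fun z hz g y hy => by
      obtain ⟨h1, h2, h3⟩ := nbAt_spec hy
      exact hM.nbAt_eq hz.1 h1.1 h2 h3
    obtain ⟨v₀, l, hl, hadd, hprod⟩ := ih (by
      rw [Set.ncard_sdiff_singleton_of_mem hr, hn]; rfl) hS₀ hM₀ hb₀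
    have hadd' : addedVertices v₀ ((r, p) :: l) = S := by rw [addedVertices_cons, hadd, hins]
    refine ⟨v₀, (r, p) :: l, .cons hl (hadd ▸ hr₀) fun q => ?_, hadd', ?_⟩
    · rw [hadd]
      exact ⟨fun h => honly q h.1 h.2, fun h => h ▸ ⟨hp₀, hrp⟩⟩
    -- The leaf is attached where it is in `M`. All vertices are balanced there, so every balance
    -- step of the call keeps `M`.
    · obtain ⟨M', h1, rfl⟩ := exists_balanceCalls (P := (· = M)) hT hM (fun v hv M' hM' =>
        ⟨M', Or.inl ⟨by subst hM'; exact (hM.balanced_iff hT.isAcyclic hS hv).2 (hb v hv), rfl⟩,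
          hM'⟩) hr hpS hrp rfl
      refine .add hprod (M₁ := M') ?_ ?_
      · rw [hadd]
        exact ⟨hins.symm ▸ hM, fun _ _ _ _ _ => rfl⟩
      · rw [hadd, hins]
        exact h1

end removal
end StraightModel

namespace StraightModel

open BTree

/-! ### Removal of leaves in the order of their values, and the balanced drawing that it defines. -/

section peeling

variable {V : Type*} {T : SimpleGraph V}

open Classical in
/-- The times before `t` at which `v` occurs in the sequence `p`, latest first. -/
noncomputable def kids (p : ℕ → V) : ℕ → V → List ℕ
  | 0, _ => []
  | t + 1, v => if p t = v then t :: kids p t v else kids p t v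

lemma kids_congr {p p' : ℕ → V} {t : ℕ} (h : ∀ s < t, p' s = p s) (v : V) :
    kids p' t v = kids p t v := by
  induction t with
  | zero => rfl
  | succ t ih =>
    simp only [kids]
    rw [ih fun s hs => h s (by omega), h t (by omega)]

lemma kids_succ_self (p : ℕ → V) (t : ℕ) : kids p (t + 1) (p t) = t :: kids p t (p t) := by
  simp [kids]

lemma kids_succ_of_ne {p : ℕ → V} {t : ℕ} {v : V} (h : p t ≠ v) :
    kids p (t + 1) v = kids p t v := by
  simp [kids, h]

lemma mem_kids {p : ℕ → V} {t s : ℕ} {v : V} : s ∈ kids p t v ↔ s < t ∧ p s = v := by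
  induction t with
  | zero => simp [kids]
  | succ t ih =>
    by_cases h : p t = v
    · subst h
      rw [kids_succ_self, List.mem_cons, ih]
      constructor
      · rintro (rfl | h)
        · exact ⟨by omega, rfl⟩
        · exact ⟨by omega, h.2⟩
      · rintro ⟨h1, h2⟩
        by_cases hs : s = t
        · exact Or.inl hs
        · exact Or.inr ⟨by omega, h2⟩
    · rw [kids_succ_of_ne h, ih]
      refine ⟨fun hh => ⟨by omega, hh.2⟩, fun hh => ⟨?_, hh.2⟩⟩
      have : s ≠ t := fun e => h (e ▸ hh.2)
      omega

lemma kids_eq_of_le {p : ℕ → V} {t N : ℕ} {v : V} (htN : t ≤ N)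
    (h : ∀ s < N, t ≤ s → p s ≠ v) : kids p N v = kids p t v := by
  induction N, htN using Nat.le_induction with
  | base => rfl
  | succ N hN ih =>
    rw [kids_succ_of_ne (h N (by omega) hN), ih fun s hs => h s (by omega)]

lemma kids_length_mono (p : ℕ → V) {t t' : ℕ} (h : t ≤ t') (v : V) :
    (kids p t v).length ≤ (kids p t' v).length := by
  induction t', h using Nat.le_induction with
  | base => exact le_rfl
  | succ N hN ih =>
    refine ih.trans ?_
    by_cases hp : p N = v
    · subst hp
      rw [kids_succ_self, List.length_cons]
      omega
    · rw [kids_succ_of_ne hp]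

lemma kids_pairwise (p : ℕ → V) (t : ℕ) (v : V) : (kids p t v).Pairwise (· > ·) := by
  induction t with
  | zero => exact List.Pairwise.nil
  | succ t ih =>
    by_cases h : p t = v
    · subst h
      rw [kids_succ_self]
      exact List.pairwise_cons.2 ⟨fun s hs => (mem_kids.1 hs).1, ih⟩
    · rwa [kids_succ_of_ne h]

/-- The index `i` is the number of children removed after `a`; together with the parent slot, this
gives `slotNo`. -/
lemma kids_getElem? {p : ℕ → V} {N i a : ℕ} {v : V} (h : (kids p N v)[i]? = some a) :
    a < N ∧ p a = v ∧ (kids p (a + 1) v).length + i = (kids p N v).length := by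
  induction N generalizing i with
  | zero => simp [kids] at h
  | succ N ih =>
    by_cases hp : p N = v
    · subst hp
      rw [kids_succ_self] at h ⊢
      cases i with
      | zero =>
        cases h
        rw [kids_succ_self]
        exact ⟨by omega, rfl, rfl⟩
      | succ i =>
        rw [List.getElem?_cons_succ] at h
        obtain ⟨h1, h2, h3⟩ := ih h
        exact ⟨by omega, h2, by rw [List.length_cons]; omega⟩
    · rw [kids_succ_of_ne hp] at h ⊢
      obtain ⟨h1, h2, h3⟩ := ih h
      exact ⟨by omega, h2, h3⟩

/-- The value of a vertex in terms of the values of its children, latest first. -/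
def candVal (x : ℕ → ℕ) : List ℕ → ℕ
  | [] => 0
  | [a] => x a
  | a :: b :: _ => max (x a) (x b + 1)

/-- The value of the `i`-th child. -/
def kidVal (x : ℕ → ℕ) (l : List ℕ) (i : ℕ) : ℤ := (l[i]?).elim (-1) fun a => (x a : ℤ)

/-- When values do not decrease with the time of removal, the latest child has the largest value and
goes straight ahead; among the others, which cost a bend, only the second matters. The value `-1` of
a missing child covers the short lists. -/
lemma candVal_eq (x : ℕ → ℕ) (l : List ℕ) :
    (candVal x l : ℤ) = max (kidVal x l 0) (kidVal x l 1 + 1) := by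
  match l with
  | [] => rfl
  | [a] => simp [candVal, kidVal]
  | a :: b :: l => simp [candVal, kidVal]

/-- The leaf `r s` with the neighbour `p s` and the value `x s` is removed at time `s < t`, the
values being minimal. -/
structure Peel (T : SimpleGraph V) (r p : ℕ → V) (x : ℕ → ℕ) (t : ℕ) : Prop where
  adj : ∀ s < t, T.Adj (r s) (p s)
  inj : ∀ s < t, ∀ s' < s, r s ≠ r s'
  alive : ∀ s < t, ∀ s' < s, p s ≠ r s'
  uniq : ∀ s < t, ∀ q, T.Adj (r s) q → (∀ s' < s, q ≠ r s') → q = p s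
  mono : ∀ s < t, ∀ s' < s, x s' ≤ x s
  val : ∀ s < t, x s = candVal x (kids p s (r s))
  -- The hypothesis says that `p s` is a leaf as well, so that both ends of the last edge compete;
  -- the one with the smaller value is removed.
  min : ∀ s < t, (∀ q, T.Adj (p s) q → (∀ s' < s, q ≠ r s') → q = r s) →
    x s ≤ candVal x (kids p s (p s))

lemma candVal_congr {x x' : ℕ → ℕ} {l : List ℕ} (h : ∀ a ∈ l, x' a = x a) :
    candVal x' l = candVal x l := by
  match l with
  | [] => rfl
  | [a] => exact h a (by simp)
  | a :: b :: l =>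
    simp only [candVal]
    rw [h a (by simp), h b (by simp)]

lemma Peel.congr {r p r' p' : ℕ → V} {x x' : ℕ → ℕ} {t : ℕ} (h : Peel T r p x t)
    (hr : ∀ s < t, r' s = r s) (hp : ∀ s < t, p' s = p s) (hx : ∀ s < t, x' s = x s) :
    Peel T r' p' x' t := by
  have hcand : ∀ s < t, ∀ v, candVal x' (kids p' s v) = candVal x (kids p s v) := by
    intro s hs v
    rw [kids_congr fun s' hs' => hp s' (hs'.trans hs)]
    exact candVal_congr fun a ha => hx a ((mem_kids.1 ha).1.trans hs)
  have hr' : ∀ {s q}, s < t → (∀ s' < s, q ≠ r' s') → ∀ s' < s, q ≠ r s' :=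
    fun hs hq s' hs' => hr s' (hs'.trans hs) ▸ hq s' hs'
  constructor
  · intro s hs; rw [hr s hs, hp s hs]; exact h.adj s hs
  · intro s hs s' hs'; rw [hr s hs, hr s' (hs'.trans hs)]; exact h.inj s hs s' hs'
  · intro s hs s' hs'; rw [hp s hs, hr s' (hs'.trans hs)]; exact h.alive s hs s' hs'
  · intro s hs q; rw [hr s hs, hp s hs]; exact fun h1 h2 => h.uniq s hs q h1 (hr' hs h2)
  · intro s hs s' hs'; rw [hx s hs, hx s' (hs'.trans hs)]; exact h.mono s hs s' hs'
  · intro s hs; rw [hx s hs, hr s hs, hcand s hs]; exact h.val s hs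
  · intro s hs; rw [hx s hs, hp s hs, hcand s hs, hr s hs]
    exact fun hq => h.min s hs fun q hpq hq' =>
      hq q hpq fun s' hs' => by rw [hr s' (hs'.trans hs)]; exact hq' s' hs'

lemma Peel.succ {r p : ℕ → V} {x : ℕ → ℕ} {t : ℕ} (h : Peel T r p x t)
    (adj : T.Adj (r t) (p t)) (inj : ∀ s < t, r t ≠ r s) (alive : ∀ s < t, p t ≠ r s)
    (uniq : ∀ q, T.Adj (r t) q → (∀ s < t, q ≠ r s) → q = p t) (mono : ∀ s < t, x s ≤ x t)
    (val : x t = candVal x (kids p t (r t)))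
    (min : (∀ q, T.Adj (p t) q → (∀ s < t, q ≠ r s) → q = r t) →
      x t ≤ candVal x (kids p t (p t))) : Peel T r p x (t + 1) := by
  constructor <;> intro s hs <;> rcases Nat.lt_succ_iff_lt_or_eq.1 hs with hs | rfl
  exacts [h.adj s hs, adj, h.inj s hs, inj, h.alive s hs, alive, h.uniq s hs, uniq, h.mono s hs,
    mono, h.val s hs, val, h.min s hs, min]

/-- The order in which the slots of a vertex are filled. -/
def slotOf : ℕ → ZMod 4
  -- The slots filled first, `0` and `2`, are opposite. At vertices other than `c`, slot `0` belongs
  -- to the parent, so the first child is straight ahead.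
  | 0 => 0
  | 1 => 2
  | 2 => 3
  | _ => 1

lemma slotOf_inj {i j : ℕ} (hi : i ≤ 3) (hj : j ≤ 3) (h : slotOf i = slotOf j) : i = j := by
  interval_cases i <;> interval_cases j <;> first | rfl | exact absurd h (by decide)

open Classical in
/-- The number of slots at `p t` that are filled before `r t` is inserted, when the vertices are
inserted in the reverse order of their removal. -/
noncomputable def slotNo (p : ℕ → V) (N : ℕ) (c : V) (t : ℕ) : ℕ :=
  (kids p N (p t)).length - (kids p (t + 1) (p t)).length + if p t = c then 0 else 1

/-- All vertices but `c` are removed before time `N`. -/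
structure Peel.Complete (r : ℕ → V) (c : V) (N : ℕ) : Prop where
  all : ∀ v, v = c ∨ ∃ t < N, r t = v
  ne : ∀ t < N, r t ≠ c

variable {r p : ℕ → V} {x : ℕ → ℕ} {N : ℕ} {c : V}

/-- The end of the edge that is removed first has the other end as its only remaining neighbour. -/
lemma Peel.edge (h : Peel T r p x N) (hc : Peel.Complete r c N) {v y : V} (hvy : T.Adj v y) :
    (∃ t < N, v = r t ∧ y = p t) ∨ ∃ t < N, y = r t ∧ v = p t := by
  have key : ∀ {v y}, T.Adj v y → ∀ t < N, v = r t → (y = c ∨ ∃ t', t < t' ∧ t' < N ∧ y = r t') →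
      y = p t := by
    rintro v y hvy t ht rfl hy
    refine h.uniq t ht y hvy fun s hs => ?_
    rcases hy with rfl | ⟨t', h1, h2, rfl⟩
    · exact (hc.ne s (hs.trans ht)).symm
    · exact h.inj t' h2 s (hs.trans h1)
  rcases hc.all v with hv | ⟨t, ht, rfl⟩ <;> rcases hc.all y with hy | ⟨t', ht', rfl⟩
  · exact absurd (hv.trans hy.symm) hvy.ne
  · exact Or.inr ⟨t', ht', rfl, key hvy.symm t' ht' rfl (Or.inl hv)⟩
  · exact Or.inl ⟨t, ht, rfl, key hvy t ht rfl (Or.inl hy)⟩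
  · rcases lt_trichotomy t t' with hlt | rfl | hlt
    · exact Or.inl ⟨t, ht, rfl, key hvy t ht rfl (Or.inr ⟨t', hlt, ht', rfl⟩)⟩
    · exact absurd rfl hvy.ne
    · exact Or.inr ⟨t', ht', rfl, key hvy.symm t' ht' rfl (Or.inr ⟨t, hlt, ht, rfl⟩)⟩

lemma Peel.inj' (h : Peel T r p x N) {s t : ℕ} (hs : s < N) (ht : t < N) (hst : r s = r t) :
    s = t := by
  rcases lt_trichotomy s t with hlt | rfl | hlt
  · exact absurd hst.symm (h.inj t ht s hlt)
  · rfl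
  · exact absurd hst (h.inj s hs t hlt)

lemma Peel.kids_eq (h : Peel T r p x N) {t : ℕ} (ht : t < N) : kids p N (r t) = kids p t (r t) := by
  refine kids_eq_of_le ht.le fun s hs hts hp => ?_
  rcases hts.eq_or_lt with rfl | hts
  · exact (h.adj _ hs).ne hp.symm
  · exact h.alive s hs t hts hp

/-- The children are distinct neighbours, and at vertices other than `c` the parent is one more. -/
lemma Peel.kids_length [Finite V] [DecidableEq V] (h : Peel T r p x N) (hc : Peel.Complete r c N)
    (hdeg : ∀ v, (T.neighborSet v).ncard ≤ 4) (v : V) :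
    (kids p N v).length + (if v = c then 0 else 1) ≤ 4 := by
  have hinj : Set.InjOn r {s | s ∈ kids p N v} := fun a ha b hb hab =>
    h.inj' (mem_kids.1 ha).1 (mem_kids.1 hb).1 hab
  have hnd : (kids p N v).Nodup := (kids_pairwise p N v).imp fun h => h.ne'
  have hcard : (r '' {s | s ∈ kids p N v}).ncard = (kids p N v).length := by
    rw [hinj.ncard_image, ← List.toFinset_card_of_nodup hnd, ← Set.ncard_coe_finset]
    congr 1
    ext; simp
  have hsub : r '' {s | s ∈ kids p N v} ⊆ T.neighborSet v := by
    rintro _ ⟨s, hs, rfl⟩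
    obtain ⟨h1, rfl⟩ := mem_kids.1 hs
    exact (h.adj s h1).symm
  by_cases hv : v = c
  · rw [if_pos hv, add_zero, ← hcard]
    exact (Set.ncard_le_ncard hsub (Set.toFinite _)).trans (hdeg v)
  · rw [if_neg hv]
    obtain ⟨t, ht, rfl⟩ := (hc.all v).resolve_left hv
    have hnot : p t ∉ r '' {s | s ∈ kids p N (r t)} := by
      rintro ⟨s, hs, hst⟩
      rw [Set.mem_ofPred_eq, h.kids_eq ht] at hs
      exact h.alive t ht s (mem_kids.1 hs).1 hst.symm
    have hsub' : insert (p t) (r '' {s | s ∈ kids p N (r t)}) ⊆ T.neighborSet (r t) :=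
      Set.insert_subset (h.adj t ht) hsub
    have := (Set.ncard_le_ncard hsub' (Set.toFinite _)).trans (hdeg (r t))
    rwa [Set.ncard_insert_of_notMem hnot (Set.toFinite _), hcard] at this

lemma Peel.slotNo_le [Finite V] (h : Peel T r p x N) (hc : Peel.Complete r c N)
    (hdeg : ∀ v, (T.neighborSet v).ncard ≤ 4) {t : ℕ} (ht : t < N) : slotNo p N c t ≤ 3 := by
  classical
  have h1 := h.kids_length hc hdeg (p t)
  have h2 := kids_length_mono p ht (p t)
  rw [slotNo]
  rw [kids_succ_self, List.length_cons] at h2 ⊢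
  split_ifs at h1 ⊢ <;> omega

/-- The directions in which the vertices are inserted. -/
structure Drawn (nb : V → ZMod 4 → Option V) (r p : ℕ → V) (N : ℕ) (c : V) (base : V → ZMod 4) :
    Prop where
  slot : ∀ t < N, nb (p t) (base (p t) + slotOf (slotNo p N c t)) = some (r t)
  base : ∀ t < N, base (r t) = base (p t) + slotOf (slotNo p N c t) + 2

variable {nb : V → ZMod 4 → Option V} {base : V → ZMod 4}

lemma Drawn.slot_some [DecidableEq V] (hd : Drawn nb r p N c base) {v : V} {i a : ℕ}
    (hi : (kids p N v)[i]? = some a) : slotNo p N c a = i + (if v = c then 0 else 1) ∧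
      nb v (base v + slotOf (i + (if v = c then 0 else 1))) = some (r a) := by
  obtain ⟨h1, rfl, h3⟩ := kids_getElem? hi
  have : slotNo p N c a = i + (if p a = c then 0 else 1) := by
    rw [slotNo]
    split_ifs <;> omega
  exact ⟨this, this ▸ hd.slot a h1⟩

/-- A neighbour in this direction would be the parent, which is in slot `0`, or a child, which is in
the slot given by its own index; different numbers give different slots. -/
lemma Drawn.slot_none [Finite V] [DecidableEq V] (h : Peel T r p x N) (hc : Peel.Complete r c N)
    (hdeg : ∀ v, (T.neighborSet v).ncard ≤ 4) (hD : DirSys T Set.univ nb)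
    (hd : Drawn nb r p N c base) {v : V} {i : ℕ} (hi : (kids p N v)[i]? = none)
    (hi3 : i + (if v = c then 0 else 1) ≤ 3) :
    nb v (base v + slotOf (i + (if v = c then 0 else 1))) = none := by
  rcases hx : nb v (base v + slotOf (i + (if v = c then 0 else 1))) with _ | y
  · rfl
  exfalso
  have hvy := (hD.mem (Set.mem_univ v) hx).2
  rcases h.edge hc hvy with ⟨t, ht, rfl, rfl⟩ | ⟨t, ht, rfl, rfl⟩
  · have h1 := hD.opp (Set.mem_univ _) (hd.slot t ht)
    rw [← hd.base t ht] at h1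
    have h2 := hD.inj (Set.mem_univ _) h1 hx
    have h3 : slotOf (i + (if r t = c then 0 else 1)) = slotOf 0 := by
      rw [← add_zero (base (r t)), add_assoc] at h2
      have := add_left_cancel h2
      rw [zero_add] at this
      exact this.symm
    have := slotOf_inj hi3 (by omega) h3
    rw [if_neg (hc.ne t ht)] at this
    omega
  · obtain ⟨j, hj⟩ := List.getElem?_of_mem (mem_kids.2 ⟨ht, rfl⟩ : t ∈ kids p N (p t))
    obtain ⟨h1, h2⟩ := hd.slot_some hj
    have h3 := add_left_cancel (hD.inj (Set.mem_univ _) h2 hx)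
    have h4 := slotOf_inj (h1 ▸ h.slotNo_le hc hdeg ht) hi3 h3
    have : j = i := by omega
    rw [this, hi] at hj
    cases hj

lemma Peel.kidVal_anti (h : Peel T r p x N) (v : V) (i : ℕ) :
    kidVal x (kids p N v) (i + 1) ≤ kidVal x (kids p N v) i := by
  unfold kidVal
  rcases h1 : (kids p N v)[i + 1]? with _ | b
  · rcases h0 : (kids p N v)[i]? with _ | a
    · exact le_rfl
    · simp only [Option.elim]; omega
  · obtain ⟨hb, hb'⟩ := List.getElem?_eq_some_iff.1 h1
    rw [List.getElem?_eq_getElem (by omega)]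
    have hlt := List.pairwise_iff_getElem.1 (kids_pairwise p N v) i (i + 1) (by omega) hb (by omega)
    rw [hb'] at hlt
    have := (mem_kids.1 (List.getElem_mem (by omega : i < (kids p N v).length))).1
    exact Int.ofNat_le.2 (h.mono _ this b hlt)

/-- The drawing in which the vertices are inserted in the reverse order of their removal is
balanced. -/
theorem Drawn.balAt [Finite V] (hT : T.IsTree) (hdeg : ∀ v, (T.neighborSet v).ncard ≤ 4)
    (h : Peel T r p x N) (hc : Peel.Complete r c N) (hD : DirSys T Set.univ nb)
    (hd : Drawn nb r p N c base) : ∀ v ∈ (Set.univ : Set V), BalAt nb v := by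
  classical
  have hA := hT.isAcyclic
  have hU := fun v : V => Set.mem_univ v
  have arm : ∀ v, (∀ s < N, p s = v →
      Srt (see nb v (base v + slotOf (slotNo p N c s))) ∧
        seeVal nb v (base v + slotOf (slotNo p N c s)) = x s) →
      ∀ i, i + (if v = c then 0 else 1) ≤ 3 →
        Srt (see nb v (base v + slotOf (i + (if v = c then 0 else 1)))) ∧
          seeVal nb v (base v + slotOf (i + (if v = c then 0 else 1))) =
            kidVal x (kids p N v) i := by
    intro v hv i hi
    rcases hk : (kids p N v)[i]? with _ | a
    · rw [seeVal, see_none (Drawn.slot_none h hc hdeg hD hd hk hi), kidVal, hk]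
      exact ⟨trivial, rfl⟩
    · obtain ⟨h1, h2, -⟩ := kids_getElem? hk
      have := hv a h1 h2
      rw [(hd.slot_some hk).1] at this
      rwa [kidVal, hk]
  -- Children are removed before their parent, so induction on the time of removal applies. The
  -- order of the removals makes the children at a vertex sorted.
  have key : ∀ t < N, Srt (see nb (p t) (base (p t) + slotOf (slotNo p N c t))) ∧
      seeVal nb (p t) (base (p t) + slotOf (slotNo p N c t)) = x t := by
    intro t
    induction t using Nat.strong_induction_on with
    | _ t ih =>
      intro ht
      have hlt : ∀ s < N, p s = r t → s < t := by
        intro s hs hst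
        have := mem_kids.2 ⟨hs, hst⟩
        rw [h.kids_eq ht] at this
        exact (mem_kids.1 this).1
      have harm := arm (r t) fun s hs hst => hst ▸ ih s (hlt s hs hst) hs
      rw [if_neg (hc.ne t ht), hd.base t ht] at harm
      have hslot := hd.slot t ht
      set d := base (p t) + slotOf (slotNo p N c t)
      obtain ⟨a1, a2⟩ := harm 0 (by omega)
      obtain ⟨b1, b2⟩ := harm 1 (by omega)
      obtain ⟨c1, c2⟩ := harm 2 (by omega)
      have e0 : d + 2 + slotOf (0 + 1) = d := zmod4_add_two_two d
      have e1 : d + 2 + slotOf (1 + 1) = d + 1 := by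
        rw [add_assoc]; rfl
      have e2 : d + 2 + slotOf (2 + 1) = d + 3 := by
        rw [add_assoc]; rfl
      rw [e0] at a1 a2
      rw [e1] at b1 b2
      rw [e2] at c1 c2
      have k0 := h.kidVal_anti (r t) 0
      have k1 := h.kidVal_anti (r t) 1
      have hx : (x t : ℤ) = _ := congrArg _ (h.val t ht)
      rw [← h.kids_eq ht, candVal_eq] at hx
      simp only [zero_add, one_add_one_eq_two] at k0 k1
      rw [seeVal, hD.see_some hA (hU _) hslot, val_node]
      change _ ∧ max (seeVal nb (r t) d)
        (max (seeVal nb (r t) (d + 1) + 1) (seeVal nb (r t) (d + 3) + 1)) = _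
      refine ⟨⟨?_, ?_, a1, b1, c1⟩, ?_⟩
      · change seeVal nb (r t) (d + 1) ≤ seeVal nb (r t) d
        omega
      · change seeVal nb (r t) (d + 3) ≤ seeVal nb (r t) d
        omega
      · omega
  have harm := arm c fun s hs hst => hst ▸ key s hs
  simp only [if_true, add_zero] at harm
  obtain ⟨a1, a2⟩ := harm 0 (by omega)
  obtain ⟨b1, b2⟩ := harm 1 (by omega)
  obtain ⟨c1, c2⟩ := harm 2 (by omega)
  obtain ⟨d1, d2⟩ := harm 3 (by omega)
  set b := base c
  simp only [slotOf, add_zero] at a1 a2 b1 b2 c1 c2 d1 d2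
  have k0 := h.kidVal_anti c 0
  have k1 := h.kidVal_anti c 1
  have k2 := h.kidVal_anti c 2
  simp only [zero_add, Nat.reduceAdd] at k0 k1 k2
  -- The last leaf removed hangs at `c`. By `min` its value is at most the value that the other
  -- branches give to `c`, so even the largest branch at `c` is light.
  have hlast : kidVal x (kids p N c) 0 ≤
      max (kidVal x (kids p N c) 1) (kidVal x (kids p N c) 2 + 1) := by
    cases N with
    | zero => simp [kids, kidVal]
    | succ N =>
      have hpc : p N = c := by
        refine (hc.all (p N)).resolve_right ?_
        rintro ⟨t, ht, hpt⟩
        rcases Nat.lt_succ_iff_lt_or_eq.1 ht with ht | rfl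
        · exact h.alive N (by omega) t ht hpt.symm
        · exact (h.adj t (by omega)).ne hpt
      have h1 := h.min N (by omega) fun q hq hq' => by
        rw [hpc] at hq
        obtain ⟨t, ht, rfl⟩ := (hc.all q).resolve_left hq.ne'
        rcases Nat.lt_succ_iff_lt_or_eq.1 ht with ht | rfl
        · exact absurd rfl (hq' t ht)
        · rfl
      have h2 : (x N : ℤ) ≤ _ := Int.ofNat_le.2 h1
      rw [candVal_eq] at h2
      rw [← hpc, kids_succ_self]
      exact h2
  refine hD.balAt_of_center hT pathClosed_univ (hU c) ?_ fun e => ?_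
  · rw [balAt_iff b]
    exact Or.inl ⟨by omega, by omega, by omega, by omega⟩
  · obtain ⟨u0, u1, u3⟩ := upVal_turns (seeVal nb c) b
    rcases zmod4_cases' b e with rfl | rfl | rfl | rfl
    · refine a1.subBal ?_
      change seeVal nb c b ≤ _
      rw [u0]; omega
    · refine d1.subBal ?_
      change seeVal nb c (b + 1) ≤ _
      rw [u1]; omega
    · refine b1.subBal ?_
      change seeVal nb c (b + 2) ≤ _
      have : seeVal nb c (b + 2 + 2) ≤ upVal (seeVal nb c) (b + 2) := le_max_left _ _
      rw [zmod4_add_two_two] at this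
      omega
    · refine c1.subBal ?_
      change seeVal nb c (b + 3) ≤ _
      rw [u3]; omega

end peeling
end StraightModel

namespace StraightModel

/-! ### Reinsertion of the removed vertices. -/

section drawing

variable {V : Type*} {T : SimpleGraph V} {r p : ℕ → V} {x : ℕ → ℕ} {N : ℕ} {c : V}
  {M M' : V → GridPoint} {base base' : V → ZMod 4}

/-- The vertices that are not removed before time `t`. -/
def aliveAt (r : ℕ → V) (t : ℕ) : Set V := {v | ∀ s < t, v ≠ r s}

lemma aliveAt_zero : aliveAt r 0 = Set.univ :=
  Set.eq_univ_of_forall fun _ _ hs => absurd hs (Nat.not_lt_zero _)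

lemma mem_aliveAt_succ {t : ℕ} {v : V} : v ∈ aliveAt r (t + 1) ↔ v ∈ aliveAt r t ∧ v ≠ r t := by
  constructor
  · exact fun h => ⟨fun s hs => h s (by omega), h t (by omega)⟩
  · rintro ⟨h1, h2⟩ s hs
    rcases Nat.lt_succ_iff_lt_or_eq.1 hs with hs | rfl
    exacts [h1 s hs, h2]

lemma Peel.insert_aliveAt (h : Peel T r p x N) {t : ℕ} (ht : t < N) :
    insert (r t) (aliveAt r (t + 1)) = aliveAt r t := by
  ext v
  rw [Set.mem_insert_iff, mem_aliveAt_succ]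
  constructor
  · rintro (rfl | h')
    · exact fun s hs => h.inj t ht s hs
    · exact h'.1
  · intro hv
    by_cases hvr : v = r t
    · exact Or.inl hvr
    · exact Or.inr ⟨hv, hvr⟩

lemma Peel.Complete.aliveAt_eq (hc : Peel.Complete r c N) : aliveAt r N = {c} := by
  ext v
  rw [Set.mem_singleton_iff]
  constructor
  · intro hv
    refine (hc.all v).resolve_right ?_
    rintro ⟨t, ht, rfl⟩
    exact hv t ht rfl
  · rintro rfl s hs
    exact (hc.ne s hs).symm

lemma Peel.parent_mem (h : Peel T r p x N) {t : ℕ} (ht : t < N) : p t ∈ aliveAt r (t + 1) :=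
  mem_aliveAt_succ.2 ⟨h.alive t ht, (h.adj t ht).ne'⟩

open Classical in
/-- The number of filled slots at `v` when the vertices `r s`, `s ≥ t`, have been inserted. -/
noncomputable def slotCnt (p : ℕ → V) (N : ℕ) (c : V) (t : ℕ) (v : V) : ℕ :=
  (kids p N v).length - (kids p t v).length + if v = c then 0 else 1

lemma slotNo_eq (t : ℕ) : slotNo p N c t = slotCnt p N c (t + 1) (p t) := rfl

lemma slotCnt_last : slotCnt p N c N c = 0 := by simp [slotCnt]

lemma slotCnt_parent {t : ℕ} (ht : t < N) :
    slotCnt p N c t (p t) = slotCnt p N c (t + 1) (p t) + 1 := by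
  have := kids_length_mono p ht (p t)
  unfold slotCnt
  rw [kids_succ_self, List.length_cons] at this ⊢
  omega

lemma slotCnt_of_ne {t : ℕ} {v : V} (h : v ≠ p t) : slotCnt p N c t v = slotCnt p N c (t + 1) v := by
  rw [slotCnt, slotCnt, kids_succ_of_ne h.symm]

lemma Peel.slotCnt_new (h : Peel T r p x N) (hc : Peel.Complete r c N) {t : ℕ} (ht : t < N) :
    slotCnt p N c t (r t) = 1 := by
  rw [slotCnt, h.kids_eq ht, Nat.sub_self, if_neg (hc.ne t ht)]

/-- `M` draws the vertices `r s`, `t ≤ s < N`, and `c`, in the directions given by `base`. -/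
structure Drawing (T : SimpleGraph V) (r p : ℕ → V) (N : ℕ) (c : V) (t : ℕ) (M : V → GridPoint)
    (base : V → ZMod 4) : Prop where
  model : IsSModel T (aliveAt r t) M
  dir : ∀ s, t ≤ s → s < N →
    direction (M (p s)) (M (r s)) = uvec (base (p s) + slotOf (slotNo p N c s))
  base : ∀ s, t ≤ s → s < N → base (r s) = base (p s) + slotOf (slotNo p N c s) + 2

lemma Peel.Complete.drawing (hc : Peel.Complete r c N) : Drawing T r p N c N M base := by
  refine ⟨?_, fun s h1 h2 => absurd h1 (by omega), fun s h1 h2 => absurd h1 (by omega)⟩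
  rw [hc.aliveAt_eq]
  exact isSModel_singleton c M

lemma Peel.pathClosed (hT : T.IsTree) {t : ℕ} (h : Peel T r p x t) : PathClosed T (aliveAt r t) := by
  induction t with
  | zero => rw [aliveAt_zero]; exact pathClosed_univ
  | succ t ih =>
    have h' : Peel T r p x t := by
      constructor
      · exact fun s hs => h.adj s (by omega)
      · exact fun s hs => h.inj s (by omega)
      · exact fun s hs => h.alive s (by omega)
      · exact fun s hs => h.uniq s (by omega)
      · exact fun s hs => h.mono s (by omega)
      · exact fun s hs => h.val s (by omega)
      · exact fun s hs => h.min s (by omega)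
    refine PathClosed.of_insert_leaf hT (r := r t) (p := p t) (fun hh => hh t (by omega) rfl) ?_
      fun q hq hrq => h.uniq t (by omega) q hrq fun s hs => hq s (by omega)
    rw [h.insert_aliveAt (by omega)]
    exact ih h'

variable [Finite V]

/-- The neighbours of `p t` drawn so far are its parent, in slot `0`, and children removed after
time `t`, which have smaller slot numbers. -/
lemma Drawing.free (h : Peel T r p x N) (hc : Peel.Complete r c N)
    (hdeg : ∀ v, (T.neighborSet v).ncard ≤ 4) {t : ℕ} (ht : t < N)
    (hD : Drawing T r p N c (t + 1) M base) {z : V} (hz : z ∈ aliveAt r (t + 1))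
    (hpz : T.Adj (p t) z) :
    direction (M (p t)) (M z) ≠ uvec (base (p t) + slotOf (slotNo p N c t)) := by
  classical
  have hle := h.slotNo_le hc hdeg ht
  have hlate : ∀ s, r s ∈ aliveAt r (t + 1) → t + 1 ≤ s := by
    intro s hs
    by_contra hcon
    exact hs s (by omega) rfl
  intro heq
  rcases h.edge hc hpz with ⟨s, hs, h1, rfl⟩ | ⟨s, hs, rfl, h1⟩
  · have hts := hlate s (h1 ▸ h.parent_mem ht)
    have h2 := direction_back (hD.dir s hts hs)
    rw [← hD.base s hts hs, ← h1, heq] at h2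
    have h3 := uvec_injective h2
    have h4 : slotOf (slotNo p N c t) = slotOf 0 := left_eq_add.1 h3.symm
    have h5 := slotOf_inj hle (by omega) h4
    rw [slotNo, if_neg (h1 ▸ hc.ne s hs)] at h5
    omega
  · have hts := hlate s hz
    have h2 := hD.dir s hts hs
    rw [← h1, heq] at h2
    have h3 := slotOf_inj hle (h.slotNo_le hc hdeg hs) (add_left_cancel (uvec_injective h2))
    rw [slotNo, slotNo, ← h1] at h3
    have h4 := kids_length_mono p hs (p s)
    rw [kids_succ_self, List.length_cons, ← h1] at h4
    have h5 := kids_length_mono p hts (p t)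
    have h6 : (kids p (s + 1) (p t)).length = (kids p s (p t)).length + 1 := by
      rw [h1, kids_succ_self, List.length_cons]
    omega

/-- The insertion of the next vertex into a drawing, in a new column or row. -/
theorem Drawing.insert (h : Peel T r p x N) (hc : Peel.Complete r c N)
    (hdeg : ∀ v, (T.neighborSet v).ncard ≤ 4) {t : ℕ} (ht : t < N)
    (hD : Drawing T r p N c (t + 1) M base) {d : ZMod 4} {q : ℤ}
    (hd : d = base (p t) + slotOf (slotNo p N c t)) (hb : ∀ v, v ≠ r t → base' v = base v)
    (hbr : base' (r t) = d + 2)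
    (hq : (((d = 0 ∧ q = (M (p t)).1 + 1) ∨ (d = 2 ∧ q = (M (p t)).1)) ∧
        (∀ u ∈ aliveAt r (t + 1), M' u = (shiftAt q (M u).1, (M u).2)) ∧
        M' (r t) = (q, (M (p t)).2)) ∨
      (((d = 1 ∧ q = (M (p t)).2 + 1) ∨ (d = 3 ∧ q = (M (p t)).2)) ∧
        (∀ u ∈ aliveAt r (t + 1), M' u = ((M u).1, shiftAt q (M u).2)) ∧
        M' (r t) = ((M (p t)).1, q))) : Drawing T r p N c t M' base' := by
  have hr : r t ∉ aliveAt r (t + 1) := fun hh => hh t (by omega) rfl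
  have hp := h.parent_mem ht
  have hadj : ∀ z ∈ aliveAt r (t + 1), T.Adj (r t) z ↔ z = p t := fun z hz =>
    ⟨fun hh => h.uniq t ht z hh fun s hs => hz s (by omega), fun hh => hh ▸ h.adj t ht⟩
  have hfree : ∀ z ∈ aliveAt r (t + 1), T.Adj (p t) z → direction (M (p t)) (M z) ≠ uvec d :=
    fun z hz hpz => hd ▸ Drawing.free h hc hdeg ht hD hz hpz
  have key : IsSModel T (Insert.insert (r t) (aliveAt r (t + 1))) M' ∧
      (∀ x ∈ aliveAt r (t + 1), ∀ y ∈ aliveAt r (t + 1),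
        direction (M' x) (M' y) = direction (M x) (M y)) ∧
      direction (M' (p t)) (M' (r t)) = uvec d := by
    rcases hq with ⟨h1, h2, h3⟩ | ⟨h1, h2, h3⟩
    · exact hD.model.insert_column hr hp hadj h1 hfree h2 h3
    · exact hD.model.insert_row hr hp hadj h1 hfree h2 h3
  rw [h.insert_aliveAt ht] at key
  obtain ⟨k1, k2, k3⟩ := key
  have hbp : ∀ s, t ≤ s → s < N → base' (p s) = base (p s) := by
    intro s hts hs
    refine hb _ ?_
    rcases hts.eq_or_lt with rfl | hts
    · exact (h.adj _ hs).ne'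
    · exact h.alive s hs t hts
  have hmem : ∀ s, t < s → s < N → r s ∈ aliveAt r (t + 1) ∧ p s ∈ aliveAt r (t + 1) :=
    fun s hts hs => ⟨fun s' hs' => h.inj s hs s' (by omega), fun s' hs' =>
      h.alive s hs s' (by omega)⟩
  refine ⟨k1, fun s hts hs => ?_, fun s hts hs => ?_⟩
  · rw [hbp s hts hs]
    rcases hts.eq_or_lt with rfl | hts
    · rw [k3, hd]
    · obtain ⟨m1, m2⟩ := hmem s hts hs
      rw [k2 _ m2 _ m1, hD.dir s hts hs]
  · rw [hbp s hts hs]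
    rcases hts.eq_or_lt with rfl | hts
    · rw [hbr, hd]
    · rw [hb _ (h.inj s hs t hts), hD.base s hts hs]

/-- A complete drawing is the result of an execution of the algorithm. -/
theorem Drawing.exists_produces (hT : T.IsTree) (h : Peel T r p x N) (hc : Peel.Complete r c N)
    (hdeg : ∀ v, (T.neighborSet v).ncard ≤ 4) (hD : Drawing T r p N c 0 M base) :
    ∃ v₀ l, IncrementallyBuilt T v₀ l ∧ Produces T v₀ l M := by
  have hM := hD.model
  rw [aliveAt_zero] at hM
  have hdrawn : Drawn (nbAt T Set.univ M) r p N c base :=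
    ⟨fun t ht => hM.nbAt_eq (Set.mem_univ _) (Set.mem_univ _) (h.adj t ht).symm
      (hD.dir t (Nat.zero_le t) ht), fun t ht => hD.base t (Nat.zero_le t) ht⟩
  have hb := hdrawn.balAt hT hdeg h hc hM.dirSys
  have hcard : (Set.univ : Set V).ncard = (Set.univ : Set V).ncard - 1 + 1 := by
    have := (Set.ncard_pos (Set.toFinite (Set.univ : Set V))).2 ⟨c, Set.mem_univ c⟩
    omega
  obtain ⟨v₀, l, h1, h2, h3⟩ := exists_produces_of_balAt hT _ hcard pathClosed_univ hM hb
  exact ⟨v₀, l, ⟨h1, h2⟩, h3⟩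

/-- A tree with at least two vertices, embedded in `T`, has a leaf. -/
lemma exists_isLeaf (hT : T.IsTree) (hdeg : ∀ v, (T.neighborSet v).ncard ≤ 4) {S : Set V}
    (hS : PathClosed T S) (hnt : S.Nontrivial) : ∃ v, IsLeaf T S v := by
  -- Some model is used only for its directions: the induction along edges pointing away from a
  -- vertex ends at a leaf.
  obtain ⟨v₀, l, hl⟩ := exists_incrementallyBuilt hT
  obtain ⟨M, hM⟩ := hl.1.exists_produces hT hdeg
  have hM := (hM.optimal hT hl).1
  have hD := (hM.mono (Set.subset_univ S)).dirSys
  obtain ⟨y, hy⟩ := hnt.nonempty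
  obtain ⟨z, hz, hzy⟩ := hnt.exists_ne y
  obtain ⟨w, hw, hs⟩ := exists_side hT hzy
  obtain ⟨d, hd⟩ := hD.surj hy (hS.side_mem hy hz hw hs) hw
  refine hD.induct hT.isAcyclic (P := fun _ _ _ => ∃ v, IsLeaf T S v) ?_ hy hd
  intro q d v hq hv ih
  by_cases h : ∀ e, e ≠ d + 2 → nbAt T S M v e = none
  · exact ⟨v, hD.isLeaf hq hv h⟩
  · push Not at h
    obtain ⟨e, he, hne⟩ := h
    obtain ⟨x, hx⟩ := Option.ne_none_iff_exists'.1 hne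
    exact ih e x he hx

end drawing
end StraightModel

namespace StraightModel

/-! ### The data from which the next leaf is chosen. -/

section state

variable {V : Type*} {T : SimpleGraph V} {r p : ℕ → V} {x : ℕ → ℕ} {t : ℕ} {deg cand next : V → ℕ}

/-- One more than the value of the latest child. -/
def nextVal (x : ℕ → ℕ) : List ℕ → ℕ
  | [] => 0
  | a :: _ => x a + 1

lemma nextVal_congr {x x' : ℕ → ℕ} {l : List ℕ} (h : ∀ a ∈ l, x' a = x a) :
    nextVal x' l = nextVal x l := by
  match l with
  | [] => rfl
  | a :: l => simp [nextVal, h a]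

lemma candVal_cons (x : ℕ → ℕ) (a : ℕ) (l : List ℕ) :
    candVal x (a :: l) = max (x a) (nextVal x l) := by
  match l with
  | [] => simp [candVal, nextVal]
  | b :: l => rfl

lemma candVal_le {l : List ℕ} (hl : ∀ a ∈ l, a < t) (hx : ∀ a ∈ l, x a ≤ a) : candVal x l ≤ t := by
  match l with
  | [] => exact Nat.zero_le t
  | [a] => exact (hx a (by simp)).trans (hl a (by simp)).le
  | a :: b :: l =>
    have := hx a (by simp)
    have := hl a (by simp)
    have := hx b (by simp)
    have := hl b (by simp)
    simp only [candVal]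
    omega

lemma nextVal_le {l : List ℕ} (hl : ∀ a ∈ l, a < t) (hx : ∀ a ∈ l, x a ≤ a) : nextVal x l ≤ t := by
  match l with
  | [] => exact Nat.zero_le t
  | a :: l =>
    have := hx a (by simp)
    have := hl a (by simp)
    simp only [nextVal]
    omega

/-- The data kept while leaves are removed: the degrees, the values, and for each vertex one more
than the value of its latest child. -/
structure PeelState (T : SimpleGraph V) (r p : ℕ → V) (x : ℕ → ℕ) (t : ℕ) (deg cand next : V → ℕ) :
    Prop where
  peel : Peel T r p x t
  cand_eq : ∀ v, cand v = candVal x (kids p t v)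
  next_eq : ∀ v, next v = nextVal x (kids p t v)
  deg_eq : ∀ v ∈ aliveAt r t, deg v = (T.neighborSet v ∩ aliveAt r t).ncard
  dead : ∀ s < t, deg (r s) = 0
  le : ∀ v ∈ aliveAt r t, deg v = 1 → ∀ s < t, x s ≤ cand v
  -- This bounds the values that the program has to store.
  bound : ∀ s < t, x s ≤ s

lemma PeelState.zero (r p : ℕ → V) (x : ℕ → ℕ) (hdeg : ∀ v, deg v = (T.neighborSet v).ncard)
    (hcand : ∀ v, cand v = 0) (hnext : ∀ v, next v = 0) : PeelState T r p x 0 deg cand next where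
  peel := by constructor <;> intro s hs <;> exact absurd hs (Nat.not_lt_zero s)
  cand_eq := hcand
  next_eq := hnext
  deg_eq v _ := by rw [aliveAt_zero, Set.inter_univ, hdeg]
  dead s hs := absurd hs (Nat.not_lt_zero s)
  le _ _ _ s hs := absurd hs (Nat.not_lt_zero s)
  bound s hs := absurd hs (Nat.not_lt_zero s)

lemma PeelState.mem_aliveAt (h : PeelState T r p x t deg cand next) {v : V} (hv : deg v ≠ 0) :
    v ∈ aliveAt r t := by
  rintro s hs rfl
  exact hv (h.dead s hs)

lemma PeelState.cand_le (h : PeelState T r p x t deg cand next) (v : V) : cand v ≤ t := by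
  rw [h.cand_eq]
  exact candVal_le (fun a ha => (mem_kids.1 ha).1) fun a ha => h.bound a (mem_kids.1 ha).1

lemma PeelState.next_le (h : PeelState T r p x t deg cand next) (v : V) : next v ≤ t := by
  rw [h.next_eq]
  exact nextVal_le (fun a ha => (mem_kids.1 ha).1) fun a ha => h.bound a (mem_kids.1 ha).1

lemma PeelState.nbr_unique (h : PeelState T r p x t deg cand next) {u w q : V} (hu : deg u = 1)
    (huw : T.Adj u w) (hw : w ∈ aliveAt r t) (huq : T.Adj u q) (hq : q ∈ aliveAt r t) : q = w := by
  have hu' := h.mem_aliveAt (v := u) (by omega)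
  rw [h.deg_eq u hu', Set.ncard_eq_one] at hu
  obtain ⟨y, hy⟩ := hu
  have h1 : w ∈ T.neighborSet u ∩ aliveAt r t := ⟨huw, hw⟩
  have h2 : q ∈ T.neighborSet u ∩ aliveAt r t := ⟨huq, hq⟩
  rw [hy] at h1 h2
  exact h2.trans h1.symm

/-- Among the surviving candidates only that of `w` changes, and it becomes at least the value just
removed; hence the removed values stay monotone. The former latest child of `w` becomes the second,
so the old `next w` is the other term of the maximum. -/
lemma PeelState.succ [DecidableEq V] (h : PeelState T r p x t deg cand next) {u w : V} (hu : deg u = 1)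
    (hmin : ∀ v, deg v = 1 → cand u ≤ cand v) (huw : T.Adj u w) (hw : w ∈ aliveAt r t) :
    PeelState T (Function.update r t u) (Function.update p t w) (Function.update x t (cand u))
      (t + 1) (Function.update (Function.update deg u 0) w (deg w - 1))
      (Function.update cand w (max (next w) (cand u))) (Function.update next w (cand u + 1)) := by
  have hu' := h.mem_aliveAt (v := u) (by omega)
  have hr : ∀ s < t, Function.update r t u s = r s := fun s hs => Function.update_of_ne hs.ne _ _
  have hp : ∀ s < t, Function.update p t w s = p s := fun s hs => Function.update_of_ne hs.ne _ _
  have hx : ∀ s < t, Function.update x t (cand u) s = x s :=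
    fun s hs => Function.update_of_ne hs.ne _ _
  have hkids : ∀ v, kids (Function.update p t w) t v = kids p t v := kids_congr hp
  have hxk : ∀ v, ∀ a ∈ kids p t v, Function.update x t (cand u) a = x a :=
    fun v a ha => hx a (mem_kids.1 ha).1
  have halive : ∀ v, (∀ s < t, v ≠ Function.update r t u s) ↔ v ∈ aliveAt r t := fun v =>
    forall₂_congr fun s hs => by rw [hr s hs]
  have hsucc : aliveAt (Function.update r t u) (t + 1) = aliveAt r t \ {u} := by
    ext v
    rw [mem_aliveAt_succ, Function.update_self]
    exact and_congr (halive v) Iff.rfl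
  have hks : ∀ v, kids (Function.update p t w) (t + 1) v =
      if v = w then t :: kids p t v else kids p t v := by
    intro v
    simp only [kids, Function.update_self, hkids, eq_comm (a := w)]
  have huniq : ∀ q, T.Adj u q → q ∈ aliveAt r t → q = w := fun q huq hq =>
    h.nbr_unique hu huw hw huq hq
  constructor
  · refine (h.peel.congr hr hp hx).succ ?_ ?_ ?_ ?_ ?_ ?_ ?_
    · simpa using huw
    · rw [Function.update_self, halive]; exact hu'
    · rw [Function.update_self, halive]; exact hw
    · intro q
      rw [Function.update_self, Function.update_self, halive]
      exact huniq q
    · intro s hs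
      rw [Function.update_self, hx s hs]
      exact h.le u hu' hu s hs
    · rw [Function.update_self, Function.update_self, hkids, candVal_congr (hxk u), h.cand_eq]
    · rw [Function.update_self, Function.update_self, Function.update_self, hkids,
        candVal_congr (hxk w), ← h.cand_eq]
      intro hq
      -- If `u` is the only remaining neighbour of `w`, then `w` has degree one and took part in the
      -- choice of the minimum.
      refine hmin w ?_
      rw [h.deg_eq w hw, Set.ncard_eq_one]
      exact ⟨u, Set.eq_singleton_iff_unique_mem.2 ⟨⟨huw.symm, hu'⟩,
        fun q hqw => hq q hqw.1 ((halive q).2 hqw.2)⟩⟩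
  · intro v
    rw [hks]
    split_ifs with hv
    · subst hv
      rw [Function.update_self, candVal_cons, Function.update_self, nextVal_congr (hxk v),
        h.next_eq, max_comm]
    · rw [Function.update_of_ne hv, candVal_congr (hxk v), h.cand_eq]
  · intro v
    rw [hks]
    split_ifs with hv
    · subst hv
      rw [Function.update_self, nextVal, Function.update_self]
    · rw [Function.update_of_ne hv, nextVal_congr (hxk v), h.next_eq]
  · intro v hv
    rw [hsucc] at hv ⊢
    have hint : T.neighborSet v ∩ (aliveAt r t \ {u}) = (T.neighborSet v ∩ aliveAt r t) \ {u} :=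
      Set.inter_sdiff_assoc _ _ _ |>.symm
    rw [hint]
    by_cases hvw : v = w
    · subst hvw
      have hmem : u ∈ T.neighborSet v ∩ aliveAt r t := Set.mem_inter huw.symm hu'
      rw [Function.update_self, h.deg_eq v hw, Set.ncard_sdiff_singleton_of_mem hmem]
    · rw [Function.update_of_ne hvw, Function.update_of_ne hv.2, Set.sdiff_singleton_eq_self,
        h.deg_eq v hv.1]
      exact fun hh => hvw (huniq v hh.1.symm hv.1)
  · intro s hs
    rcases Nat.lt_succ_iff_lt_or_eq.1 hs with hs | rfl
    · rw [hr s hs, Function.update_of_ne (hw s hs).symm, Function.update_of_ne (hu' s hs).symm]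
      exact h.dead s hs
    · rw [Function.update_self, Function.update_of_ne huw.ne, Function.update_self]
  · intro v hv hdv s hs
    rw [hsucc] at hv
    have hxs : Function.update x t (cand u) s ≤ cand u := by
      rcases Nat.lt_succ_iff_lt_or_eq.1 hs with hs | rfl
      · rw [hx s hs]; exact h.le u hu' hu s hs
      · rw [Function.update_self]
    by_cases hvw : v = w
    · subst hvw
      rw [Function.update_self]
      exact hxs.trans (le_max_right _ _)
    · rw [Function.update_of_ne hvw, Function.update_of_ne hv.2] at hdv
      rw [Function.update_of_ne hvw]
      exact hxs.trans (hmin v hdv)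
  · intro s hs
    rcases Nat.lt_succ_iff_lt_or_eq.1 hs with hs | rfl
    · rw [hx s hs]; exact h.bound s hs
    · rw [Function.update_self]; exact h.cand_le u

variable [Finite V]

lemma Peel.ncard_aliveAt (h : Peel T r p x t) : (aliveAt r t).ncard + t = Nat.card V := by
  have h1 : (aliveAt r t)ᶜ = r '' Set.Iio t := by
    ext v
    simp [aliveAt, eq_comm]
  have h2 : (r '' Set.Iio t).ncard = t := by
    have hinj : Set.InjOn r (Set.Iio t) := fun a ha b hb hab => h.inj' ha hb hab
    rw [hinj.ncard_image]
    simp [Set.ncard_eq_toFinset_card']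
  rw [← Set.ncard_add_ncard_compl (aliveAt r t), h1, h2]

lemma PeelState.deg_pos (h : PeelState T r p x t deg cand next) {u w : V} (hu : u ∈ aliveAt r t)
    (hw : w ∈ aliveAt r t) (huw : T.Adj u w) : deg u ≠ 0 := by
  rw [h.deg_eq u hu]
  exact ((Set.ncard_pos (Set.toFinite _)).2 ⟨w, Set.mem_inter huw hw⟩).ne'

lemma PeelState.exists_deg_one (hT : T.IsTree) (hdeg : ∀ v, (T.neighborSet v).ncard ≤ 4)
    (h : PeelState T r p x t deg cand next) (ht : t + 1 < Nat.card V) :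
    ∃ u w, deg u = 1 ∧ T.Adj u w ∧ w ∈ aliveAt r t := by
  have h1 := h.peel.ncard_aliveAt
  have hnt : (aliveAt r t).Nontrivial := Set.one_lt_ncard_iff_nontrivial.1 (by omega)
  obtain ⟨u, hu, w, ⟨hw, huw⟩, huniq⟩ := exists_isLeaf hT hdeg (h.peel.pathClosed hT) hnt
  refine ⟨u, w, ?_, huw, hw⟩
  rw [h.deg_eq u hu, Set.ncard_eq_one]
  refine ⟨w, Set.eq_singleton_iff_unique_mem.2 ⟨⟨huw, hw⟩, fun y hy => huniq y ⟨hy.2, hy.1⟩⟩⟩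

lemma PeelState.complete (h : PeelState T r p x t deg cand next) (ht : t + 1 = Nat.card V) :
    ∃ c, Peel.Complete r c t := by
  have h1 := h.peel.ncard_aliveAt
  obtain ⟨c, hc⟩ := Set.ncard_eq_one.1 (show (aliveAt r t).ncard = 1 by omega)
  refine ⟨c, fun v => ?_, fun s hs hsc => ?_⟩
  · by_cases hv : v ∈ aliveAt r t
    · rw [hc] at hv
      exact Or.inl hv
    · right
      simp only [aliveAt, Set.mem_ofPred_eq, not_forall, not_not] at hv
      obtain ⟨s, hs, rfl⟩ := hv
      exact ⟨s, hs, rfl⟩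
  · have : c ∈ aliveAt r t := hc ▸ Set.mem_singleton c
    exact this s hs hsc.symm

end state
end StraightModel

/-! ### Rules for running times, and the removal of a leaf by the program. -/

namespace RAM

variable {W : ℕ}

/-- Started in `σ`, the program halts within `c` steps in a memory that satisfies `Q`. -/
def Run (W : ℕ) (P : Prog) (c : ℕ) (σ : Memory) (Q : Memory → Prop) : Prop :=
  ∃ t σ', Exec W P σ t σ' ∧ t ≤ c ∧ Q σ'

lemma Run.mono {P : Prog} {c : ℕ} {σ : Memory} {Q Q' : Memory → Prop} (h : Run W P c σ Q)
    (hQ : ∀ σ', Q σ' → Q' σ') : Run W P c σ Q' := by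
  obtain ⟨t, σ', h1, h2, h3⟩ := h
  exact ⟨t, σ', h1, h2, hQ σ' h3⟩

lemma Run.seq {P P' : Prog} {c c' : ℕ} {σ : Memory} {Q Q' : Memory → Prop} (h : Run W P c σ Q)
    (h' : ∀ σ', Q σ' → Run W P' c' σ' Q') : Run W (.seq P P') (c + c') σ Q' := by
  obtain ⟨t, σ', h1, h2, h3⟩ := h
  obtain ⟨t', σ'', h4, h5, h6⟩ := h' σ' h3
  exact ⟨t + t', σ'', .seq h1 h4, by omega, h6⟩

lemma Run.ite {e : Expr} {P P' : Prog} {c : ℕ} {σ : Memory} {Q : Memory → Prop}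
    (h : e.eval σ ≠ 0 → Run W P c σ Q) (h' : e.eval σ = 0 → Run W P' c σ Q) :
    Run W (.ite e P P') (e.cost + 1 + c) σ Q := by
  by_cases he : e.eval σ = 0
  · obtain ⟨t, σ', h1, h2, h3⟩ := h' he
    exact ⟨_, σ', .ite_false he h1, by omega, h3⟩
  · obtain ⟨t, σ', h1, h2, h3⟩ := h he
    exact ⟨_, σ', .ite_true he h1, by omega, h3⟩

/-- The rule for a loop that is carried out `m` times. -/
lemma Run.loop {e : Expr} {P : Prog} {c m : ℕ} {σ : Memory} {I : ℕ → Memory → Prop} (h0 : I 0 σ)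
    (hstep : ∀ k < m, ∀ σ, I k σ → e.eval σ ≠ 0 ∧ Run W P c σ (I (k + 1)))
    (hend : ∀ σ, I m σ → e.eval σ = 0) :
    Run W (.while e P) ((c + e.cost + 1) * m + (e.cost + 1)) σ (I m) := by
  suffices H : ∀ j k σ, k + j = m → I k σ →
      Run W (.while e P) ((c + e.cost + 1) * j + (e.cost + 1)) σ (I m) from H m 0 σ (by omega) h0
  intro j
  induction j with
  | zero =>
    rintro k σ rfl h
    exact ⟨_, σ, .while_false (hend σ h), by omega, h⟩
  | succ j ih =>
    intro k σ hk h
    obtain ⟨he, t, σ', h1, h2, h3⟩ := hstep k (by omega) σ h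
    obtain ⟨t', σ'', h4, h5, h6⟩ := ih (k + 1) σ' (by omega) h3
    refine ⟨_, σ'', .while_true he h1 h4, ?_, h6⟩
    rw [Nat.mul_succ]
    omega

/-- The weakest precondition of a program without loops. -/
def Prog.pre (W : ℕ) : Prog → Memory → (Memory → Prop) → Prop
  | .skip, σ, Q => Q σ
  | .set a i e, σ, Q => e.eval σ ≤ W ∧ Q (write σ a (i.eval σ) (e.eval σ))
  | .seq P P', σ, Q => P.pre W σ fun σ' => P'.pre W σ' Q
  | .ite e P P', σ, Q => (e.eval σ ≠ 0 → P.pre W σ Q) ∧ (e.eval σ = 0 → P'.pre W σ Q)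
  | .while _ _, _, _ => False

/-- A bound for the running time of a program without loops. -/
def Prog.size : Prog → ℕ
  | .skip => 1
  | .set _ i e => i.cost + e.cost + 1
  | .seq P P' => P.size + P'.size
  | .ite e P P' => e.cost + 1 + (P.size + P'.size)
  | .while _ _ => 0

lemma Prog.pre.run {P : Prog} : ∀ {σ : Memory} {Q : Memory → Prop}, P.pre W σ Q →
    Run W P P.size σ Q := by
  induction P with
  | skip => exact fun {σ} Q h => ⟨1, σ, .skip σ, le_rfl, h⟩
  | set a i e => exact fun {σ} Q h => ⟨_, _, .set a i e σ h.1, le_rfl, h.2⟩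
  | seq P P' ih ih' => exact fun h => (ih h).seq fun σ' h' => ih' h'
  | ite e P P' ih ih' =>
    intro σ Q h
    refine Run.ite (fun he => ?_) fun he => ?_
    · obtain ⟨t, σ', h1, h2, h3⟩ := ih (h.1 he)
      exact ⟨t, σ', h1, by omega, h3⟩
    · obtain ⟨t, σ', h1, h2, h3⟩ := ih' (h.2 he)
      exact ⟨t, σ', h1, by omega, h3⟩
  | _ => exact fun h => h.elim

lemma write_same (σ : Memory) (a i x j : ℕ) : write σ a i x a j = if j = i then x else σ a j := by
  simp [write, Function.update_apply]

lemma write_of_ne (σ : Memory) {a b : ℕ} (i x : ℕ) (h : b ≠ a) : write σ a i x b = σ b := by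
  simp [write, h]

/-- A scalar variable. -/
abbrev Expr.var (a : ℕ) : Expr := .get a (.const 0)

/-- Assignment to a scalar variable. -/
abbrev Prog.put (a : ℕ) (e : Expr) : Prog := .set a (.const 0) e

/-- The loop `for i = 0, …, n - 1`, where the body increments the counter, in cell `0` of
array `11`. -/
abbrev Prog.for (P : Prog) : Prog :=
  .while (.sub (.var 0) (.var 11)) (.seq P (.put 11 (.add (.var 11) (.const 1))))

/-- The cell of array `1` that holds the `k`-th neighbour of `u`. -/
abbrev Expr.nbr (u : Expr) (k : ℕ) : Expr :=
  .get 1 (.add (.add (.add u u) (.add u u)) (.const k))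

/-- `1` if the value is positive, and `0` otherwise. -/
abbrev Expr.flag (e : Expr) : Expr := .sub (.const 1) (.sub (.const 1) e)

/-- In each round the test and the increment cost `6` steps each; the last test costs another `6`.
-/
lemma Run.for {P : Prog} {c n : ℕ} {σ : Memory} {I : ℕ → Memory → Prop} (hn : n ≤ W)
    (h0 : σ 11 0 = 0) (hσ : σ 0 0 = n) (hI : I 0 σ)
    (hstep : ∀ k < n, ∀ σ, σ 11 0 = k → σ 0 0 = n → I k σ →
      Run W P c σ fun σ' => σ' 11 0 = k ∧ σ' 0 0 = n ∧ I (k + 1) (write σ' 11 0 (k + 1))) :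
    Run W P.for ((c + 12) * n + 6) σ fun σ' => σ' 0 0 = n ∧ I n σ' := by
  have := Run.loop (W := W) (e := .sub (.var 0) (.var 11))
    (P := .seq P (.put 11 (.add (.var 11) (.const 1)))) (c := c + 6) (m := n) (σ := σ)
    (I := fun k σ => σ 11 0 = k ∧ σ 0 0 = n ∧ I k σ) ⟨h0, hσ, hI⟩ (fun k hk σ hkσ => ?_)
    fun σ hσ => ?_
  · exact this.mono fun σ' h => h.2
  · obtain ⟨h1, h2, h3⟩ := hkσ
    refine ⟨by simp only [Expr.eval]; omega, (hstep k hk σ h1 h2 h3).seq fun σ' h => ?_⟩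
    obtain ⟨h4, h5, h6⟩ := h
    refine Prog.pre.run (P := .put 11 (.add (.var 11) (.const 1))) (And.intro ?_ ⟨?_, ?_, ?_⟩)
    · simp only [Expr.eval, h4]; omega
    · simp [Expr.eval, write_same, h4]
    · rwa [write_of_ne _ _ _ (by decide)]
    · simpa only [Expr.eval, h4] using h6
  · simp only [Expr.eval]
    omega

/-! The arrays used by the program: `2`, `3` coordinates, `4` degrees, `5` values, `6` values of
the latest children plus one, `7`, `8` removed leaves and their neighbours, `9` directions of the
first slots, `10` numbers of filled slots, `18`, `19` tables; scalars `11` loop counter, `12` time,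
`13` leaf, `14` minimum, `15` neighbour of the leaf, `16` direction, `17` new coordinate. -/

/-- Computes the degrees. -/
def degreeBody : Prog :=
  .set 4 (.var 11) (.add (.add (.flag (.nbr (.var 11) 0)) (.flag (.nbr (.var 11) 1)))
    (.add (.flag (.nbr (.var 11) 2)) (.flag (.nbr (.var 11) 3))))

lemma run_degree {n : ℕ} {σ : Memory} (hW : n + 9 ≤ W) (hn : σ 0 0 = n) (h0 : σ 11 0 = 0) :
    Run W degreeBody.for ((degreeBody.size + 12) * n + 6) σ fun σ' =>
      (∀ a, a ≠ 4 → a ≠ 11 → σ' a = σ a) ∧ ∀ v < n, σ' 4 v =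
        (1 - (1 - σ 1 (4 * v + 0))) + (1 - (1 - σ 1 (4 * v + 1))) +
          ((1 - (1 - σ 1 (4 * v + 2))) + (1 - (1 - σ 1 (4 * v + 3)))) := by
  refine (Run.for (I := fun k σ' => (∀ a, a ≠ 4 → a ≠ 11 → σ' a = σ a) ∧ ∀ v < k, σ' 4 v =
        (1 - (1 - σ 1 (4 * v + 0))) + (1 - (1 - σ 1 (4 * v + 1))) +
          ((1 - (1 - σ 1 (4 * v + 2))) + (1 - (1 - σ 1 (4 * v + 3))))) (by omega) h0 hn
    ⟨fun _ _ _ => rfl, fun v hv => absurd hv (Nat.not_lt_zero v)⟩ ?_).mono fun σ' h => h.2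
  rintro k hk σ' h11 h00 ⟨hf, hv⟩
  refine Prog.pre.run (P := degreeBody) ⟨?_, ?_⟩
  · simp only [Expr.eval]
    omega
  · have h4 : k + k + (k + k) = 4 * k := by omega
    refine ⟨?_, ?_, fun a h1 h2 => ?_, fun v hvk => ?_⟩
    · rw [write_of_ne _ _ _ (by decide), h11]
    · rw [write_of_ne _ _ _ (by decide), h00]
    · rw [write_of_ne _ _ _ h2, write_of_ne _ _ _ h1, hf a h1 h2]
    · rw [write_of_ne _ _ _ (by decide), write_same]
      simp only [Expr.eval, h11, h4]
      split_ifs with hvk'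
      · rw [hvk', hf 1 (by decide) (by decide)]
      · exact hv v (by omega)

/-- Keeps the smallest value of a vertex of degree one. -/
def findBody : Prog :=
  -- The condition holds exactly if the degree is not one.
  .ite (.add (.sub (.get 4 (.var 11)) (.const 1)) (.sub (.const 1) (.get 4 (.var 11)))) .skip
    (.ite (.sub (.var 14) (.get 5 (.var 11)))
      (.seq (.put 14 (.get 5 (.var 11))) (.put 13 (.var 11))) .skip)

/-- All values are at most `n`, so the initial minimum `n + 1` marks that no leaf has been found
yet. -/
lemma run_find {n : ℕ} {σ : Memory} (hW : n + 9 ≤ W) (hn : σ 0 0 = n) (h0 : σ 11 0 = 0)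
    (h14 : σ 14 0 = n + 1) (hval : ∀ v < n, σ 5 v ≤ n) (hex : ∃ v < n, σ 4 v = 1) :
    Run W findBody.for ((findBody.size + 12) * n + 6) σ fun σ' =>
      (∀ a, a ≠ 11 → a ≠ 13 → a ≠ 14 → σ' a = σ a) ∧ σ' 13 0 < n ∧ σ 4 (σ' 13 0) = 1 ∧
        ∀ v < n, σ 4 v = 1 → σ 5 (σ' 13 0) ≤ σ 5 v := by
  refine (Run.for (I := fun k σ' => (∀ a, a ≠ 11 → a ≠ 13 → a ≠ 14 → σ' a = σ a) ∧
    ((σ' 14 0 = n + 1 ∧ ∀ v < k, σ 4 v ≠ 1) ∨ (σ' 13 0 < n ∧ σ 4 (σ' 13 0) = 1 ∧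
      σ' 14 0 = σ 5 (σ' 13 0) ∧ ∀ v < k, σ 4 v = 1 → σ 5 (σ' 13 0) ≤ σ 5 v)))
    (by omega) h0 hn ⟨fun _ _ _ _ => rfl, Or.inl ⟨h14, fun v hv => absurd hv (Nat.not_lt_zero v)⟩⟩
    ?_).mono ?_
  · rintro k hk σ' h11 h00 ⟨hf, hv⟩
    have f4 : σ' 4 = σ 4 := hf 4 (by decide) (by decide) (by decide)
    have f5 : σ' 5 = σ 5 := hf 5 (by decide) (by decide) (by decide)
    have hvk := hval k hk
    refine Prog.pre.run (P := findBody) ⟨fun he => ?_, fun he => ⟨fun he' => ?_, fun he' => ?_⟩⟩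
    · simp only [Expr.eval, h11, f4] at he
      refine ⟨h11, h00, fun a h1 h2 h3 => ?_, ?_⟩
      · rw [write_of_ne _ _ _ h1, hf a h1 h2 h3]
      · rw [write_of_ne _ _ _ (by decide), write_of_ne _ _ _ (by decide)]
        refine hv.imp (fun h => ⟨h.1, fun v hv => ?_⟩) fun h => ⟨h.1, h.2.1, h.2.2.1, fun v hv h' => ?_⟩
        · rcases Nat.lt_succ_iff_lt_or_eq.1 hv with hv | rfl
          · exact h.2 v hv
          · omega
        · rcases Nat.lt_succ_iff_lt_or_eq.1 hv with hv | rfl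
          · exact h.2.2.2 v hv h'
          · omega
    · simp only [Expr.eval, h11, f4, f5] at he he'
      refine ⟨by simp only [Expr.eval, h11, f5]; omega,
        by simp only [Expr.eval, write_of_ne _ _ _ (show 11 ≠ 14 by decide), h11]; omega, ?_⟩
      simp only [Expr.eval, write_of_ne _ _ _ (show 11 ≠ 14 by decide),
        write_of_ne _ _ _ (show 11 ≠ 13 by decide), write_of_ne _ _ _ (show 0 ≠ 13 by decide),
        write_of_ne _ _ _ (show 0 ≠ 14 by decide), h11, f5]
      refine ⟨trivial, h00, fun a h1 h2 h3 => ?_, Or.inr ?_⟩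
      · rw [write_of_ne _ _ _ h1, write_of_ne _ _ _ h2, write_of_ne _ _ _ h3, hf a h1 h2 h3]
      · simp only [write_of_ne _ _ _ (show 13 ≠ 11 by decide), write_same, if_true,
          write_of_ne _ _ _ (show 14 ≠ 11 by decide), write_of_ne _ _ _ (show 14 ≠ 13 by decide)]
        refine ⟨hk, by omega, trivial, fun v hvk' h' => ?_⟩
        rcases Nat.lt_succ_iff_lt_or_eq.1 hvk' with hvk' | rfl
        · rcases hv with hv | hv
          · exact absurd h' (hv.2 v hvk')
          · exact le_trans (by omega) (hv.2.2.2 v hvk' h')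
        · exact le_rfl
    · simp only [Expr.eval, h11, f4, f5] at he he'
      refine ⟨h11, h00, fun a h1 h2 h3 => ?_, ?_⟩
      · rw [write_of_ne _ _ _ h1, hf a h1 h2 h3]
      · rw [write_of_ne _ _ _ (by decide), write_of_ne _ _ _ (by decide)]
        refine hv.imp (fun h => absurd h.1 (by omega)) fun h =>
          ⟨h.1, h.2.1, h.2.2.1, fun v hv h' => ?_⟩
        rcases Nat.lt_succ_iff_lt_or_eq.1 hv with hv | rfl
        · exact h.2.2.2 v hv h'
        · omega
  · rintro σ' ⟨-, hf, h⟩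
    refine ⟨hf, ?_⟩
    rcases h with h | h
    · obtain ⟨v, hv, hv'⟩ := hex
      exact absurd hv' (h.2 v hv)
    · exact ⟨h.1, h.2.1, h.2.2.2⟩

/-- Tests whether the `k`-th neighbour of the leaf is still there. -/
def parentTest (k : ℕ) : Prog :=
  .ite (.nbr (.var 13) k) (.ite (.get 4 (.sub (.nbr (.var 13) k) (.const 1)))
    (.put 15 (.sub (.nbr (.var 13) k) (.const 1))) .skip) .skip

/-- Finds the neighbour of the leaf. -/
def parent : Prog :=
  .seq (.seq (parentTest 0) (parentTest 1)) (.seq (parentTest 2) (parentTest 3))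

/-- Removed vertices have degree `0` in the table, so a nonzero degree identifies the neighbour that
is still present. -/
lemma run_parent {n : ℕ} {σ : Memory} (hW : n + 9 ≤ W)
    (hle : ∀ k < 4, σ 1 (4 * σ 13 0 + k) ≤ n)
    (hex : ∃ k < 4, ∃ w, σ 1 (4 * σ 13 0 + k) = w + 1 ∧ σ 4 w ≠ 0) :
    Run W parent parent.size σ fun σ' => (∀ a, a ≠ 15 → σ' a = σ a) ∧
      ∃ k < 4, σ 1 (4 * σ 13 0 + k) = σ' 15 0 + 1 ∧ σ 4 (σ' 15 0) ≠ 0 := by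
  have step : ∀ j < 4, ∀ σ', ((∀ a, a ≠ 15 → σ' a = σ a) ∧
      ((∀ k < j, ∀ w, σ 1 (4 * σ 13 0 + k) = w + 1 → σ 4 w = 0) ∨
        ∃ k < 4, σ 1 (4 * σ 13 0 + k) = σ' 15 0 + 1 ∧ σ 4 (σ' 15 0) ≠ 0)) →
      Run W (parentTest j) (parentTest j).size σ' fun σ' => (∀ a, a ≠ 15 → σ' a = σ a) ∧
      ((∀ k < j + 1, ∀ w, σ 1 (4 * σ 13 0 + k) = w + 1 → σ 4 w = 0) ∨
        ∃ k < 4, σ 1 (4 * σ 13 0 + k) = σ' 15 0 + 1 ∧ σ 4 (σ' 15 0) ≠ 0) := by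
    rintro j hj σ' ⟨hf, h⟩
    have f1 := hf 1 (by decide)
    have f4 := hf 4 (by decide)
    have f13 := hf 13 (by decide)
    have hlej := hle j hj
    have h4 : σ 13 0 + σ 13 0 + (σ 13 0 + σ 13 0) = 4 * σ 13 0 := by omega
    have hext : (∀ w, σ 1 (4 * σ 13 0 + j) = w + 1 → σ 4 w = 0) →
        (∀ k < j, ∀ w, σ 1 (4 * σ 13 0 + k) = w + 1 → σ 4 w = 0) →
        ∀ k < j + 1, ∀ w, σ 1 (4 * σ 13 0 + k) = w + 1 → σ 4 w = 0 := by
      intro h1 h2 k hk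
      rcases Nat.lt_succ_iff_lt_or_eq.1 hk with hk | rfl
      exacts [h2 k hk, h1]
    refine Prog.pre.run (P := parentTest j) ⟨fun he => ⟨fun he' => ?_, fun he' => ?_⟩, fun he => ?_⟩
    · simp only [Expr.eval, f1, f4, f13, h4] at he he'
      refine ⟨by simp only [Expr.eval, f1, f13, h4]; omega, fun a ha => ?_, Or.inr ⟨j, hj, ?_⟩⟩
      · rw [write_of_ne _ _ _ ha, hf a ha]
      · simp only [Expr.eval, f1, f13, h4, write_same, if_true]
        exact ⟨by omega, he'⟩
    · simp only [Expr.eval, f1, f4, f13, h4] at he he'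
      refine ⟨hf, h.imp (hext fun w hw => ?_) id⟩
      rwa [hw, Nat.add_sub_cancel] at he'
    · simp only [Expr.eval, f1, f13, h4] at he
      exact ⟨hf, h.imp (hext fun w hw => by omega) id⟩
  refine Run.mono (Run.seq (Run.seq (step 0 (by decide) σ ⟨fun _ _ => rfl,
    Or.inl fun k hk => absurd hk (Nat.not_lt_zero k)⟩) (step 1 (by decide)))
    fun σ' h => Run.seq (step 2 (by decide) σ' h) (step 3 (by decide))) ?_
  rintro σ' ⟨hf, h⟩
  refine ⟨hf, h.resolve_left fun hh => ?_⟩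
  obtain ⟨k, hk, w, h1, h2⟩ := hex
  exact h2 (hh k hk w h1)

/-- Removes the leaf. -/
def record : Prog :=
  .seq (.seq (.seq (.set 7 (.var 12) (.var 13)) (.set 8 (.var 12) (.var 15)))
    -- With truncated subtraction, `a + (b - a)` is the maximum of `a` and `b`.
    (.seq (.set 5 (.var 15) (.add (.get 6 (.var 15))
      (.sub (.get 5 (.var 13)) (.get 6 (.var 15)))))
      (.set 6 (.var 15) (.add (.get 5 (.var 13)) (.const 1)))))
    (.seq (.seq (.set 4 (.var 13) (.const 0))
      (.set 4 (.var 15) (.sub (.get 4 (.var 15)) (.const 1))))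
      (.put 12 (.add (.var 12) (.const 1))))

lemma run_record {n t u w : ℕ} {σ : Memory} (hW : n + 9 ≤ W) (ht : σ 12 0 = t) (hu : σ 13 0 = u)
    (hw : σ 15 0 = w) (hun : u < n) (hwn : w < n) (huw : u ≠ w) (htn : t < n)
    (h5 : σ 5 u ≤ n) (h6 : σ 6 w ≤ n) (h4 : σ 4 w ≤ 4) :
    Run W record record.size σ fun σ' =>
      (∀ a, a ≠ 4 → a ≠ 5 → a ≠ 6 → a ≠ 7 → a ≠ 8 → a ≠ 12 → σ' a = σ a) ∧ σ' 12 0 = t + 1 ∧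
      (∀ j, σ' 7 j = if j = t then u else σ 7 j) ∧ (∀ j, σ' 8 j = if j = t then w else σ 8 j) ∧
      (∀ j, σ' 5 j = if j = w then max (σ 6 w) (σ 5 u) else σ 5 j) ∧
      (∀ j, σ' 6 j = if j = w then σ 5 u + 1 else σ 6 j) ∧
      (∀ j, σ' 4 j = if j = w then σ 4 w - 1 else if j = u then 0 else σ 4 j) := by
  refine Prog.pre.run (P := record) ?_
  simp only [record, Prog.pre, Expr.eval, write_same, ht, hu, hw, huw, huw.symm, if_true, if_false,
    write_of_ne, ne_eq, Nat.reduceEqDiff, not_false_eq_true]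
  refine ⟨by omega, by omega, by omega, by omega, by omega, by omega, by omega, ?_, ?_⟩
  · intro a h4 h5 h6 h7 h8 h12
    simp only [write_of_ne, ne_eq, *, not_false_eq_true]
  · refine ⟨trivial, fun _ => trivial, fun _ => trivial, fun j => ?_, fun _ => trivial,
      fun _ => trivial⟩
    congr 1
    omega

end RAM

/-! ### The insertion of a vertex by the program. -/

namespace RAM

variable {W : ℕ}

/-- Makes room in a row or column. -/
def shiftBody (a : ℕ) : Prog :=
  -- The condition holds exactly for coordinates that are at least the new one.
  .ite (.sub (.add (.get a (.var 11)) (.const 1)) (.var 17))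
    (.set a (.var 11) (.add (.get a (.var 11)) (.const 1))) .skip

lemma run_shift {a n q : ℕ} {σ : Memory} (ha : a ≠ 0) (ha' : a < 11) (hW : n + 9 ≤ W)
    (hn : σ 0 0 = n) (h0 : σ 11 0 = 0) (hq : σ 17 0 = q) (hle : ∀ j < n, σ a j ≤ n) :
    Run W (shiftBody a).for (((shiftBody a).size + 12) * n + 6) σ fun σ' =>
      (∀ b, b ≠ a → b ≠ 11 → σ' b = σ b) ∧
        ∀ j, σ' a j = if j < n ∧ q ≤ σ a j then σ a j + 1 else σ a j := by
  refine (Run.for (I := fun k σ' => (∀ b, b ≠ a → b ≠ 11 → σ' b = σ b) ∧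
        ∀ j, σ' a j = if j < k ∧ q ≤ σ a j then σ a j + 1 else σ a j) (by omega) h0 hn
    ⟨fun _ _ _ => rfl, fun j => by simp⟩ ?_).mono fun σ' h => h.2
  rintro k hk σ' h11 h00 ⟨hf, hv⟩
  have hak : σ' a k = σ a k := by rw [hv, if_neg (by omega)]
  have h17 : σ' 17 0 = q := by rw [hf 17 (by omega) (by decide), hq]
  have hlek := hle k hk
  have haa : a ≠ 11 := by omega
  refine Prog.pre.run (P := shiftBody a) ⟨fun he => ?_, fun he => ?_⟩
  · simp only [Expr.eval, h11, hak, h17] at he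
    refine ⟨by simp only [Expr.eval, h11, hak]; omega, ?_⟩
    simp only [Expr.eval, h11, hak]
    refine ⟨?_, ?_, fun b h1 h2 => ?_, fun j => ?_⟩
    · rw [write_of_ne _ _ _ haa.symm, h11]
    · rw [write_of_ne _ _ _ ha.symm, h00]
    · rw [write_of_ne _ _ _ h2, write_of_ne _ _ _ h1, hf b h1 h2]
    · rw [write_of_ne _ _ _ haa, write_same, hv]
      by_cases hj : j = k
      · subst hj
        rw [if_pos rfl, if_pos (by omega)]
      · rw [if_neg hj]
        by_cases h : j < k ∧ q ≤ σ a j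
        · rw [if_pos h, if_pos (by omega)]
        · rw [if_neg h, if_neg (by omega)]
  · simp only [Expr.eval, h11, hak, h17] at he
    refine ⟨h11, h00, fun b h1 h2 => ?_, fun j => ?_⟩
    · rw [write_of_ne _ _ _ h2, hf b h1 h2]
    · rw [write_of_ne _ _ _ haa, hv]
      by_cases hj : j = k
      · subst hj
        rw [if_neg (by omega), if_neg (by omega)]
      · by_cases h : j < k ∧ q ≤ σ a j
        · rw [if_pos h, if_pos (by omega)]
        · rw [if_neg h, if_neg (by omega)]

/-- Places the new vertex in a new row or column; `a` is the array of the coordinates that are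
shifted. -/
def place (a b : ℕ) : Prog :=
  -- In directions `0` and `1` the new line is just beyond the neighbour. In directions `2` and `3`
  -- it takes the neighbour's coordinate, and the neighbour is shifted away.
  .seq (.seq (.put 17 (.add (.get a (.var 15)) (.flag (.sub (.const 2) (.var 16)))))
    (.put 11 (.const 0)))
    (.seq (shiftBody a).for
      (.seq (.set a (.var 13) (.var 17)) (.set b (.var 13) (.get b (.var 15)))))

/-- A bound for the running time of `place a b`, up to a factor `n`. -/
def placeTime (n : ℕ) : ℕ := 50 + ((shiftBody 2).size + 12) * n

lemma run_place {a b n u w d q : ℕ} {σ : Memory} (ha : a = 2 ∨ a = 3) (hb : b = 2 ∨ b = 3)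
    (hab : a ≠ b) (hW : n + 9 ≤ W) (hn : σ 0 0 = n) (hu : σ 13 0 = u) (hw : σ 15 0 = w)
    (hd : σ 16 0 = d) (huw : w ≠ u) (hwn : w < n) (hq : q = σ a w + (1 - (1 - (2 - d))))
    (hle : ∀ j < n, σ a j ≤ n) (hleb : σ b w ≤ n) :
    Run W (place a b) (placeTime n) σ fun σ' =>
      (∀ e, e ≠ 2 → e ≠ 3 → e ≠ 11 → e ≠ 17 → σ' e = σ e) ∧ σ' a u = q ∧ σ' b u = σ b w ∧
        (∀ j, j ≠ u → σ' b j = σ b j) ∧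
        ∀ j < n, j ≠ u → σ' a j = if q ≤ σ a j then σ a j + 1 else σ a j := by
  have hlew := hle w hwn
  have hpre : Run W (.seq (.put 17 (.add (.get a (.var 15)) (.flag (.sub (.const 2) (.var 16)))))
      (.put 11 (.const 0))) 20 σ fun σ' => (∀ e, e ≠ 11 → e ≠ 17 → σ' e = σ e) ∧
        σ' 11 0 = 0 ∧ σ' 17 0 = q := by
    obtain ⟨t, σ', h1, h2, h3⟩ := Prog.pre.run (W := W) (σ := σ)
      (P := .seq (.put 17 (.add (.get a (.var 15)) (.flag (.sub (.const 2) (.var 16)))))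
      (.put 11 (.const 0))) (Q := fun σ' => (∀ e, e ≠ 11 → e ≠ 17 → σ' e = σ e) ∧
        σ' 11 0 = 0 ∧ σ' 17 0 = q) (by
      simp only [Prog.pre, Expr.eval, hw, hd, ← hq, write_same, if_true,
        write_of_ne _ _ _ (show 17 ≠ 11 by decide)]
      refine ⟨by omega, Nat.zero_le _, fun e h1 h2 => ?_, trivial, trivial⟩
      rw [write_of_ne _ _ _ h1, write_of_ne _ _ _ h2])
    exact ⟨t, σ', h1, h2.trans (by simp [Prog.size, Expr.cost]), h3⟩
  have hsize : (shiftBody a).size = (shiftBody 2).size := rfl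
  have hmain := Run.seq hpre fun σ₁ h => Run.seq (P' :=
      .seq (.set a (.var 13) (.var 17)) (.set b (.var 13) (.get b (.var 15)))) (c' := 20)
      (Q' := fun σ' => (∀ e, e ≠ 2 → e ≠ 3 → e ≠ 11 → e ≠ 17 → σ' e = σ e) ∧ σ' a u = q ∧
        σ' b u = σ b w ∧ (∀ j, j ≠ u → σ' b j = σ b j) ∧
        ∀ j < n, j ≠ u → σ' a j = if q ≤ σ a j then σ a j + 1 else σ a j)
      (run_shift (a := a) (q := q) (by omega) (by omega) hW (by
        rw [h.1 0 (by decide) (by decide), hn]) h.2.1 h.2.2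
        (by rw [h.1 a (by omega) (by omega)]; exact hle)) fun σ₂ h' => by
    obtain ⟨hf, h11, h17⟩ := h
    obtain ⟨hf', hv⟩ := h'
    have e13 : σ₂ 13 0 = u := by
      rw [hf' 13 (by omega) (by decide), hf 13 (by decide) (by decide), hu]
    have e15 : σ₂ 15 0 = w := by
      rw [hf' 15 (by omega) (by decide), hf 15 (by decide) (by decide), hw]
    have e17 : σ₂ 17 0 = q := by rw [hf' 17 (by omega) (by decide), h17]
    have eb : σ₂ b = σ b := by
      rw [hf' b hab.symm (by omega), hf b (by omega) (by omega)]
    rw [hf a (by omega) (by omega)] at hv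
    obtain ⟨t, σ', h1, h2, h3⟩ := Prog.pre.run (W := W) (σ := σ₂)
      (P := .seq (.set a (.var 13) (.var 17)) (.set b (.var 13) (.get b (.var 15))))
      (Q := fun σ' => (∀ e, e ≠ 2 → e ≠ 3 → e ≠ 11 → e ≠ 17 → σ' e = σ e) ∧ σ' a u = q ∧
        σ' b u = σ b w ∧ (∀ j, j ≠ u → σ' b j = σ b j) ∧
        ∀ j < n, j ≠ u → σ' a j = if q ≤ σ a j then σ a j + 1 else σ a j) (by
      simp only [Prog.pre, Expr.eval, e13, e17, write_of_ne _ _ _ hab.symm,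
        write_of_ne _ _ _ (show 15 ≠ a by omega), write_of_ne _ _ _ (show 13 ≠ a by omega), e15,
        eb, write_of_ne _ _ _ hab, write_same, if_true]
      refine ⟨by omega, by omega, fun e h2 h3 h4 h5 => ?_, trivial, trivial, fun j hj => ?_,
        fun j hjn hj => ?_⟩
      · rw [write_of_ne _ _ _ (by omega), write_of_ne _ _ _ (by omega), hf' e (by omega) h4,
          hf e h4 h5]
      · rw [if_neg hj]
      · rw [if_neg hj, hv]
        simp only [hjn, true_and])
    exact ⟨t, σ', h1, h2.trans (by simp [Prog.size, Expr.cost]), h3⟩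
  obtain ⟨t, σ', h1, h2, h3⟩ := hmain
  refine ⟨t, σ', h1, h2.trans ?_, h3⟩
  rw [hsize, placeTime]
  omega

/-- Takes the next vertex, and computes the direction of its insertion. -/
def advance : Prog :=
  .seq (.seq (.put 12 (.sub (.var 12) (.const 1)))
    (.seq (.put 13 (.get 7 (.var 12))) (.put 15 (.get 8 (.var 12)))))
  (.seq (.seq (.put 16 (.get 18 (.add (.get 9 (.var 15)) (.get 19 (.get 10 (.var 15))))))
    (.set 9 (.var 13) (.get 18 (.add (.var 16) (.const 2)))))
    (.seq (.set 10 (.var 15) (.add (.get 10 (.var 15)) (.const 1)))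
      (.set 10 (.var 13) (.const 1))))

lemma run_advance {t u w d b : ℕ} {σ : Memory} (ht : σ 12 0 = t + 1) (hu : σ 7 t = u)
    (hw : σ 8 t = w) (hd : σ 18 (σ 9 w + σ 19 (σ 10 w)) = d) (hb : σ 18 (d + 2) = b)
    (htW : t ≤ W) (huW : u ≤ W) (hwW : w ≤ W) (hdW : d ≤ W) (hbW : b ≤ W) (hcW : σ 10 w + 1 ≤ W) :
    Run W advance advance.size σ fun σ' =>
      (∀ e, e ≠ 9 → e ≠ 10 → e ≠ 12 → e ≠ 13 → e ≠ 15 → e ≠ 16 → σ' e = σ e) ∧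
        σ' 12 0 = t ∧ σ' 13 0 = u ∧ σ' 15 0 = w ∧ σ' 16 0 = d ∧
        (∀ j, σ' 9 j = if j = u then b else σ 9 j) ∧
        ∀ j, σ' 10 j = if j = u then 1 else if j = w then σ 10 w + 1 else σ 10 j := by
  refine Prog.pre.run (P := advance) ?_
  simp only [advance, Prog.pre, Expr.eval, write_same, ht, hu, hw, hd, hb, if_true,
    write_of_ne, ne_eq, Nat.reduceEqDiff, not_false_eq_true, Nat.add_sub_cancel]
  refine ⟨by omega, by omega, by omega, by omega, by omega, by omega, by omega, ?_, ?_⟩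
  · intro a h4 h5 h6 h7 h8 h12
    simp only [write_of_ne, ne_eq, *, not_false_eq_true]
  · simp

/-- Inserts the next vertex. -/
def insertBody : Prog :=
  -- The condition holds for the directions `0` and `2`, which need a new column.
  .seq advance (.ite (.add (.sub (.const 1) (.var 16)) (.sub (.sub (.var 16) (.const 1))
    (.add (.sub (.var 16) (.const 2)) (.sub (.var 16) (.const 2))))) (place 2 3) (place 3 2))

/-- Finds and removes the next leaf. -/
def peelBody : Prog :=
  .seq (.seq (.put 14 (.add (.var 0) (.const 1))) (.put 11 (.const 0)))
    (.seq findBody.for (.seq parent record))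

/-- The tables of the residues modulo `4` and of the slots. -/
def tables : Prog :=
  -- A residue is looked up only for a sum of two numbers at most `3`, so indices up to `6` suffice;
  -- the entries `0` and `4` are zero already.
  .seq (.seq (.seq (.set 18 (.const 1) (.const 1)) (.set 18 (.const 2) (.const 2)))
    (.seq (.set 18 (.const 3) (.const 3)) (.set 18 (.const 5) (.const 1))))
    (.seq (.seq (.set 18 (.const 6) (.const 2)) (.set 19 (.const 1) (.const 2)))
      (.seq (.seq (.set 19 (.const 2) (.const 3)) (.set 19 (.const 3) (.const 1)))
        (.put 11 (.const 0))))

lemma run_tables {σ : Memory} (hW : 9 ≤ W) (h18 : ∀ i, σ 18 i = 0) (h19 : ∀ i, σ 19 i = 0) :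
    Run W tables tables.size σ fun σ' => (∀ a, a ≠ 11 → a ≠ 18 → a ≠ 19 → σ' a = σ a) ∧
      σ' 11 0 = 0 ∧ (∀ i ≤ 6, σ' 18 i = i % 4) ∧
      ∀ j ≤ 3, σ' 19 j ≤ 3 ∧ ((σ' 19 j : ℕ) : ZMod 4) = StraightModel.slotOf j := by
  refine Prog.pre.run (P := tables) ?_
  simp only [tables, Prog.pre, Expr.eval, write_same, if_true,
    write_of_ne, ne_eq, Nat.reduceEqDiff, not_false_eq_true, h18, h19]
  refine ⟨by omega, by omega, by omega, by omega, by omega, by omega, by omega, by omega,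
    by omega, ?_, ?_, ?_, ?_⟩
  · intro a h4 h5 h6
    simp only [write_of_ne, ne_eq, *, not_false_eq_true]
  · trivial
  · intro i hi
    interval_cases i <;> rfl
  · intro j hj
    interval_cases j <;> exact ⟨by decide, rfl⟩

/-- The program that draws a tree. -/
def drawTree : Prog :=
  .seq tables (.seq degreeBody.for
    (.seq (.while (.sub (.sub (.var 0) (.const 1)) (.var 12)) peelBody)
      (.while (.var 12) insertBody)))

end RAM

/-! ### Correctness of one round of each main loop. -/

namespace RAM

open StraightModel

variable {W n : ℕ} {T : SimpleGraph (Fin n)} {ι τ σ : Memory} {r p : ℕ → Fin n} {x : ℕ → ℕ}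

/-- The nonempty cells of the adjacency list correspond one to one to the neighbours, and `1 - (1 -
m)` indicates whether `m ≠ 0`. -/
lemma IsInput.degree (h : IsInput T ι) (v : Fin n) :
    (1 - (1 - ι 1 (4 * v + 0))) + (1 - (1 - ι 1 (4 * v + 1))) +
      ((1 - (1 - ι 1 (4 * v + 2))) + (1 - (1 - ι 1 (4 * v + 3)))) = (T.neighborSet v).ncard := by
  set K := (Finset.range 4).filter fun k => ι 1 (4 * v + k) ≠ 0 with hK
  have himg : (fun k => ι 1 (4 * v + k) - 1) '' (K : Set ℕ) = Fin.val '' T.neighborSet v := by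
    ext j
    simp only [Set.mem_image, hK, Finset.coe_filter, Finset.mem_range, Set.mem_ofPred_eq]
    constructor
    · rintro ⟨k, ⟨hk, hk0⟩, rfl⟩
      obtain ⟨w, hw, hkw⟩ := (h.entry v k hk).resolve_left hk0
      exact ⟨w, hw, by omega⟩
    · rintro ⟨w, hw, rfl⟩
      obtain ⟨k, ⟨hk, hkw⟩, -⟩ := h.adj v w hw
      exact ⟨k, ⟨hk, by omega⟩, by omega⟩
  have hinj : Set.InjOn (fun k => ι 1 (4 * v + k) - 1) (K : Set ℕ) := by
    intro k hk k' hk' hkk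
    simp only [hK, Finset.coe_filter, Finset.mem_range, Set.mem_ofPred_eq] at hk hk' hkk
    obtain ⟨w, hw, hkw⟩ := (h.entry v k hk.1).resolve_left hk.2
    exact (h.adj v w hw).unique ⟨hk.1, hkw⟩ ⟨hk'.1, by omega⟩
  rw [← Set.ncard_image_of_injective _ Fin.val_injective, ← himg, hinj.ncard_image,
    Set.ncard_coe_finset, hK, Finset.card_filter]
  have hflag : ∀ m : ℕ, (if m ≠ 0 then 1 else 0) = 1 - (1 - m) := fun m => by
    split_ifs <;> omega
  simp only [hflag, Finset.sum_range_succ, Finset.sum_range_zero]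
  omega

/-- The memory after `t` removals of leaves. -/
structure PeelMemory (T : SimpleGraph (Fin n)) (τ : Memory) (r p : ℕ → Fin n) (x : ℕ → ℕ) (t : ℕ)
    (σ : Memory) : Prop where
  state : PeelState T r p x t (fun v => σ 4 v) (fun v => σ 5 v) (fun v => σ 6 v)
  time : σ 12 0 = t
  steps : ∀ s < t, σ 7 s = r s ∧ σ 8 s = p s
  frame : ∀ a, a < 4 ∨ (8 < a ∧ a < 11) ∨ 17 < a → σ a = τ a

/-- A bound for the running time of `peelBody`. -/
def peelTime (n : ℕ) : ℕ := 9 + ((findBody.size + 12) * n + 6 + (parent.size + record.size))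

/-- One round carries out `PeelState.succ` in memory: the scan supplies the leaf of least value, and
the adjacency list its remaining neighbour. -/
lemma run_peel (hT : T.IsTree) (hdeg : ∀ v, (T.neighborSet v).ncard ≤ 4) (hW : n + 9 ≤ W)
    (hι : IsInput T ι) (hn : τ 0 0 = n) (h1 : τ 1 = ι 1) {t : ℕ} (ht : t + 1 < n)
    (h : PeelMemory T τ r p x t σ) :
    Run W peelBody (peelTime n) σ fun σ' => ∃ r p x, PeelMemory T τ r p x (t + 1) σ' := by
  have hpre := Prog.pre.run (W := W) (σ := σ)
    (P := .seq (.put 14 (.add (.var 0) (.const 1))) (.put 11 (.const 0)))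
    (Q := fun σ' => (∀ a, a ≠ 11 → a ≠ 14 → σ' a = σ a) ∧ σ' 14 0 = n + 1 ∧ σ' 11 0 = 0) (by
      simp only [Prog.pre, Expr.eval, h.frame 0 (by decide), hn, write_same, if_true,
        write_of_ne _ _ _ (show 14 ≠ 11 by decide)]
      refine ⟨by omega, Nat.zero_le _, fun e h1 h2 => ?_, trivial, trivial⟩
      rw [write_of_ne _ _ _ h1, write_of_ne _ _ _ h2])
  refine hpre.seq fun σ₁ ⟨f1, g14, g11⟩ => ?_
  have hfind := run_find (W := W) (n := n) (σ := σ₁) hW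
    (by rw [f1 0 (by decide) (by decide), h.frame 0 (by decide), hn]) g11 g14
    (by
      intro v hv
      rw [f1 5 (by decide) (by decide)]
      exact (h.state.cand_le ⟨v, hv⟩).trans (by omega))
    (by
      obtain ⟨u, w, hu, -⟩ := h.state.exists_deg_one hT hdeg (by rwa [Nat.card_fin])
      refine ⟨u, u.2, ?_⟩
      rw [f1 4 (by decide) (by decide)]
      exact hu)
  rw [f1 4 (by decide) (by decide), f1 5 (by decide) (by decide)] at hfind
  refine hfind.seq fun σ₂ ⟨f2, hun, hu, hmin⟩ => ?_
  have e2 : ∀ a, a ≠ 11 → a ≠ 13 → a ≠ 14 → σ₂ a = σ a := fun a h1 h2 h3 => by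
    rw [f2 a h1 h2 h3, f1 a h1 h3]
  have c1 : σ₂ 1 = ι 1 := by
    rw [e2 1 (by decide) (by decide) (by decide), h.frame 1 (by decide), h1]
  have c4 : σ₂ 4 = σ 4 := e2 4 (by decide) (by decide) (by decide)
  obtain ⟨u, hu'⟩ : ∃ u : Fin n, (u : ℕ) = σ₂ 13 0 := ⟨⟨_, hun⟩, rfl⟩
  rw [← hu'] at hu hmin
  have hua := h.state.mem_aliveAt (v := u) (by omega)
  have hpar := run_parent (W := W) (n := n) (σ := σ₂) hW
    (by
      intro k hk
      rw [c1, ← hu']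
      rcases hι.entry u k hk with h0 | ⟨w, -, hw⟩
      · omega
      · rw [hw]; exact w.2)
    (by
      rw [h.state.deg_eq u hua, Set.ncard_eq_one] at hu
      obtain ⟨w, hw⟩ := hu
      have hw' : w ∈ T.neighborSet u ∩ aliveAt r t := hw ▸ Set.mem_singleton w
      obtain ⟨k, ⟨hk, hkw⟩, -⟩ := hι.adj u w hw'.1
      refine ⟨k, hk, w, by rw [c1, ← hu', hkw], ?_⟩
      rw [c4]
      exact h.state.deg_pos hw'.2 hua hw'.1.symm)
  refine hpar.seq fun σ₃ ⟨f3, k, hk, hkw, hw4⟩ => ?_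
  rw [c1, ← hu'] at hkw
  rw [c4] at hw4
  obtain ⟨w, huw, hw⟩ := (hι.entry u k hk).resolve_left (by omega)
  have h15 : σ₃ 15 0 = w := by omega
  rw [h15] at hw4
  have hwa := h.state.mem_aliveAt (v := w) hw4
  have e3 : ∀ a, a ≠ 11 → a ≠ 13 → a ≠ 14 → a ≠ 15 → σ₃ a = σ a := fun a h1 h2 h3 h4 => by
    rw [f3 a h4, e2 a h1 h2 h3]
  have hdw : σ 4 w ≤ 4 := by
    rw [h.state.deg_eq w hwa]
    exact (Set.ncard_le_ncard Set.inter_subset_left (Set.toFinite _)).trans (hdeg w)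
  have hcu : σ 5 u ≤ t := h.state.cand_le u
  have hnw : σ 6 w ≤ t := h.state.next_le w
  have hrec := run_record (W := W) (n := n) (t := t) (u := u) (w := w) (σ := σ₃) hW
    (by rw [e3 12 (by decide) (by decide) (by decide) (by decide), h.time])
    (by rw [f3 13 (by decide), hu']) h15 u.2 w.2 (fun hh => huw.ne (Fin.ext hh)) (by omega)
    (by rw [e3 5 (by decide) (by decide) (by decide) (by decide)]; omega)
    (by rw [e3 6 (by decide) (by decide) (by decide) (by decide)]; omega)
    (by rw [e3 4 (by decide) (by decide) (by decide) (by decide)]; exact hdw)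
  rw [e3 4 (by decide) (by decide) (by decide) (by decide),
    e3 5 (by decide) (by decide) (by decide) (by decide),
    e3 6 (by decide) (by decide) (by decide) (by decide),
    e3 7 (by decide) (by decide) (by decide) (by decide),
    e3 8 (by decide) (by decide) (by decide) (by decide)] at hrec
  refine hrec.mono fun σ₄ ⟨f4, g12, g7, g8, g5, g6, g4⟩ => ?_
  refine ⟨Function.update r t u, Function.update p t w, Function.update x t (σ 5 u), ?_, g12,
    fun s hs => ?_, fun a ha => ?_⟩
  · convert h.state.succ (u := u) (w := w) hu (fun v hv => hmin v v.2 hv) huw hwa using 1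
    · funext v
      simp only [g4, Function.update_apply, Fin.ext_iff]
    · funext v
      simp only [g5, Function.update_apply, Fin.ext_iff]
    · funext v
      simp only [g6, Function.update_apply, Fin.ext_iff]
  · rw [g7, g8]
    by_cases hst : s = t
    · subst hst
      simp
    · rw [if_neg hst, if_neg hst, Function.update_of_ne hst, Function.update_of_ne hst]
      exact h.steps s (by omega)
  · rw [f4 a (by omega) (by omega) (by omega) (by omega) (by omega) (by omega),
      e3 a (by omega) (by omega) (by omega) (by omega), h.frame a ha]

/-- The memory when the vertices `r s`, `t ≤ s < N`, and `c` are drawn. -/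
structure DrawMemory (T : SimpleGraph (Fin n)) (r p : ℕ → Fin n) (N : ℕ) (c : Fin n) (t : ℕ)
    (σ : Memory) : Prop where
  size : σ 0 0 = n
  residue : ∀ i ≤ 6, σ 18 i = i % 4
  slot : ∀ j ≤ 3, σ 19 j ≤ 3 ∧ ((σ 19 j : ℕ) : ZMod 4) = slotOf j
  time : σ 12 0 = t
  steps : ∀ s < N, σ 7 s = r s ∧ σ 8 s = p s
  drawing : Drawing T r p N c t (outputModel σ) fun v => ((σ 9 v : ℕ) : ZMod 4)
  count : ∀ v ∈ aliveAt r t, σ 10 v = slotCnt p N c t v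
  base_le : ∀ v : Fin n, σ 9 v ≤ 3
  coord_le : ∀ j < n, σ 2 j + t ≤ N ∧ σ 3 j + t ≤ N

/-- A bound for the running time of `insertBody`. -/
def insertTime (n : ℕ) : ℕ := advance.size + (20 + placeTime n)

/-- One round carries out `Drawing.insert`. It increases the largest coordinate by at most one, so
coordinates stay below the number of vertices inserted; this gives the word bound. -/
lemma run_insert (hdeg : ∀ v, (T.neighborSet v).ncard ≤ 4) (hW : n + 9 ≤ W) {N t : ℕ} {c : Fin n}
    (hP : Peel T r p x N) (hc : Peel.Complete r c N) (hN : N ≤ n) (ht : t < N)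
    (h : DrawMemory T r p N c (t + 1) σ) :
    Run W insertBody (insertTime n) σ (DrawMemory T r p N c t) := by
  have hslot : slotNo p N c t ≤ 3 := hP.slotNo_le hc hdeg ht
  have hpa := hP.parent_mem ht
  have hne : p t ≠ r t := (hP.adj t ht).ne'
  have hnev : (p t : ℕ) ≠ r t := fun hh => hne (Fin.ext hh)
  have hcnt : σ 10 (p t) = slotNo p N c t := by rw [h.count _ hpa, slotNo_eq]
  obtain ⟨hs1, hs2⟩ := h.slot _ hslot
  have hb1 := h.base_le (p t)
  have hd := h.residue (σ 9 (p t) + σ 19 (slotNo p N c t)) (by omega)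
  rw [← hcnt] at hd
  obtain ⟨d, hdd⟩ : ∃ d, d = (σ 9 (p t) + σ 19 (σ 10 (p t))) % 4 := ⟨_, rfl⟩
  have hd4 : d < 4 := by omega
  rw [← hdd] at hd
  have hdz : (d : ZMod 4) = (σ 9 (p t) : ℕ) + slotOf (slotNo p N c t) := by
    rw [hdd, ZMod.natCast_mod, Nat.cast_add, hcnt, hs2]
  obtain ⟨h7, h8⟩ := h.steps t ht
  have hun := (r t).2
  have hwn := (p t).2
  have hadv := run_advance (W := W) (t := t) (u := r t) (w := p t) (d := d) (b := (d + 2) % 4)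
    (σ := σ) h.time h7 h8 hd (h.residue (d + 2) (by omega)) (by omega) (by omega) (by omega)
    (by omega) (by omega) (by omega)
  refine hadv.seq fun σ₁ ⟨f1, g12, g13, g15, g16, g9, g10⟩ => ?_
  have c2 : σ₁ 2 = σ 2 :=
    f1 2 (by decide) (by decide) (by decide) (by decide) (by decide) (by decide)
  have c3 : σ₁ 3 = σ 3 :=
    f1 3 (by decide) (by decide) (by decide) (by decide) (by decide) (by decide)
  have key : ∀ σ', (∀ e, e ≠ 2 → e ≠ 3 → e ≠ 11 → e ≠ 17 → σ' e = σ₁ e) →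
      (∀ j < n, σ' 2 j + t ≤ N ∧ σ' 3 j + t ≤ N) →
      Drawing T r p N c t (outputModel σ') (fun v => ((σ' 9 v : ℕ) : ZMod 4)) →
      DrawMemory T r p N c t σ' := by
    intro σ' hf hco hD
    have e : ∀ e, e ≠ 2 → e ≠ 3 → e ≠ 9 → e ≠ 10 → e ≠ 11 → e ≠ 12 → e ≠ 13 → e ≠ 15 → e ≠ 16 →
        e ≠ 17 → σ' e = σ e := fun e h1 h2 h3 h4 h5 h6 h7 h8 h9 h10 => by
      rw [hf e h1 h2 h5 h10, f1 e h3 h4 h6 h7 h8 h9]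
    refine ⟨?_, ?_, ?_, ?_, ?_, hD, fun v hv => ?_, fun v => ?_, hco⟩
    · rw [e 0 (by decide) (by decide) (by decide) (by decide) (by decide) (by decide) (by decide)
        (by decide) (by decide) (by decide), h.size]
    · rw [e 18 (by decide) (by decide) (by decide) (by decide) (by decide) (by decide) (by decide)
        (by decide) (by decide) (by decide)]
      exact h.residue
    · rw [e 19 (by decide) (by decide) (by decide) (by decide) (by decide) (by decide) (by decide)
        (by decide) (by decide) (by decide)]
      exact h.slot
    · rw [hf 12 (by decide) (by decide) (by decide) (by decide), g12]
    · rw [e 7 (by decide) (by decide) (by decide) (by decide) (by decide) (by decide) (by decide)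
        (by decide) (by decide) (by decide), e 8 (by decide) (by decide) (by decide) (by decide)
        (by decide) (by decide) (by decide) (by decide) (by decide) (by decide)]
      exact h.steps
    · rw [hf 10 (by decide) (by decide) (by decide) (by decide), g10]
      split_ifs with hvr hvp
      · rw [Fin.ext hvr, hP.slotCnt_new hc ht]
      · rw [Fin.ext hvp, slotCnt_parent ht, ← slotNo_eq, hcnt]
      · have hv' : v ∈ aliveAt r (t + 1) :=
          mem_aliveAt_succ.2 ⟨hv, fun hh => hvr (congrArg Fin.val hh)⟩
        rw [h.count v hv', slotCnt_of_ne fun hh => hvp (congrArg Fin.val hh)]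
    · rw [hf 9 (by decide) (by decide) (by decide) (by decide), g9]
      split_ifs
      · omega
      · exact h.base_le v
  have hbase : ∀ σ' : Memory, (∀ e, e ≠ 2 → e ≠ 3 → e ≠ 11 → e ≠ 17 → σ' e = σ₁ e) →
      (∀ v, v ≠ r t → ((σ' 9 v : ℕ) : ZMod 4) = (σ 9 v : ℕ)) ∧
      ((σ' 9 (r t) : ℕ) : ZMod 4) = d + 2 := by
    intro σ' hf
    rw [hf 9 (by decide) (by decide) (by decide) (by decide)]
    refine ⟨fun v hv => ?_, ?_⟩
    · rw [g9, if_neg fun hh => hv (Fin.ext hh)]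
    · rw [g9, if_pos rfl, ZMod.natCast_mod]
      push_cast
      rfl
  have hshift : ∀ q y : ℕ, ((if q ≤ y then y + 1 else y : ℕ) : ℤ) = shiftAt q y := fun q y => by
    rw [shiftAt]
    split_ifs <;> omega
  have hcw := h.coord_le _ hwn
  refine Run.ite (e := .add (.sub (.const 1) (.var 16)) (.sub (.sub (.var 16) (.const 1))
    (.add (.sub (.var 16) (.const 2)) (.sub (.var 16) (.const 2))))) (fun he => ?_) fun he => ?_
  · simp only [Expr.eval, g16] at he
    have := run_place (W := W) (n := n) (q := σ₁ 2 (p t) + (1 - (1 - (2 - d)))) (Or.inl rfl)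
      (Or.inr rfl) (by decide) hW
      (by rw [f1 0 (by decide) (by decide) (by decide) (by decide) (by decide) (by decide), h.size])
      g13 g15 g16 hnev hwn rfl
      (fun j hj => by rw [c2]; have := h.coord_le j hj; omega) (by rw [c3]; omega)
    rw [c2, c3] at this
    refine this.mono fun σ' ⟨hf, h1, h2, h3, h4⟩ => key σ' hf (fun j hj => ?_) ?_
    · have := h.coord_le j hj
      by_cases hjr : j = r t
      · rw [hjr, h1, h2]
        omega
      · rw [h3 j hjr, h4 j hj hjr]
        split_ifs <;> omega
    · obtain ⟨b1, b2⟩ := hbase σ' hf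
      refine h.drawing.insert hP hc hdeg ht hdz b1 b2
        (q := ((σ 2 (p t) + (1 - (1 - (2 - d))) : ℕ) : ℤ)) (Or.inl ⟨?_, fun v hv => ?_, ?_⟩)
      · have hd02 : d = 0 ∨ d = 2 := by omega
        rcases hd02 with rfl | rfl
        · exact Or.inl ⟨rfl, by simp [outputModel]⟩
        · exact Or.inr ⟨rfl, by simp [outputModel]⟩
      · have hvr : (v : ℕ) ≠ r t := fun hh => (mem_aliveAt_succ.1 hv).2 (Fin.ext hh)
        rw [outputModel, h3 v hvr, h4 v v.2 hvr, hshift]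
        rfl
      · rw [outputModel, h1, h2]
        rfl
  · simp only [Expr.eval, g16] at he
    have := run_place (W := W) (n := n) (q := σ₁ 3 (p t) + (1 - (1 - (2 - d)))) (Or.inr rfl)
      (Or.inl rfl) (by decide) hW
      (by rw [f1 0 (by decide) (by decide) (by decide) (by decide) (by decide) (by decide), h.size])
      g13 g15 g16 hnev hwn rfl
      (fun j hj => by rw [c3]; have := h.coord_le j hj; omega) (by rw [c2]; omega)
    rw [c2, c3] at this
    refine this.mono fun σ' ⟨hf, h1, h2, h3, h4⟩ => key σ' hf (fun j hj => ?_) ?_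
    · have := h.coord_le j hj
      by_cases hjr : j = r t
      · rw [hjr, h1, h2]
        omega
      · rw [h3 j hjr, h4 j hj hjr]
        split_ifs <;> omega
    · obtain ⟨b1, b2⟩ := hbase σ' hf
      refine h.drawing.insert hP hc hdeg ht hdz b1 b2
        (q := ((σ 3 (p t) + (1 - (1 - (2 - d))) : ℕ) : ℤ)) (Or.inr ⟨?_, fun v hv => ?_, ?_⟩)
      · have hd13 : d = 1 ∨ d = 3 := by omega
        rcases hd13 with rfl | rfl
        · exact Or.inl ⟨rfl, by simp [outputModel]⟩
        · exact Or.inr ⟨rfl, by simp [outputModel]⟩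
      · have hvr : (v : ℕ) ≠ r t := fun hh => (mem_aliveAt_succ.1 hv).2 (Fin.ext hh)
        rw [outputModel, h3 v hvr, h4 v v.2 hvr, hshift]
        rfl
      · rw [outputModel, h1, h2]
        rfl

end RAM

/-! ### The whole program and its running time. -/

namespace RAM

open StraightModel

variable {W n : ℕ} {T : SimpleGraph (Fin n)} {ι : Memory}

/-- A bound for the running time of `drawTree`. -/
def drawTime (n : ℕ) : ℕ :=
  tables.size + ((degreeBody.size + 12) * n + 6 +
    ((peelTime n + 7 + 1) * (n - 1) + (7 + 1) + ((insertTime n + 2 + 1) * (n - 1) + (2 + 1))))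

/-- Both main loops have `n - 1` rounds of linear cost; the coefficients come from the constant
sizes of the loop-free pieces. -/
lemma drawTime_le (hn : n ≠ 0) : drawTime n ≤ 2000 * n ^ 2 := by
  obtain ⟨m, rfl⟩ := Nat.exists_eq_succ_of_ne_zero hn
  have h1 : tables.size + degreeBody.size + findBody.size + parent.size + record.size + advance.size
    + (shiftBody 2).size ≤ 500 := by decide
  simp only [drawTime, peelTime, insertTime, placeTime, Nat.succ_eq_add_one, Nat.add_sub_cancel]
  generalize tables.size = a1 at *
  generalize degreeBody.size = a2 at *
  generalize findBody.size = a3 at *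
  generalize parent.size = a4 at *
  generalize record.size = a5 at *
  generalize advance.size = a6 at *
  generalize (shiftBody 2).size = a7 at *
  nlinarith [Nat.mul_le_mul_right m h1, Nat.mul_le_mul_right (m * m) h1]

theorem run_drawTree (hT : T.IsTree) (hdeg : ∀ v, (T.neighborSet v).ncard ≤ 4) (hW : n + 9 ≤ W)
    (hι : IsInput T ι) : Run W drawTree (drawTime n) ι fun σ =>
      ∃ v₀ l, IncrementallyBuilt T v₀ l ∧ Produces T v₀ l (outputModel σ) := by
  have hblank : ∀ a i, 1 < a → ι a i = 0 := fun a i ha => hι.blank a i (by omega) (by omega)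
  obtain ⟨v₁⟩ := hT.connected.nonempty
  have hpos : 0 < n := v₁.pos
  refine (run_tables (by omega) (fun i => hblank _ i (by decide))
    fun i => hblank _ i (by decide)).seq fun σ₁ ⟨f1, g11, g18, g19⟩ => ?_
  refine (run_degree (n := n) hW (by rw [f1 0 (by decide) (by decide) (by decide), hι.size])
    g11).seq fun τ ⟨f2, g4⟩ => ?_
  have e : ∀ a, a ≠ 4 → a ≠ 11 → a ≠ 18 → a ≠ 19 → τ a = ι a := fun a h1 h2 h3 h4 => by
    rw [f2 a h1 h2, f1 a h2 h3 h4]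
  have hτ : ∀ a i, 1 < a → a ≠ 4 → a ≠ 11 → a ≠ 18 → a ≠ 19 → τ a i = 0 :=
    fun a i h0 h1 h2 h3 h4 => by rw [e a h1 h2 h3 h4, hblank a i h0]
  have hτ0 : τ 0 0 = n := by
    rw [e 0 (by decide) (by decide) (by decide) (by decide), hι.size]
  have hinit : PeelMemory T τ (fun _ => v₁) (fun _ => v₁) (fun _ => 0) 0 τ := by
    refine ⟨PeelState.zero _ _ _ (fun v => ?_) (fun v => hτ 5 v (by decide) (by decide) (by decide)
      (by decide) (by decide)) (fun v => hτ 6 v (by decide) (by decide) (by decide)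
      (by decide) (by decide)), hτ 12 0 (by decide) (by decide) (by decide) (by decide) (by decide),
      fun s hs => absurd hs (Nat.not_lt_zero s), fun _ _ => rfl⟩
    rw [g4 v v.2, f1 1 (by decide) (by decide) (by decide), hι.degree]
  refine (Run.loop (W := W) (c := peelTime n) (m := n - 1)
    (I := fun t σ => ∃ r p x, PeelMemory T τ r p x t σ) ⟨_, _, _, hinit⟩ ?_ ?_).seq ?_
  · rintro t ht σ ⟨r, p, x, h⟩
    refine ⟨?_, run_peel hT hdeg hW hι hτ0 (e 1 (by decide) (by decide) (by decide) (by decide))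
      (by omega) h⟩
    simp only [Expr.eval, h.frame 0 (by decide), hτ0, h.time]
    omega
  · rintro σ ⟨r, p, x, h⟩
    simp only [Expr.eval, h.frame 0 (by decide), hτ0, h.time]
    omega
  rintro σ₂ ⟨r, p, x, h⟩
  obtain ⟨c, hc⟩ := h.state.complete (by rw [Nat.card_fin]; omega)
  have hfr := h.frame
  have hzero : ∀ a i, a = 2 ∨ a = 3 ∨ a = 9 ∨ a = 10 → σ₂ a i = 0 := fun a i ha => by
    rw [hfr a (by omega), hτ a i (by omega) (by omega) (by omega) (by omega) (by omega)]
  have hdraw : DrawMemory T r p (n - 1) c (n - 1) σ₂ := by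
    refine ⟨?_, ?_, ?_, h.time, h.steps, hc.drawing, fun v hv => ?_, fun v => ?_, fun j _ => ?_⟩
    · rw [hfr 0 (by decide), hτ0]
    · rw [hfr 18 (by decide), f2 18 (by decide) (by decide)]
      exact g18
    · rw [hfr 19 (by decide), f2 19 (by decide) (by decide)]
      exact g19
    · rw [hc.aliveAt_eq] at hv
      rw [Set.mem_singleton_iff.1 hv, slotCnt_last, hzero _ _ (by decide)]
    · rw [hzero _ _ (by decide)]
      exact Nat.zero_le _
    · rw [hzero _ _ (by decide), hzero _ _ (by decide)]
      omega
  -- The clock now runs backwards: after `k` insertions the time is `n - 1 - k`, and the removals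
  -- are undone in reverse order.
  refine (Run.loop (W := W) (c := insertTime n) (m := n - 1)
    (I := fun k => DrawMemory T r p (n - 1) c (n - 1 - k)) hdraw ?_ ?_).mono ?_
  · intro k hk σ hσ
    obtain ⟨t, ht⟩ : ∃ t, n - 1 - k = t + 1 := ⟨n - 1 - k - 1, by omega⟩
    rw [ht] at hσ
    refine ⟨?_, ?_⟩
    · simp only [Expr.eval, hσ.time]
      omega
    · rw [show n - 1 - (k + 1) = t by omega]
      exact run_insert hdeg hW h.state.peel hc (by omega) (by omega) hσ
  · intro σ hσ
    simp only [Expr.eval, hσ.time]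
    omega
  · intro σ hσ
    rw [Nat.sub_self] at hσ
    exact hσ.drawing.exists_produces hT h.state.peel hc hdeg

end RAM

lemma SimpleGraph.ncard_neighborSet_le {V : Type*} [Fintype V] {T : SimpleGraph V}
    [DecidableRel T.Adj] {k : ℕ} (h : T.maxDegree ≤ k) (v : V) : (T.neighborSet v).ncard ≤ k := by
  rw [Set.ncard_eq_toFinset_card', ← SimpleGraph.neighborFinset_def,
    SimpleGraph.card_neighborFinset_eq_degree]
  exact (T.degree_le_maxDegree v).trans h

theorem mainTheorem1 :
    -- correctness: every execution of the algorithm ends with an optimal s-model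
    (∀ {V : Type*} [Fintype V] (T : SimpleGraph V) [DecidableRel T.Adj],
      T.IsTree → T.maxDegree ≤ 4 →
        (∃ v₀ l, StraightModel.IncrementallyBuilt T v₀ l) ∧
        ∀ v₀ l, StraightModel.IncrementallyBuilt T v₀ l →
          (∃ M, StraightModel.Produces T v₀ l M) ∧
          ∀ M, StraightModel.Produces T v₀ l M →
            StraightModel.IsSModel T Set.univ M ∧
            StraightModel.modelBends T Set.univ M = StraightModel.treeBends T) ∧
    -- running time: the algorithm can be carried out in quadratic time
    (∃ (P : RAM.Prog) (C : ℕ), ∀ (n : ℕ) (T : SimpleGraph (Fin n)) [DecidableRel T.Adj],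
      T.IsTree → T.maxDegree ≤ 4 → ∀ σ : RAM.Memory, RAM.IsInput T σ →
        ∃ (t : ℕ) (σ' : RAM.Memory), RAM.Exec (C * n) P σ t σ' ∧ t ≤ C * n ^ 2 ∧
          ∃ v₀ l, StraightModel.IncrementallyBuilt T v₀ l ∧
            StraightModel.Produces T v₀ l (RAM.outputModel σ')) := by
  refine ⟨fun {V} _ T _ hT hd => ⟨StraightModel.exists_incrementallyBuilt hT, fun v₀ l hl =>
    ⟨hl.1.exists_produces hT (T.ncard_neighborSet_le hd), fun M hM => hM.optimal hT hl⟩⟩,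
    RAM.drawTree, 2000, fun n T _ hT hd σ hσ => ?_⟩
  obtain ⟨v⟩ := hT.connected.nonempty
  have hn : 0 < n := v.pos
  -- The word bound needed is `n + 9`, which is at most `2000 * n` because a tree has a vertex.
  obtain ⟨t, σ', h1, h2, h3⟩ := RAM.run_drawTree (W := 2000 * n) hT (T.ncard_neighborSet_le hd)
    (by omega) hσ
  exact ⟨t, σ', h1, h2.trans (RAM.drawTime_le hn.ne'), h3⟩
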